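/- **Theorem 1 (M-Adjustment).** Let $\mathbf V=\mathbf V_o\cup\mathbf V_m$ be a finite set of variables, where $\mathbf V_o$ are always observed and $\mathbf V_m$ are partially observed, and let $\mathbf R=\{R_v : v\in\mathbf V_m\}$ be binary missingness indicators ($R_v=1$ if $v$ is observed, $R_v=0$ if it is missing). Let $G$ be an m-graph, i.e. an acyclic graph on $\mathbf V\cup\mathbf R$ with directed edges and with bidirected edges (the latter standing for unobserved common causes) in which no $R_v$ is a parent of a variable in $\mathbf V$. Let $\mathbf X,\mathbf Y,\mathbf Z\subseteq\mathbf V$ be pairwise disjoint, $\mathbf W=\mathbf V_m\cap(\mathbf X\cup\mathbf Y\cup\mathbf Z)$ and $\mathbf R_{\mathbf W}=\{R_v: v\in\mathbf W\}$. Call $\mathbf Z$ an *m-adjustment set* for the causal effect of $\mathbf X$ on $\mathbf Y$ if, for every structural causal model compatible with $G$ whose variables have finite domains, and for all values $\mathbf x,\mathbf y$, $$P(\mathbf y\mid do(\mathbf x))=\sum_{\mathbf z}P(\mathbf y\mid \mathbf x,\mathbf z,\mathbf R_{\mathbf W}=1)\,P(\mathbf z\mid \mathbf R_{\mathbf W}=1)$$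 whenever the right-hand side is defined, i.e. whenever $P(\mathbf R_{\mathbf W}=1)>0$ and $P(\mathbf x,\mathbf z,\mathbf R_{\mathbf W}=1)>0$ for every $\mathbf z$ with $P(\mathbf z,\mathbf R_{\mathbf W}=1)>0$ (terms with $P(\mathbf z\mid\mathbf R_{\mathbf W}=1)=0$ count as $0$). Write $G_{\overline{\mathbf X}}$ for $G$ without the edges having an arrowhead at a node of $\mathbf X$, and $G_{\underline{\mathbf X}}$ for $G$ without the directed edges out of nodes of $\mathbf X$. A path from a node of $\mathbf X$ to a node of $\mathbf Y$ is *proper* if only its first node lies in $\mathbf X$, and *causal* if all its edges are directed away from its first node. Every node is a descendant and an ancestor of itself. Then $\mathbf Z$ is an m-adjustment set for the causal effect of $\mathbf X$ on $\mathbf Y$ if and only if the following four conditions hold: (a) no element of $\mathbf Z$ is a descendant in $G_{\overline{\mathbf X}}$ of any node $W\notin\mathbf X$ that lies on a proper causal path from $\mathbf X$ to $\mathbf Y$; (b) all proper non-causal paths from $\mathbf X$ to $\mathbf Y$ in $G$ are blocked by $\mathbf Z\cup\mathbf R_{\mathbf W}$; (c) $\mathbf Y$ is d-separated from $\mathbf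 R_{\mathbf W}$ given $\mathbf X$ in $G_{\overline{\mathbf X}}$; (d) every $X\in\mathbf X$ that is an ancestor of $\mathbf R_{\mathbf W}$ in $G$ is d-separated (given the empty set) from $\mathbf Y$ in $G_{\underline{\mathbf X}}$. -/

import Mathlib

open scoped BigOperators

/-! ### Mixed causal graphs -/

/-- An acyclic directed mixed graph: `dir a b` is the edge `a → b`, `bi a b` is the dashed
bidirected edge `a ↔ b` (an unobserved common cause of `a` and `b`). -/
structure ADMG (N : Type*) where
  dir : N → N → Prop
  bi : N → N → Prop
  bi_symm : ∀ a b, bi a b → bi b a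
  bi_irrefl : ∀ a, ¬ bi a a
  acyclic : ∀ a, ¬ Relation.TransGen dir a a

/-- The way in which an edge is traversed: along its direction, against it, or bidirected. -/
inductive EdgeKind
  | fwd
  | bwd
  | bidir

/-- Traversing the edge, is there an arrowhead at the node we arrive at? -/
def EdgeKind.HeadAtEnd : EdgeKind → Prop
  | fwd => True
  | bwd => False
  | bidir => True

/-- Traversing the edge, is there an arrowhead at the node we leave? -/
def EdgeKind.HeadAtStart : EdgeKind → Prop
  | fwd => False
  | bwd => True
  | bidir => True

namespace ADMG

variable {N : Type*}

/-- There is an edge of kind `k` from `a` to `b`. -/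
def Step (G : ADMG N) : EdgeKind → N → N → Prop
  | EdgeKind.fwd, a, b => G.dir a b
  | EdgeKind.bwd, a, b => G.dir b a
  | EdgeKind.bidir, a, b => G.bi a b

/-- `b` is a descendant of `a`, equivalently `a` is an ancestor of `b`; every node counts as a
descendant and as an ancestor of itself. -/
def Desc (G : ADMG N) (a b : N) : Prop := Relation.ReflTransGen G.dir a b

/-- The graph obtained by deleting all edges with an arrowhead at a node of `S`. -/
def removeIn (G : ADMG N) (S : Set N) : ADMG N where
  dir a b := G.dir a b ∧ b ∉ S
  bi a b := G.bi a b ∧ a ∉ S ∧ b ∉ S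
  bi_symm a b h := ⟨G.bi_symm a b h.1, h.2.2, h.2.1⟩
  bi_irrefl a h := G.bi_irrefl a h.1
  acyclic a h := G.acyclic a (Relation.TransGen.mono (fun _ _ h => h.1) a a h)

/-- The graph obtained by deleting all directed edges that leave a node of `S`. -/
def removeOut (G : ADMG N) (S : Set N) : ADMG N where
  dir a b := G.dir a b ∧ a ∉ S
  bi := G.bi
  bi_symm := G.bi_symm
  bi_irrefl := G.bi_irrefl
  acyclic a h := G.acyclic a (Relation.TransGen.mono (fun _ _ h => h.1) a a h)

/-- Walks in the graph, recording which edges are used. -/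
inductive Walk (G : ADMG N) : N → N → Type _
  | nil (a : N) : Walk G a a
  | cons {a b c : N} (k : EdgeKind) (h : G.Step k a b) (p : Walk G b c) : Walk G a c

namespace Walk

variable {G : ADMG N}

/-- The nodes of a walk after its first node. -/
def tailNodes : ∀ {a b : N}, G.Walk a b → List N
  | _, _, nil _ => []
  | _, _, cons (b := b) _ _ p => b :: p.tailNodes

/-- All nodes of a walk, in order. -/
def nodes {a b : N} (p : G.Walk a b) : List N := a :: p.tailNodes

/-- A path is a walk without repeated nodes. -/
def IsPath {a b : N} (p : G.Walk a b) : Prop := p.nodes.Nodup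

/-- A causal (directed) walk: all edges point forward. -/
def IsCausal : ∀ {a b : N}, G.Walk a b → Prop
  | _, _, nil _ => True
  | _, _, cons k _ p => k = EdgeKind.fwd ∧ p.IsCausal

/-- The walk does not meet `X` except possibly at its first node. -/
def IsProper (X : Set N) {a b : N} (p : G.Walk a b) : Prop := ∀ n ∈ p.tailNodes, n ∉ X

/-- The walk is open (not blocked) given `C`: every interior node that is a collider has a
descendant in `C`, and every interior node that is not a collider is outside `C`. -/
def IsOpen (C : Set N) : ∀ {a b : N}, G.Walk a b → Prop
  | _, _, nil _ => True
  | _, _, cons _ _ (nil _) => True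
  | _, _, cons (b := b) k _ (cons k' h' p) =>
      ((k.HeadAtEnd ∧ k'.HeadAtStart → ∃ c ∈ C, G.Desc b c) ∧
        (¬ (k.HeadAtEnd ∧ k'.HeadAtStart) → b ∉ C)) ∧
      IsOpen C (cons k' h' p)

end Walk

/-- `A` is d-separated from `B` given `C`: every path between them is blocked by `C`. -/
def DSep (G : ADMG N) (A B C : Set N) : Prop :=
  ∀ a ∈ A, ∀ b ∈ B, ∀ p : G.Walk a b, p.IsPath → ¬ p.IsOpen C

end ADMG

/-! ### Structural causal models -/

/-- A structural causal model compatible with the graph `G`, the variable at node `i` taking its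
values in `Val i`. The exogenous variables are finitely many, mutually independent, and have
arbitrary laws; `scope k` is the set of variables whose structural equation may involve the
exogenous variable `k`. Two variables may share an exogenous variable only if `G` has a
bidirected edge between them, and the structural equation of a variable may involve only its
parents in `G` and its own exogenous variables. -/
structure SCM {N : Type*} (G : ADMG N) (Val : N → Type) where
  Exo : Type
  exoFintype : Fintype Exo
  Noise : Exo → Type
  noiseMeasurableSpace : ∀ k, MeasurableSpace (Noise k)
  law : ∀ k, MeasureTheory.Measure (Noise k)
  lawProbability : ∀ k, MeasureTheory.IsProbabilityMeasure (law k)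
  scope : Exo → Set N
  bi_of_scope : ∀ k i j, i ∈ scope k → j ∈ scope k → i ≠ j → G.bi i j
  f : ∀ i, (∀ j, Val j) → (∀ k, Noise k) → Val i
  f_parents : ∀ i v v' u, (∀ j, G.dir j i → v j = v' j) → f i v u = f i v' u
  f_noise : ∀ i v u u', (∀ k, i ∈ scope k → u k = u' k) → f i v u = f i v u'
  f_measurable : ∀ i v a, MeasurableSet {u | f i v u = a}

attribute [instance] SCM.exoFintype SCM.noiseMeasurableSpace SCM.lawProbability

namespace SCM

variable {N : Type*} {G : ADMG N} {Val : N → Type}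

/-- `v` is the solution of the structural equations for the exogenous values `u`. -/
def Solves (M : SCM G Val) (u : ∀ k, M.Noise k) (v : ∀ i, Val i) : Prop :=
  ∀ i, v i = M.f i v u

/-- The probability, under the joint distribution of all variables induced by the model, of the
event `E`. -/
noncomputable def prob (M : SCM G Val) (E : Set (∀ i, Val i)) : ℝ :=
  (MeasureTheory.Measure.pi M.law).real {u | ∃ v ∈ E, M.Solves u v}

/-- The conditional probability of `A` given `B`. -/
noncomputable def condProb (M : SCM G Val) (A B : Set (∀ i, Val i)) : ℝ :=
  M.prob (A ∩ B) / M.prob B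

/-- The submodel under the intervention that sets variable `i` to `a` whenever `x i = some a`
and leaves the structural equation of `i` alone when `x i = none`. -/
def intervene (M : SCM G Val) (x : ∀ i, Option (Val i)) : SCM G Val where
  Exo := M.Exo
  exoFintype := M.exoFintype
  Noise := M.Noise
  noiseMeasurableSpace := M.noiseMeasurableSpace
  law := M.law
  lawProbability := M.lawProbability
  scope := M.scope
  bi_of_scope := M.bi_of_scope
  f i v u := (x i).getD (M.f i v u)
  f_parents i v v' u h := by rw [M.f_parents i v v' u h]
  f_noise i v u u' h := by rw [M.f_noise i v u u' h]
  f_measurable i v a := by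
    cases x i with
    | none => exact M.f_measurable i v a
    | some b => exact MeasurableSet.const (b = a)

end SCM

/-! ### m-graphs -/

/-- The nodes of an m-graph whose substantive variables are `V` and whose partially observed
variables are `Vm`: `Sum.inl v` is the variable `v`, and `Sum.inr v` is the missingness
indicator of the partially observed variable `v`. -/
abbrev MNode {V : Type*} (Vm : Finset V) : Type _ := V ⊕ {v : V // v ∈ Vm}

/-- An m-graph: missingness indicators are not parents of substantive variables. -/
structure MGraph (V : Type*) (Vm : Finset V) extends ADMG (MNode Vm) where
  no_indicator_parent : ∀ (r : {v : V // v ∈ Vm}) (v : V), ¬ dir (Sum.inr r) (Sum.inl v)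

/-- The values of the node variables: those of `v` lie in `Dom v`, and missingness indicators are
binary, `true` standing for `1` (observed) and `false` for `0` (missing). -/
def MVal {V : Type*} (Vm : Finset V) (Dom : V → Type) : MNode Vm → Type
  | Sum.inl v => Dom v
  | Sum.inr _ => Bool

section MGraphs

variable {V : Type*} [DecidableEq V] {Vm : Finset V}

/-- A set of substantive variables, as a set of nodes. -/
def varNodes (Vm : Finset V) (S : Finset V) : Set (MNode Vm) :=
  {n | ∃ v ∈ S, n = Sum.inl v}

/-- The set `R_W` of the indicators of the partially observed variables in `S`, that is,
`W = Vm ∩ S`. -/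
def indNodes (Vm : Finset V) (S : Finset V) : Set (MNode Vm) :=
  {n | ∃ r : {v : V // v ∈ Vm}, r.1 ∈ S ∧ n = Sum.inr r}

/-- The event that the variables in `S` take the values `s`. -/
def varEvent (Vm : Finset V) {Dom : V → Type} (S : Finset V) (s : ∀ v : S, Dom v) :
    Set (∀ i, MVal Vm Dom i) :=
  {a | ∀ v : S, a (Sum.inl v.1) = s v}

/-- The event `R_W = 1`, where `W = Vm ∩ S`. -/
def indEvent (Vm : Finset V) {Dom : V → Type} (S : Finset V) : Set (∀ i, MVal Vm Dom i) :=
  {a | ∀ r : {v : V // v ∈ Vm}, r.1 ∈ S → a (Sum.inr r) = true}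

/-- The intervention `do(X = x)`, as a partial assignment. -/
def doAssign (Vm : Finset V) {Dom : V → Type} (X : Finset V) (x : ∀ v : X, Dom v) :
    ∀ i, Option (MVal Vm Dom i)
  | Sum.inl v => if h : v ∈ X then some (x ⟨v, h⟩) else none
  | Sum.inr _ => none

/-- `Z` is an m-adjustment set for the causal effect of `X` on `Y`: in every model compatible
with the m-graph, for all finite domains and all values `x` and `y`,
`P(y | do(x)) = ∑ z, P(y | x, z, R_W = 1) * P(z | R_W = 1)`, where `W = Vm ∩ (X ∪ Y ∪ Z)`.
The formula is required whenever its conditional probabilities are defined, that is, when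
`P(R_W = 1) ≠ 0` and `P(x, z, R_W = 1) ≠ 0` for every `z` of nonzero weight. -/
def MGraph.IsMAdjustmentSet (G : MGraph V Vm) (X Y Z : Finset V) : Prop :=
  ∀ (Dom : V → Type) [∀ v, Fintype (Dom v)] [∀ v, Nonempty (Dom v)]
    (M : SCM G.toADMG (MVal Vm Dom)) (x : ∀ v : X, Dom v) (y : ∀ v : Y, Dom v),
    let R1 : Set (∀ i, MVal Vm Dom i) := indEvent Vm (X ∪ Y ∪ Z)
    M.prob R1 ≠ 0 →
    (∀ z : (∀ v : Z, Dom v), M.prob (varEvent Vm Z z ∩ R1) ≠ 0 →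
      M.prob (varEvent Vm X x ∩ varEvent Vm Z z ∩ R1) ≠ 0) →
    (M.intervene (doAssign Vm X x)).prob (varEvent Vm Y y) =
      ∑ z : (∀ v : Z, Dom v),
        M.condProb (varEvent Vm Y y) (varEvent Vm X x ∩ varEvent Vm Z z ∩ R1) *
          M.condProb (varEvent Vm Z z) R1

/-- The m-adjustment criterion for `Z` relative to `(X, Y)`. -/
structure MGraph.MAdjustmentCriterion (G : MGraph V Vm) (X Y Z : Finset V) : Prop where
  /-- No element of `Z` is a descendant, in the graph without the edges into `X`, of a node
  outside `X` on a proper causal path from `X` to `Y`. -/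
  no_forbidden : ∀ x ∈ varNodes Vm X, ∀ y ∈ varNodes Vm Y, ∀ p : G.toADMG.Walk x y,
    p.IsPath → p.IsCausal → p.IsProper (varNodes Vm X) →
    ∀ w ∈ p.nodes, w ∉ varNodes Vm X →
    ∀ z ∈ varNodes Vm Z, ¬ (G.toADMG.removeIn (varNodes Vm X)).Desc w z
  /-- All proper non-causal paths from `X` to `Y` are blocked by `Z` and `R_W`. -/
  noncausal_blocked : ∀ x ∈ varNodes Vm X, ∀ y ∈ varNodes Vm Y, ∀ p : G.toADMG.Walk x y,
    p.IsPath → p.IsProper (varNodes Vm X) → ¬ p.IsCausal →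
    ¬ p.IsOpen (varNodes Vm Z ∪ indNodes Vm (X ∪ Y ∪ Z))
  /-- `Y` is d-separated from `R_W` given `X`, in the graph without the edges into `X`. -/
  indicators_dsep : (G.toADMG.removeIn (varNodes Vm X)).DSep
    (varNodes Vm Y) (indNodes Vm (X ∪ Y ∪ Z)) (varNodes Vm X)
  /-- Every element of `X` that is an ancestor of `R_W` is d-separated from `Y` in the graph
  without the edges out of `X`. -/
  ancestors_dsep : ∀ x ∈ varNodes Vm X, (∃ r ∈ indNodes Vm (X ∪ Y ∪ Z), G.toADMG.Desc x r) →
    (G.toADMG.removeOut (varNodes Vm X)).DSep {x} (varNodes Vm Y) ∅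

end MGraphs

/-! Both directions use a reformulation of (a)–(d) by walks (`MGraph.mAdjustmentCriterion_iff`). Let
D be the set of nodes outside X with a directed walk to Y that avoids X (`freeAnc`). Condition (a)
says that nodes of D below X do not lead to Z by directed walks avoiding X. Given (a) and (c),
condition (b) says that no walk open given C = Z ∪ R_W joins X and Y once the edges from X into D
are deleted (`removeCausal`). Condition (c) excludes a common source of Y and R_W (`SharedSource`),
and (d) excludes a common source of Y and of an x in X above R_W (`BackSource`), all directed walks
avoiding X up to their ends.

Sufficiency. Write Y_x for Y under the intervention, as a function of the same noises. By (c) and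
(d) the noises that drive Y_x are disjoint from those that drive R_W, so Y_x is independent of R_W
(`SCM.indep_intervene`). By (a), (b) and (c), Y_x is independent of X given C
(`SCM.cond_indep_intervene`): a single model on an ancestral set carries the factual X and C
together with the counterfactual Y, and the absence of open walks there makes the joint law factor.
By consistency P(y | x, z, R_W = 1) = P(Y_x = y | x, z, R_W = 1) = P(Y_x = y | z, R_W = 1), and
averaging over z gives P(Y_x = y | R_W = 1) = P(Y_x = y).

Necessity. Each violation yields a model of bits in which every node is a sum mod 2 of parents and
of noises that are true with probability 1/4. In these models z decides whether Y = 0, given x and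
R_W = 1, so the formula equates P(Y_x = 0) with the conditional probability of an event about z
(`BitModel.adjustment_eq`), and this fails. For (c), one noise is copied to Y and to an indicator:
3/4 would have to be 1. For (a), a child of X is x plus a noise and is copied to Y and Z: 3/4 would
have to be 5/8. For (b), bits travel along an open walk. The two end bits differ by the sum of the
collider bits, which are copied to C; yet Y_x is a single noise. The formula for both values of x
would give 3/4 + 3/4 = 1. For (d), Y, Z and an x share a bit, and x passes it to an indicator along
a path that adds a fresh noise at each node. Conditioning on R_W = 1 fixes the parity of all noises,
which biases the shared bit (`bitLaw_parity`).

The construction for (b) needs an open walk without repeated nodes whose colliders reach C by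
directed walks that are disjoint from each other and meet the open walk only at their starting
colliders. Such a walk is found by minimizing the number of edges plus the distances of the
colliders from C (`IsMinWalk`). -/

namespace EdgeKind

/-- Boolean version of `HeadAtEnd`. -/
def headAtEnd : EdgeKind → Bool
  | fwd => true
  | bwd => false
  | bidir => true

/-- Boolean version of `HeadAtStart`. -/
def headAtStart : EdgeKind → Bool
  | fwd => false
  | bwd => true
  | bidir => true

/-- The same edge, traversed in the opposite sense. -/
def rev : EdgeKind → EdgeKind
  | fwd => bwd
  | bwd => fwd
  | bidir => bidir

theorem headAtEnd_iff (k : EdgeKind) : k.HeadAtEnd ↔ k.headAtEnd = true := by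
  cases k <;> simp [HeadAtEnd, headAtEnd]

theorem headAtStart_iff (k : EdgeKind) : k.HeadAtStart ↔ k.headAtStart = true := by
  cases k <;> simp [HeadAtStart, headAtStart]

theorem rev_headAtEnd (k : EdgeKind) : k.rev.headAtEnd = k.headAtStart := by
  cases k <;> rfl

theorem rev_headAtStart (k : EdgeKind) : k.rev.headAtStart = k.headAtEnd := by
  cases k <;> rfl

theorem eq_fwd_of_headAtStart {k : EdgeKind} (h : k.headAtStart = false) : k = fwd := by
  cases k <;> simp_all [headAtStart]

end EdgeKind

/-! ### Open walks, their cost, and walks of minimal cost -/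

namespace ADMG

variable {N : Type*}

theorem Step.rev {G : ADMG N} {k : EdgeKind} {a b : N} (h : G.Step k a b) :
    G.Step k.rev b a := by
  cases k
  · exact h
  · exact h
  · exact G.bi_symm _ _ h

/-- Some descendant of `n` lies in `C`. -/
def AncOf (K : ADMG N) (C : Set N) (n : N) : Prop := ∃ c ∈ C, K.Desc n c

/-- A directed walk of length `l` leads from `n` to `C`. -/
def ReachesIn (K : ADMG N) (C : Set N) : ℕ → N → Prop
  | 0, n => n ∈ C
  | l + 1, n => ∃ n', K.dir n n' ∧ K.ReachesIn C l n'

/-- The length of a shortest directed walk from `n` to `C`. -/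
noncomputable def depth (K : ADMG N) (C : Set N) (n : N) : ℕ := sInf {l | K.ReachesIn C l n}

section Depth

variable {K : ADMG N} {C : Set N}

theorem ReachesIn.ancOf {l : ℕ} {n : N} (h : K.ReachesIn C l n) : K.AncOf C n := by
  induction l generalizing n with
  | zero => exact ⟨n, h, Relation.ReflTransGen.refl⟩
  | succ l ih =>
    obtain ⟨n', h1, h2⟩ := h
    obtain ⟨c, hc, h3⟩ := ih h2
    exact ⟨c, hc, h3.head h1⟩

theorem AncOf.exists_reachesIn {n : N} (h : K.AncOf C n) : ∃ l, K.ReachesIn C l n := by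
  obtain ⟨c, hc, h⟩ := h
  induction h using Relation.ReflTransGen.head_induction_on with
  | refl => exact ⟨0, hc⟩
  | head h1 _ ih =>
    obtain ⟨l, hl⟩ := ih
    exact ⟨l + 1, _, h1, hl⟩

theorem AncOf.reachesIn_depth {n : N} (h : K.AncOf C n) : K.ReachesIn C (K.depth C n) n :=
  Nat.sInf_mem h.exists_reachesIn

theorem ReachesIn.depth_le {l : ℕ} {n : N} (h : K.ReachesIn C l n) : K.depth C n ≤ l :=
  Nat.sInf_le h

theorem AncOf.of_dir {n n' : N} (hd : K.dir n n') (h : K.AncOf C n') : K.AncOf C n := by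
  obtain ⟨c, hc, h⟩ := h
  exact ⟨c, hc, h.head hd⟩

theorem AncOf.of_mem {n : N} (h : n ∈ C) : K.AncOf C n := ⟨n, h, Relation.ReflTransGen.refl⟩

theorem AncOf.depth_le_of_dir {n n' : N} (hd : K.dir n n') (h : K.AncOf C n') :
    K.depth C n ≤ K.depth C n' + 1 :=
  ReachesIn.depth_le (l := K.depth C n' + 1) ⟨n', hd, h.reachesIn_depth⟩

theorem AncOf.mem_of_depth {n : N} (h : K.AncOf C n) (h0 : K.depth C n = 0) : n ∈ C := by
  have := h.reachesIn_depth
  rwa [h0] at this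

theorem depth_eq_zero_of_mem {n : N} (h : n ∈ C) : K.depth C n = 0 :=
  Nat.le_zero.1 (ReachesIn.depth_le (K := K) (l := 0) h)

theorem AncOf.exists_next {n : N} (h : K.AncOf C n) (h0 : K.depth C n ≠ 0) :
    ∃ n', K.dir n n' ∧ K.AncOf C n' ∧ K.depth C n' + 1 = K.depth C n := by
  have h1 := h.reachesIn_depth
  obtain ⟨l, hl⟩ := Nat.exists_eq_succ_of_ne_zero h0
  rw [hl] at h1
  obtain ⟨n', hd, hr⟩ := h1
  have h2 := hr.depth_le
  have h3 := AncOf.depth_le_of_dir hd hr.ancOf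
  exact ⟨n', hd, hr.ancOf, by omega⟩

open Classical in
/-- The next node on a chosen shortest directed walk from `n` to `C`. -/
noncomputable def next (K : ADMG N) (C : Set N) (n : N) : N :=
  if h : ∃ n', K.dir n n' ∧ K.AncOf C n' ∧ K.depth C n' + 1 = K.depth C n then h.choose else n

theorem AncOf.next_spec {n : N} (h : K.AncOf C n) (h0 : K.depth C n ≠ 0) :
    K.dir n (K.next C n) ∧ K.AncOf C (K.next C n) ∧
      K.depth C (K.next C n) + 1 = K.depth C n := by
  have h1 := h.exists_next h0
  unfold next
  rw [dif_pos h1]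
  exact h1.choose_spec

theorem AncOf.iterate_next {n : N} (h : K.AncOf C n) {l : ℕ} (hl : l ≤ K.depth C n) :
    K.AncOf C ((K.next C)^[l] n) ∧ K.depth C ((K.next C)^[l] n) + l = K.depth C n := by
  induction l with
  | zero => exact ⟨h, rfl⟩
  | succ l ih =>
    obtain ⟨h1, h2⟩ := ih (by omega)
    rw [Function.iterate_succ_apply']
    obtain ⟨_, h3, h4⟩ := h1.next_spec (by omega)
    exact ⟨h3, by omega⟩

theorem AncOf.dir_iterate_next {n : N} (h : K.AncOf C n) {l : ℕ} (hl : l < K.depth C n) :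
    K.dir ((K.next C)^[l] n) ((K.next C)^[l + 1] n) := by
  obtain ⟨h1, h2⟩ := h.iterate_next hl.le
  rw [Function.iterate_succ_apply']
  exact (h1.next_spec (by omega)).1

theorem AncOf.iterate_next_notMem {n : N} (h : K.AncOf C n) {l : ℕ} (hl : l < K.depth C n) :
    (K.next C)^[l] n ∉ C := by
  intro hc
  obtain ⟨_, h2⟩ := h.iterate_next hl.le
  rw [depth_eq_zero_of_mem hc] at h2
  omega

theorem AncOf.iterate_next_depth_mem {n : N} (h : K.AncOf C n) :
    (K.next C)^[K.depth C n] n ∈ C := by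
  obtain ⟨h1, h2⟩ := h.iterate_next le_rfl
  exact h1.mem_of_depth (by omega)

theorem AncOf.desc_iterate_next {n : N} (h : K.AncOf C n) {l : ℕ} (hl : l ≤ K.depth C n) :
    K.Desc n ((K.next C)^[l] n) := by
  induction l with
  | zero => exact Relation.ReflTransGen.refl
  | succ l ih => exact (ih (by omega)).tail (h.dir_iterate_next (by omega))

end Depth

/-- A walk may pass through `n`, which is a collider on it precisely if `b` holds. -/
def JOpen (K : ADMG N) (C : Set N) (b : Bool) (n : N) : Prop :=
  (b = true → K.AncOf C n) ∧ (b = false → n ∉ C)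

/-- The cost of passing through `n`, which is a collider precisely if `b` holds. -/
noncomputable def jcost (K : ADMG N) (C : Set N) (b : Bool) (n : N) : ℕ :=
  bif b then K.depth C n else 0

/-- `n` is the end of a walk of `H` that starts in `A` and is open given `C`, its colliders being
ancestors of `C` in `K`. Here `w` is the number of edges plus the depths of all colliders, and
`h` tells whether the walk arrives with an arrowhead. -/
inductive Reach (H K : ADMG N) (C A : Set N) : ℕ → Bool → N → Prop
  | start {a : N} (ha : a ∈ A) : Reach H K C A 0 false a
  | step {w : ℕ} {h : Bool} {n n' : N} {k : EdgeKind} (hr : Reach H K C A w h n)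
      (hs : H.Step k n n') (ho : K.JOpen C (h && k.headAtStart) n) :
      Reach H K C A (w + 1 + K.jcost C (h && k.headAtStart) n) k.headAtEnd n'

/-- Some open walk joins `A` and `B`. -/
def Conn (H K : ADMG N) (C A B : Set N) : Prop :=
  ∃ n w₁ h₁ w₂ h₂, Reach H K C A w₁ h₁ n ∧ Reach H K C B w₂ h₂ n ∧ K.JOpen C (h₁ && h₂) n

/-- Does the walk with edge kinds `kd` arrive at its `t`-th node with an arrowhead? -/
def arr (kd : ℕ → EdgeKind) : ℕ → Bool
  | 0 => false
  | t + 1 => (kd t).headAtEnd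

/-- Is the `t`-th node of the walk with edge kinds `kd` a collider? -/
def coll (kd : ℕ → EdgeKind) (t : ℕ) : Bool := arr kd t && (kd t).headAtStart

/-- The cost of the first `t` edges of a walk. -/
noncomputable def cost (K : ADMG N) (C : Set N) (nd : ℕ → N) (kd : ℕ → EdgeKind) : ℕ → ℕ
  | 0 => 0
  | t + 1 => cost K C nd kd t + 1 + K.jcost C (coll kd t) (nd t)

/-- The first `m` edges given by `nd` and `kd` form an open walk that starts in `A`. -/
structure IsOpenWalk (H K : ADMG N) (C A : Set N) (m : ℕ) (nd : ℕ → N) (kd : ℕ → EdgeKind) :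
    Prop where
  start : nd 0 ∈ A
  step : ∀ t < m, H.Step (kd t) (nd t) (nd (t + 1))
  isOpen : ∀ t < m, K.JOpen C (coll kd t) (nd t)

/-- An open walk from `A` to `B` of minimal cost. -/
structure IsMinWalk (H K : ADMG N) (C A B : Set N) (m : ℕ) (nd : ℕ → N) (kd : ℕ → EdgeKind) :
    Prop extends IsOpenWalk H K C A m nd kd where
  mem_end : nd m ∈ B
  cost_le : ∀ {n w₁ h₁ w₂ h₂}, Reach H K C A w₁ h₁ n → Reach H K C B w₂ h₂ n →
    K.JOpen C (h₁ && h₂) n → cost K C nd kd m ≤ w₁ + w₂ + K.jcost C (h₁ && h₂) n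

section Walks

variable {H K : ADMG N} {C A B : Set N} {m : ℕ} {nd : ℕ → N} {kd : ℕ → EdgeKind}

theorem jopen_true {n : N} : K.JOpen C true n ↔ K.AncOf C n := by simp [JOpen]

theorem jopen_false {n : N} : K.JOpen C false n ↔ n ∉ C := by simp [JOpen]

theorem jcost_true {n : N} : K.jcost C true n = K.depth C n := rfl

theorem jcost_false {n : N} : K.jcost C false n = 0 := rfl

theorem cost_congr {nd' : ℕ → N} {kd' : ℕ → EdgeKind} {t : ℕ} (h1 : ∀ s < t, nd s = nd' s)
    (h2 : ∀ s < t, kd s = kd' s) : cost K C nd kd t = cost K C nd' kd' t := by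
  induction t with
  | zero => rfl
  | succ t ih =>
    have h3 : coll kd t = coll kd' t := by
      unfold coll
      cases t with
      | zero => rfl
      | succ t => simp [arr, h2 t (by omega), h2 (t + 1) (by omega)]
    simp only [cost]
    rw [ih (fun s hs => h1 s (by omega)) (fun s hs => h2 s (by omega)), h3, h1 t (by omega)]

theorem coll_congr {kd' : ℕ → EdgeKind} {t : ℕ} (h2 : ∀ s ≤ t, kd s = kd' s) :
    coll kd t = coll kd' t := by
  unfold coll
  cases t with
  | zero => rfl
  | succ t => simp [arr, h2 t (by omega), h2 (t + 1) (by omega)]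

theorem IsOpenWalk.extend {n : N} {k : EdgeKind} (hw : IsOpenWalk H K C A m nd kd)
    (hs : H.Step k (nd m) n) (ho : K.JOpen C (arr kd m && k.headAtStart) (nd m)) :
    ∃ nd' kd', IsOpenWalk H K C A (m + 1) nd' kd' ∧ nd' (m + 1) = n ∧
      arr kd' (m + 1) = k.headAtEnd ∧
      cost K C nd' kd' (m + 1) =
        cost K C nd kd m + 1 + K.jcost C (arr kd m && k.headAtStart) (nd m) := by
  classical
  have e1 : ∀ s ≤ m, Function.update nd (m + 1) n s = nd s := fun s hs => by
    rw [Function.update_of_ne]; omega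
  have e2 : ∀ s < m, Function.update kd m k s = kd s := fun s hs => by
    rw [Function.update_of_ne]; omega
  have e3 : Function.update kd m k m = k := Function.update_self ..
  have e4 : arr (Function.update kd m k) m = arr kd m := by
    cases m with
    | zero => rfl
    | succ m => simp [arr]
  have e5 : ∀ s < m, coll (Function.update kd m k) s = coll kd s := fun s hs =>
    coll_congr (fun r hr => e2 r (by omega))
  have e6 : coll (Function.update kd m k) m = (arr kd m && k.headAtStart) := by
    simp [coll, e4]
  refine ⟨Function.update nd (m + 1) n, Function.update kd m k, ⟨?_, ?_, ?_⟩, ?_, ?_, ?_⟩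
  · rw [e1 0 (by omega)]; exact hw.start
  · intro t ht
    rcases Nat.lt_succ_iff_lt_or_eq.1 ht with h | rfl
    · rw [e1 t h.le, e1 (t + 1) h, e2 t h]; exact hw.step t h
    · rw [e1 t le_rfl, e3, Function.update_self]; exact hs
  · intro t ht
    rcases Nat.lt_succ_iff_lt_or_eq.1 ht with h | rfl
    · rw [e1 t h.le, e5 t h]; exact hw.isOpen t h
    · rw [e1 t le_rfl, e6]; exact ho
  · exact Function.update_self ..
  · simp [arr]
  · simp only [cost]
    rw [e6, e1 m le_rfl, cost_congr (fun s hs => e1 s (le_of_lt hs)) (fun s hs => e2 s hs)]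

theorem Reach.exists_isOpenWalk {w : ℕ} {h : Bool} {n : N} (hr : Reach H K C A w h n) :
    ∃ m nd kd, IsOpenWalk H K C A m nd kd ∧ nd m = n ∧ arr kd m = h ∧
      cost K C nd kd m = w := by
  induction hr with
  | @start a ha =>
    exact ⟨0, fun _ => a, fun _ => EdgeKind.fwd, ⟨ha, by simp, by simp⟩, rfl, rfl, rfl⟩
  | step _ hs ho ih =>
    obtain ⟨m, nd, kd, hw, rfl, rfl, rfl⟩ := ih
    obtain ⟨nd', kd', h1, h2, h3, h4⟩ := hw.extend hs ho
    exact ⟨m + 1, nd', kd', h1, h2, h3, h4⟩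

/-- The walk from `B` is undone edge by edge, each edge being appended in reverse to the walk from
`A`. Being a collider does not depend on the sense of traversal, so the costs add up exactly. -/
theorem Reach.exists_join {w : ℕ} {h : Bool} {n : N} (hr : Reach H K C B w h n) :
    ∀ {m nd kd}, IsOpenWalk H K C A m nd kd → nd m = n → K.JOpen C (arr kd m && h) n →
      ∃ m' nd' kd', IsOpenWalk H K C A m' nd' kd' ∧ nd' m' ∈ B ∧
        cost K C nd' kd' m' = cost K C nd kd m + w + K.jcost C (arr kd m && h) n := by
  induction hr with
  | @start a ha =>
    rintro m nd kd hw rfl _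
    exact ⟨m, nd, kd, hw, ha, by simp [jcost]⟩
  | @step w h n n' k hr hs ho ih =>
    rintro m nd kd hw rfl hj
    obtain ⟨nd', kd', h1, h2, h3, h4⟩ := hw.extend hs.rev (by rwa [EdgeKind.rev_headAtStart])
    rw [EdgeKind.rev_headAtEnd] at h3
    obtain ⟨m', nd'', kd'', h5, h6, h7⟩ := ih h1 h2 (by rwa [h3, Bool.and_comm])
    refine ⟨m', nd'', kd'', h5, h6, ?_⟩
    rw [h7, h4, h3, EdgeKind.rev_headAtStart, Bool.and_comm h]
    omega

theorem IsOpenWalk.reach (hw : IsOpenWalk H K C A m nd kd) {t : ℕ} (ht : t ≤ m) :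
    Reach H K C A (cost K C nd kd t) (arr kd t) (nd t) := by
  induction t with
  | zero => exact Reach.start hw.start
  | succ t ih => exact (ih (by omega)).step (hw.step t ht) (hw.isOpen t ht)

/-- The arrowhead at the `t`-th node on the edge that leaves it, on a walk with `m` edges. -/
def dep (kd : ℕ → EdgeKind) (m t : ℕ) : Bool := if t < m then (kd t).headAtStart else false

theorem dep_of_lt {t : ℕ} (h : t < m) : dep kd m t = (kd t).headAtStart := if_pos h

theorem dep_self : dep kd m m = false := if_neg (lt_irrefl m)

theorem IsOpenWalk.jopen (hw : IsOpenWalk H K C A m nd kd) (hm : nd m ∉ C) {t : ℕ}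
    (ht : t ≤ m) : K.JOpen C (arr kd t && dep kd m t) (nd t) := by
  rcases ht.lt_or_eq with h | rfl
  · rw [dep_of_lt h]; exact hw.isOpen t h
  · rw [dep_self, Bool.and_false]; exact jopen_false.2 hm

/-- Reading the walk from its end splits the total cost exactly at node `t`. Every surgery on a
minimal walk below joins such an end piece to some other initial piece and compares costs. -/
theorem IsOpenWalk.reach_rev (hw : IsOpenWalk H K C A m nd kd) (hB : nd m ∈ B) (hm : nd m ∉ C)
    {t : ℕ} (ht : t ≤ m) : ∃ b, Reach H K C B b (dep kd m t) (nd t) ∧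
      cost K C nd kd t + b + K.jcost C (arr kd t && dep kd m t) (nd t) = cost K C nd kd m := by
  induction ht using Nat.decreasingInduction with
  | self => exact ⟨0, by rw [dep_self]; exact Reach.start hB, by simp [dep_self, jcost]⟩
  | of_succ t ht ih =>
    obtain ⟨b, h1, h2⟩ := ih
    have h3 := h1.step (hw.step t ht).rev (by
      rw [EdgeKind.rev_headAtStart, Bool.and_comm]
      exact hw.jopen hm ht)
    rw [EdgeKind.rev_headAtEnd, EdgeKind.rev_headAtStart] at h3
    rw [dep_of_lt ht]
    refine ⟨_, h3, ?_⟩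
    rw [← h2, Bool.and_comm (dep kd m (t + 1))]
    simp only [cost, coll, arr]
    omega

theorem Conn.exists_isMinWalk (h : Conn H K C A B) : ∃ m nd kd, IsMinWalk H K C A B m nd kd := by
  classical
  let P : ℕ → Prop := fun w => ∃ n w₁ h₁ w₂ h₂, Reach H K C A w₁ h₁ n ∧
    Reach H K C B w₂ h₂ n ∧ K.JOpen C (h₁ && h₂) n ∧ w = w₁ + w₂ + K.jcost C (h₁ && h₂) n
  have hP : ∃ w, P w := by
    obtain ⟨n, w₁, h₁, w₂, h₂, h⟩ := h
    exact ⟨_, n, w₁, h₁, w₂, h₂, h.1, h.2.1, h.2.2, rfl⟩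
  obtain ⟨n, w₁, h₁, w₂, h₂, r1, r2, ho, hw⟩ := Nat.find_spec hP
  obtain ⟨m, nd, kd, e1, rfl, rfl, rfl⟩ := r1.exists_isOpenWalk
  obtain ⟨m', nd', kd', e2, e3, e4⟩ := r2.exists_join e1 rfl ho
  refine ⟨m', nd', kd', e2, e3, ?_⟩
  intro n' v₁ g₁ v₂ g₂ q1 q2 qo
  rw [e4, ← hw]
  exact Nat.find_min' hP ⟨n', v₁, g₁, v₂, g₂, q1, q2, qo, rfl⟩

theorem cost_add_le {s t : ℕ} (h : s < t) :
    cost K C nd kd s + K.jcost C (coll kd s) (nd s) + (t - s) ≤ cost K C nd kd t := by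
  induction t, h using Nat.le_induction with
  | base => simp only [cost]; omega
  | succ t h ih => simp only [cost]; omega

theorem IsOpenWalk.ancOf_of_forall_fwd (hw : IsOpenWalk H K C A m nd kd)
    (hHK : ∀ a b, H.dir a b → K.dir a b) {i j : ℕ} (hij : i ≤ j) (hj : j ≤ m)
    (hf : ∀ t, i ≤ t → t < j → kd t = EdgeKind.fwd) (ha : K.AncOf C (nd j)) :
    K.AncOf C (nd i) ∧ K.depth C (nd i) ≤ (j - i) + K.depth C (nd j) := by
  induction j, hij using Nat.le_induction with
  | base => exact ⟨ha, by omega⟩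
  | succ j hij ih =>
    have h1 := hw.step j (by omega)
    rw [hf j hij (by omega)] at h1
    have h1 := hHK _ _ h1
    obtain ⟨h2, h3⟩ := ih (by omega) (fun t ht1 ht2 => hf t ht1 (by omega)) (ha.of_dir h1)
    have h4 := ha.depth_le_of_dir h1
    exact ⟨h2, by omega⟩

theorem IsOpenWalk.transGen_of_forall_fwd (hw : IsOpenWalk H K C A m nd kd)
    (hHK : ∀ a b, H.dir a b → K.dir a b) {i j : ℕ} (hij : i < j) (hj : j ≤ m)
    (hf : ∀ t, i ≤ t → t < j → kd t = EdgeKind.fwd) :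
    Relation.TransGen K.dir (nd i) (nd j) := by
  induction j, hij using Nat.le_induction with
  | base =>
    have h1 := hw.step i (by omega)
    rw [hf i le_rfl (by omega)] at h1
    exact Relation.TransGen.single (hHK _ _ h1)
  | succ j hij ih =>
    have h1 := hw.step j (by omega)
    rw [hf j (by omega) (by omega)] at h1
    exact (ih (by omega) (fun t ht1 ht2 => hf t ht1 (by omega))).tail (hHK _ _ h1)

/-- The first later edge that does not point forward has an arrowhead at its starting node, which is
therefore an open collider below `nd i`. The depth of `nd i` exceeds that of the collider by at most
the number of edges in between, and these edges are counted by the cost as well. -/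
theorem IsOpenWalk.fwd_run (hw : IsOpenWalk H K C A m nd kd)
    (hHK : ∀ a b, H.dir a b → K.dir a b) {i j : ℕ} (hij : i < j) (hj : j ≤ m)
    (hi : kd i = EdgeKind.fwd) :
    (∀ t, i ≤ t → t < j → kd t = EdgeKind.fwd) ∨
      ∃ s, i < s ∧ s < j ∧ coll kd s = true ∧ K.AncOf C (nd i) ∧
        cost K C nd kd i + K.depth C (nd i) ≤ cost K C nd kd s + K.depth C (nd s) := by
  induction j, hij using Nat.le_induction with
  | base =>
    refine Or.inl fun t h1 h2 => ?_
    obtain rfl : t = i := by omega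
    exact hi
  | succ j hij ih =>
    rcases ih (by omega) with h | ⟨s, h1, h2, h3⟩
    · by_cases hk : kd j = EdgeKind.fwd
      · refine Or.inl fun t h1 h2 => ?_
        rcases Nat.lt_succ_iff_lt_or_eq.1 h2 with h3 | rfl
        · exact h t h1 h3
        · exact hk
      · have hc : coll kd j = true := by
          obtain ⟨j', rfl⟩ : ∃ j', j = j' + 1 := ⟨j - 1, by omega⟩
          have : (kd (j' + 1)).headAtStart = true := by
            by_contra hh
            exact hk (EdgeKind.eq_fwd_of_headAtStart (by simpa using hh))
          simp [coll, arr, h j' (by omega) (by omega), this, EdgeKind.headAtEnd]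
        have ho := hw.isOpen j (by omega)
        rw [hc] at ho
        obtain ⟨h4, h5⟩ := hw.ancOf_of_forall_fwd hHK (by omega) (by omega) h (jopen_true.1 ho)
        have h6 := cost_add_le (K := K) (C := C) (nd := nd) (kd := kd) (s := i) (t := j) (by omega)
        exact Or.inr ⟨j, by omega, by omega, hc, h4, by omega⟩
    · exact Or.inr ⟨s, h1, by omega, h3⟩

namespace IsMinWalk

/-- The nodes of a minimal walk are distinct. -/
theorem injOn (hw : IsMinWalk H K C A B m nd kd) (hHK : ∀ a b, H.dir a b → K.dir a b)
    (hBC : ∀ b ∈ B, b ∉ C) {i j : ℕ} (hij : i < j) (hj : j ≤ m) : nd i ≠ nd j := by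
  intro he
  have hm := hBC _ hw.mem_end
  have ri := hw.reach (t := i) (by omega)
  obtain ⟨bi, -, ei⟩ := hw.reach_rev hw.mem_end hm (t := i) (by omega)
  obtain ⟨bj, rj, ej⟩ := hw.reach_rev hw.mem_end hm hj
  rw [← he] at rj
  have oi := hw.jopen hm (t := i) (by omega)
  have oj := hw.jopen hm hj
  have hc := cost_add_le (K := K) (C := C) (nd := nd) (kd := kd) hij
  -- Cutting out the loop between the two visits leaves a cheaper walk, in which the node has the
  -- arrowheads `arr kd i` and `dep kd m j`. Minimality is contradicted if the node is open there.
  have hmin := hw.cost_le ri rj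
  rw [← he] at oj ej
  have hdi := dep_of_lt (kd := kd) (m := m) (t := i) (by omega)
  rw [coll, ← hdi] at hc
  cases h1 : arr kd i <;> cases h2 : dep kd m i <;> cases h3 : arr kd j <;>
    cases h4 : dep kd m j <;>
    simp only [h1, h2, h3, h4, Bool.and_true, Bool.and_false,
      jopen_true, jopen_false, jcost_true, jcost_false, Bool.and_self] at *
  all_goals first
    | (have := hmin oi; omega)
    | (have := hmin oj; omega)
    | skip
  -- The remaining case: the node becomes a collider, although it was none at either visit. The walk
  -- leaves `nd i` forward, so either it closes a directed cycle or it reaches a collider, which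
  -- makes the node an open collider at no extra cost.
  have hfwd := EdgeKind.eq_fwd_of_headAtStart hdi.symm
  rcases hw.fwd_run hHK hij hj hfwd with h | ⟨s, hs1, hs2, hs3, hs4, hs5⟩
  · have := hw.transGen_of_forall_fwd hHK hij hj h
    rw [← he] at this
    exact K.acyclic _ this
  · have := hmin hs4
    have h6 := cost_add_le (K := K) (C := C) (nd := nd) (kd := kd) hs2
    rw [hs3, jcost_true] at h6
    omega

/-- Otherwise the end piece that starts at this node of `A` would be a cheaper walk; it is open
there because a first node is no collider and `A` avoids `C`. -/
theorem notMem_start (hw : IsMinWalk H K C A B m nd kd) (hAC : ∀ a ∈ A, a ∉ C)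
    (hBC : ∀ b ∈ B, b ∉ C) {t : ℕ} (h0 : 0 < t) (ht : t ≤ m) : nd t ∉ A := by
  intro ha
  obtain ⟨b, r, e⟩ := hw.reach_rev hw.mem_end (hBC _ hw.mem_end) ht
  have := hw.cost_le (Reach.start ha) r (jopen_false.2 (hAC _ ha))
  have hc := cost_add_le (K := K) (C := C) (nd := nd) (kd := kd) h0
  simp only [Bool.false_and, jcost_false] at this
  omega

theorem notMem_end (hw : IsMinWalk H K C A B m nd kd)
    (hBC : ∀ b ∈ B, b ∉ C) {t : ℕ} (ht : t < m) : nd t ∉ B := by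
  intro hb
  have := hw.cost_le (hw.reach ht.le) (Reach.start hb)
    (by rw [Bool.and_false]; exact jopen_false.2 (hBC _ hb))
  have hc := cost_add_le (K := K) (C := C) (nd := nd) (kd := kd) ht
  simp only [Bool.and_false, jcost_false] at this
  omega

end IsMinWalk

end Walks

end ADMG

/-! ### Directed excursions from the colliders to the conditioning set; d-separation by walks -/

namespace ADMG

variable {N : Type*} {H K : ADMG N} {C A B : Set N} {m : ℕ} {nd : ℕ → N} {kd : ℕ → EdgeKind}

/-- An open walk that ends at `n` can be continued along the chosen directed walk to `C`. -/
theorem Reach.iterate_next {w : ℕ} {h : Bool} {n : N} (hr : Reach H K C A w h n)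
    (ha : K.AncOf C n) {l : ℕ} (h1 : 1 ≤ l) (hl : l ≤ K.depth C n)
    (hH : ∀ r < l, H.dir ((K.next C)^[r] n) ((K.next C)^[r + 1] n)) :
    Reach H K C A (w + l) true ((K.next C)^[l] n) := by
  induction l, h1 using Nat.le_induction with
  | base =>
    have := hr.step (k := EdgeKind.fwd) (hH 0 (by omega)) (by
      simpa [EdgeKind.headAtStart, jopen_false] using ha.iterate_next_notMem (l := 0) (by omega))
    simpa [EdgeKind.headAtStart, EdgeKind.headAtEnd, jcost_false] using this
  | succ l h1 ih =>
    have := (ih (by omega) (fun r hr => hH r (by omega))).step (k := EdgeKind.fwd)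
      (hH l (by omega)) (by
      simpa [EdgeKind.headAtStart, jopen_false] using ha.iterate_next_notMem (l := l) (by omega))
    simpa only [EdgeKind.headAtStart, EdgeKind.headAtEnd, jcost_false, Bool.and_false,
      add_zero, add_assoc] using this

namespace IsMinWalk

theorem coll_pos {t : ℕ} (h : coll kd t = true) : 0 < t := by
  rcases Nat.eq_zero_or_pos t with rfl | h'
  · simp [coll, arr] at h
  · exact h'

theorem arr_of_coll {t : ℕ} (h : coll kd t = true) : arr kd t = true := by
  simp only [coll, Bool.and_eq_true] at h
  exact h.1

theorem ancOf_of_coll (hw : IsMinWalk H K C A B m nd kd) {t : ℕ} (ht : t < m)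
    (h : coll kd t = true) : K.AncOf C (nd t) := by
  have := hw.isOpen t ht
  rw [h] at this
  exact jopen_true.1 this

/-- The chosen directed walk from a collider to `C` avoids `A` and `B`. -/
theorem iterate_next_notMem (hw : IsMinWalk H K C A B m nd kd)
    (hHK : ∀ a b, K.dir a b → a ∉ A → H.dir a b) (hAC : ∀ a ∈ A, a ∉ C) (hBC : ∀ b ∈ B, b ∉ C)
    {s : ℕ} (hs : s < m) (hc : coll kd s = true) {l : ℕ} (hl : l ≤ K.depth C (nd s)) :
    (K.next C)^[l] (nd s) ∉ A ∧ (K.next C)^[l] (nd s) ∉ B := by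
  have ha := hw.ancOf_of_coll hs hc
  induction l using Nat.strong_induction_on with
  | _ l ih =>
  rcases Nat.eq_zero_or_pos l with rfl | hl0
  · exact ⟨hw.notMem_start hAC hBC (coll_pos hc) hs.le, hw.notMem_end hBC hs⟩
  -- The excursion is a walk of `K`, but its earlier nodes lie outside `A`, and `H` keeps all edges
  -- with tails outside `A`.
  · have hH : ∀ r < l, H.dir ((K.next C)^[r] (nd s)) ((K.next C)^[r + 1] (nd s)) := fun r hr =>
      hHK _ _ (ha.dir_iterate_next (by omega)) (ih r hr (by omega)).1
    obtain ⟨b, rb, eb⟩ := hw.reach_rev hw.mem_end (hBC _ hw.mem_end) hs.le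
    rw [dep_of_lt hs, ← coll, hc, jcost_true] at eb
    have s0 := coll_pos hc
    have c0 := cost_add_le (K := K) (C := C) (nd := nd) (kd := kd) s0
    have c1 := cost_add_le (K := K) (C := C) (nd := nd) (kd := kd) hs
    rw [hc, jcost_true] at c1
    -- A node of `A` on the excursion could replace the part of the walk before the collider, and a
    -- node of `B` the part after it. The excursion costs at most the depth that the collider is
    -- charged, so the edges left out make the new walk cheaper.
    constructor
    · intro hA
      have := hw.cost_le (Reach.start hA) (rb.iterate_next ha hl0 hl hH)
        (jopen_false.2 (hAC _ hA))
      simp only [Bool.false_and, jcost_false] at this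
      omega
    · intro hB
      have := hw.cost_le ((hw.reach hs.le).iterate_next ha hl0 hl hH) (Reach.start hB)
        (jopen_false.2 (hBC _ hB))
      simp only [Bool.and_false, jcost_false] at this
      omega

theorem reach_iterate_next (hw : IsMinWalk H K C A B m nd kd)
    (hHK : ∀ a b, K.dir a b → a ∉ A → H.dir a b) (hAC : ∀ a ∈ A, a ∉ C) (hBC : ∀ b ∈ B, b ∉ C)
    {s : ℕ} (hs : s < m) (hc : coll kd s = true) {l : ℕ} (h1 : 1 ≤ l)
    (hl : l ≤ K.depth C (nd s)) :
    Reach H K C A (cost K C nd kd s + l) true ((K.next C)^[l] (nd s)) ∧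
      ∃ b, Reach H K C B (b + l) true ((K.next C)^[l] (nd s)) ∧
        cost K C nd kd s + b + K.depth C (nd s) = cost K C nd kd m := by
  have ha := hw.ancOf_of_coll hs hc
  have hH : ∀ r < l, H.dir ((K.next C)^[r] (nd s)) ((K.next C)^[r + 1] (nd s)) := fun r hr =>
    hHK _ _ (ha.dir_iterate_next (by omega))
      (hw.iterate_next_notMem hHK hAC hBC hs hc (by omega)).1
  obtain ⟨b, rb, eb⟩ := hw.reach_rev hw.mem_end (hBC _ hw.mem_end) hs.le
  rw [dep_of_lt hs, ← coll, hc, jcost_true] at eb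
  exact ⟨(hw.reach hs.le).iterate_next ha h1 hl hH, b, rb.iterate_next ha h1 hl hH, eb⟩

/-- The chosen directed walk from a collider to `C` does not return to the minimal walk. -/
theorem iterate_next_ne (hw : IsMinWalk H K C A B m nd kd)
    (hHK : ∀ a b, K.dir a b → a ∉ A → H.dir a b) (hAC : ∀ a ∈ A, a ∉ C) (hBC : ∀ b ∈ B, b ∉ C)
    {s : ℕ} (hs : s < m) (hc : coll kd s = true) {l : ℕ} (h1 : 1 ≤ l)
    (hl : l ≤ K.depth C (nd s)) {j : ℕ} (hj : j ≤ m) : (K.next C)^[l] (nd s) ≠ nd j := by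
  intro he
  have hm := hBC _ hw.mem_end
  obtain ⟨ra, b, rb, eb⟩ := hw.reach_iterate_next hHK hAC hBC hs hc h1 hl
  obtain ⟨ha, hd⟩ := (hw.ancOf_of_coll hs hc).iterate_next hl
  obtain ⟨bj, rj, ej⟩ := hw.reach_rev hw.mem_end hm hj
  have oj := hw.jopen hm hj
  have aj := hw.reach hj
  rw [he] at ra rb ha hd
  -- The excursion would be a shortcut between `s` and `j`. If the meeting point becomes a collider,
  -- its remaining depth together with the `l` edges is what the collider at `s` was charged. For `j
  -- = s` the depths disagree.
  rcases lt_trichotomy s j with h | rfl | h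
  · have c1 := cost_add_le (K := K) (C := C) (nd := nd) (kd := kd) h
    rw [hc, jcost_true] at c1
    have hmin := hw.cost_le ra rj
    cases h2 : dep kd m j <;>
      simp only [h2, Bool.and_false, Bool.and_self, jopen_true, jopen_false,
        jcost_true, jcost_false] at *
    · have := hmin oj; omega
    · have := hmin ha; omega
  · omega
  · have c1 := cost_add_le (K := K) (C := C) (nd := nd) (kd := kd) h
    have hmin := hw.cost_le aj rb
    cases h2 : arr kd j <;>
      simp only [h2, Bool.false_and, Bool.and_self, jopen_true, jopen_false,
        jcost_true, jcost_false] at *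
    · have := hmin oj; omega
    · have := hmin ha; omega

/-- The chosen directed walks from two colliders to `C` are disjoint. -/
theorem iterate_next_ne_iterate_next (hw : IsMinWalk H K C A B m nd kd)
    (hHK : ∀ a b, K.dir a b → a ∉ A → H.dir a b) (hAC : ∀ a ∈ A, a ∉ C) (hBC : ∀ b ∈ B, b ∉ C)
    {s s' : ℕ} (hss : s < s') (hs' : s' < m) (hc : coll kd s = true) (hc' : coll kd s' = true)
    {l l' : ℕ} (h1 : 1 ≤ l) (hl : l ≤ K.depth C (nd s)) (h1' : 1 ≤ l')
    (hl' : l' ≤ K.depth C (nd s')) : (K.next C)^[l] (nd s) ≠ (K.next C)^[l'] (nd s') := by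
  intro he
  have hs : s < m := by omega
  obtain ⟨ra, -⟩ := hw.reach_iterate_next hHK hAC hBC hs hc h1 hl
  obtain ⟨-, b, rb, eb⟩ := hw.reach_iterate_next hHK hAC hBC hs' hc' h1' hl'
  obtain ⟨ha, hd⟩ := (hw.ancOf_of_coll hs hc).iterate_next hl
  rw [← he] at rb
  -- Going down one excursion and up the other makes the meeting point the only collider between the
  -- two pieces. Its depth, with the `l` edges down, pays for the collider at `s`; the `l'` edges up
  -- cost no more than the collider at `s'`; the edges from `s` to `s'` are saved.
  have := hw.cost_le ra rb (jopen_true.2 ha)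
  rw [Bool.and_self, jcost_true] at this
  have c1 := cost_add_le (K := K) (C := C) (nd := nd) (kd := kd) hss
  rw [hc, jcost_true] at c1
  omega

/-- A minimal walk, as a `Walk`. -/
theorem exists_walk (hw : IsMinWalk H K C A B m nd kd)
    (hHK : ∀ k a b, H.Step k a b → K.Step k a b) {t : ℕ} (ht : t ≤ m) :
    ∃ p : K.Walk (nd t) (nd m), p.tailNodes = (List.range' (t + 1) (m - t)).map nd ∧
      p.IsOpen C ∧
      (∀ a k (h : K.Step k a (nd t)), (t < m → K.JOpen C (k.headAtEnd && dep kd m t) (nd t)) →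
        (Walk.cons k h p).IsOpen C) ∧
      (p.IsCausal → ∀ s, t ≤ s → s < m → kd s = EdgeKind.fwd) := by
  induction ht using Nat.decreasingInduction with
  | self =>
    exact ⟨Walk.nil _, by simp [Walk.tailNodes], trivial, fun _ _ _ _ => trivial,
      fun _ s h1 h2 => by omega⟩
  | of_succ t ht ih =>
    obtain ⟨p, h1, h2, h3, h4⟩ := ih
    have h5 : (Walk.cons (kd t) (hHK _ _ _ (hw.step t ht)) p).IsOpen C := by
      refine h3 _ _ _ fun ht' => ?_
      rw [dep_of_lt ht']
      exact hw.isOpen (t + 1) ht'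
    refine ⟨Walk.cons (kd t) (hHK _ _ _ (hw.step t ht)) p, ?_, h5, ?_, ?_⟩
    · obtain ⟨r, hr⟩ : ∃ r, m - t = r + 1 := ⟨m - t - 1, by omega⟩
      rw [Walk.tailNodes, h1, hr, List.range'_succ, List.map_cons]
      congr 3
      omega
    · intro a k h ho
      have ho := ho ht
      rw [dep_of_lt ht] at ho
      refine ⟨⟨fun hc => ?_, fun hc => ?_⟩, h5⟩
      · exact ho.1 (by
          rw [EdgeKind.headAtEnd_iff, EdgeKind.headAtStart_iff] at hc; simp [hc])
      · exact ho.2 (by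
          rw [EdgeKind.headAtEnd_iff, EdgeKind.headAtStart_iff] at hc
          rw [Bool.eq_false_iff]
          simpa using hc)
    · rintro ⟨h6, h7⟩ s hs1 hs2
      rcases hs1.lt_or_eq with h | rfl
      · exact h4 h7 s h hs2
      · exact h6

end IsMinWalk

/-- An open walk between `A` and `B` can be shortened to an open path that meets `A` only in its
first node. -/
theorem Conn.exists_path (h : Conn H K C A B) (hHK : ∀ k a b, H.Step k a b → K.Step k a b)
    (hAC : ∀ a ∈ A, a ∉ C) (hBC : ∀ b ∈ B, b ∉ C) :
    ∃ a ∈ A, ∃ b ∈ B, ∃ p : K.Walk a b, p.IsPath ∧ p.IsOpen C ∧ p.IsProper A ∧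
      (p.IsCausal → a = b ∨ ∃ c, c ∉ A ∧ H.dir a c ∧
        Relation.ReflTransGen (fun x y => H.dir x y ∧ y ∉ A) c b) := by
  obtain ⟨m, nd, kd, hw⟩ := h.exists_isMinWalk
  obtain ⟨p, h1, h2, -, h3⟩ := hw.exists_walk hHK (Nat.zero_le m)
  refine ⟨nd 0, hw.start, nd m, hw.mem_end, p, ?_, h2, ?_, fun hc => ?_⟩
  · have : p.nodes = (List.range' 0 (m + 1)).map nd := by
      rw [Walk.nodes, h1, List.range'_succ, List.map_cons]
      rfl
    rw [Walk.IsPath, this]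
    refine List.Nodup.map_on ?_ List.nodup_range'
    intro i hi j hj he
    simp only [List.mem_range'_1] at hi hj
    by_contra hne
    rcases Nat.lt_or_gt_of_ne hne with h | h
    · exact hw.injOn (fun a b => hHK EdgeKind.fwd a b) hBC h (by omega) he
    · exact hw.injOn (fun a b => hHK EdgeKind.fwd a b) hBC h (by omega) he.symm
  · intro n hn
    rw [h1, List.mem_map] at hn
    obtain ⟨t, ht, rfl⟩ := hn
    simp only [List.mem_range'_1] at ht
    exact hw.notMem_start hAC hBC (by omega) (by omega)
  · have hf := h3 hc
    rcases Nat.eq_zero_or_pos m with rfl | hm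
    · exact Or.inl rfl
    · right
      have hd : ∀ t < m, H.dir (nd t) (nd (t + 1)) := fun t ht => by
        have := hw.step t ht
        rwa [hf t (Nat.zero_le _) ht] at this
      refine ⟨nd 1, hw.notMem_start hAC hBC one_pos hm, hd 0 hm, ?_⟩
      have : ∀ t, 1 ≤ t → t ≤ m →
          Relation.ReflTransGen (fun x y => H.dir x y ∧ y ∉ A) (nd 1) (nd t) := by
        intro t h1
        induction t, h1 using Nat.le_induction with
        | base => exact fun _ => Relation.ReflTransGen.refl
        | succ t h1 ih =>
          intro h2
          exact (ih (by omega)).tail ⟨hd t (by omega), hw.notMem_start hAC hBC (by omega) h2⟩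
      exact this m hm le_rfl

/-- All edges of the walk belong to `H`. -/
def Walk.EdgesIn (H : ADMG N) : ∀ {a b : N}, K.Walk a b → Prop
  | _, _, Walk.nil _ => True
  | _, _, Walk.cons (a := a) (b := b) k _ p => H.Step k a b ∧ p.EdgesIn H

/-- The walk is appended edge by edge to an open walk that ends at `a`. `IsOpen` says nothing about
the first node, so its passage is a separate hypothesis, which depends on how `a` was reached. -/
theorem Walk.conn {a b : N} (p : K.Walk a b) (hp : p.IsOpen C) (hH : p.EdgesIn H) (hb : b ∈ B)
    (hbC : b ∉ C) : ∀ {w h}, Reach H K C A w h a →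
    (∀ {k n} (hs : K.Step k a n) (q : K.Walk n b), p = Walk.cons k hs q →
      K.JOpen C (h && k.headAtStart) a) → Conn H K C A B := by
  induction p with
  | nil a =>
    intro w h hr _
    exact ⟨a, w, h, 0, false, hr, Reach.start hb, by rw [Bool.and_false]; exact jopen_false.2 hbC⟩
  | @cons a n b k hs q ih =>
    intro w h hr ho
    refine ih ?_ hH.2 hb hbC (hr.step hH.1 (ho hs q rfl)) ?_
    · cases q with
      | nil => trivial
      | cons k' hs' q => exact hp.2
    · rintro k' n' hs' q' rfl
      have := hp.1
      rw [EdgeKind.headAtEnd_iff, EdgeKind.headAtStart_iff] at this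
      refine ⟨fun h => this.1 (by simpa using h), fun h => this.2 ?_⟩
      rw [Bool.eq_false_iff] at h
      simpa using h

theorem Walk.edgesIn_self {a b : N} (p : K.Walk a b) : p.EdgesIn K := by
  induction p with
  | nil => trivial
  | cons k h p ih => exact ⟨h, ih⟩

/-- d-separation in terms of walks with weights. -/
theorem dSep_iff (hAC : ∀ a ∈ A, a ∉ C) (hBC : ∀ b ∈ B, b ∉ C) :
    K.DSep A B C ↔ ¬ Conn K K C A B := by
  constructor
  · intro h hc
    obtain ⟨a, ha, b, hb, p, hp, ho, -⟩ := hc.exists_path (fun _ _ _ h => h) hAC hBC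
    exact h a ha b hb p hp ho
  · intro h a ha b hb p _ ho
    exact h (p.conn ho p.edgesIn_self hb (hBC b hb) (Reach.start ha)
      (fun _ _ _ => by rw [Bool.false_and]; exact jopen_false.2 (hAC a ha)))

end ADMG

/-! ### The four conditions in terms of directed walks and open walks -/

namespace ADMG

open Relation (ReflTransGen TransGen)

variable {N : Type*} {H K G : ADMG N} {A B C X Y : Set N}

theorem reflTransGen_mono {r s : N → N → Prop} (h : ∀ a b, r a b → s a b) {a b : N}
    (hr : ReflTransGen r a b) : ReflTransGen s a b :=
  ReflTransGen.mono h a b hr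

section Reach

theorem Reach.up {w : ℕ} {n n' : N} (hr : Reach H K C A w false n)
    (h : ReflTransGen (fun a b => H.dir a b ∧ b ∉ C) n' n) :
    ∃ w', Reach H K C A w' false n' := by
  induction h using ReflTransGen.head_induction_on with
  | refl => exact ⟨w, hr⟩
  | head h1 _ ih =>
    obtain ⟨w', ih⟩ := ih
    exact ⟨_, ih.step (k := EdgeKind.bwd) h1.1 (by
      rw [Bool.false_and]; exact jopen_false.2 h1.2)⟩

theorem Reach.down {w : ℕ} {h : Bool} {n n' : N} (hr : Reach H K C A w h n)
    (hd : ReflTransGen (fun a b => H.dir a b ∧ a ∉ C) n n') :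
    ∃ w' h', Reach H K C A w' h' n' := by
  induction hd with
  | refl => exact ⟨w, h, hr⟩
  | tail _ h1 ih =>
    obtain ⟨w', h', ih⟩ := ih
    exact ⟨_, _, ih.step (k := EdgeKind.fwd) h1.1 (by
      rw [EdgeKind.headAtStart, Bool.and_false]; exact jopen_false.2 h1.2)⟩

theorem Conn.reach_end (h : Conn H K C A B) : ∃ b ∈ B, ∃ w h, Reach H K C A w h b := by
  obtain ⟨n, w₁, h₁, w₂, h₂, r1, r2, ho⟩ := h
  obtain ⟨m, nd, kd, e1, rfl, rfl, rfl⟩ := r1.exists_isOpenWalk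
  obtain ⟨m', nd', kd', e2, e3, -⟩ := r2.exists_join e1 rfl ho
  exact ⟨_, e3, _, _, e2.reach le_rfl⟩

theorem Reach.conn {w₁ w₂ : ℕ} {h : Bool} {n : N} (h1 : Reach H K C A w₁ h n)
    (h2 : Reach H K C B w₂ false n) (hn : n ∉ C) : Conn H K C A B :=
  ⟨n, w₁, h, w₂, false, h1, h2, by rw [Bool.and_false]; exact jopen_false.2 hn⟩

end Reach

section Desc

theorem Desc.of_removeIn {a b : N} (h : (G.removeIn X).Desc a b) : G.Desc a b :=
  reflTransGen_mono (fun _ _ h => h.1) h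

theorem Desc.notMem_of_removeIn {a b : N} (h : (G.removeIn X).Desc a b) (ha : a ∉ X) :
    b ∉ X := by
  induction h with
  | refl => exact ha
  | tail _ h1 _ => exact h1.2

theorem Desc.removeIn_tails {a b : N} (h : (G.removeIn X).Desc a b) (ha : a ∉ X) :
    ReflTransGen (fun a b => (G.removeIn X).dir a b ∧ a ∉ X) a b := by
  induction h with
  | refl => exact ReflTransGen.refl
  | tail h0 h1 ih => exact ih.tail ⟨h1, Desc.notMem_of_removeIn h0 ha⟩

/-- A directed walk either avoids `X` after its first node or then has a first node in `X`. -/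
theorem Desc.removeIn_or {a b : N} (h : G.Desc a b) :
    (G.removeIn X).Desc a b ∨
      ∃ p, ∃ x ∈ X, (G.removeIn X).Desc a p ∧ G.dir p x ∧ G.Desc x b := by
  induction h with
  | refl => exact Or.inl ReflTransGen.refl
  | @tail b c _ h1 ih =>
    rcases ih with ih | ⟨p, x, hx, h2, h3, h4⟩
    · by_cases hc : c ∈ X
      · exact Or.inr ⟨b, c, hc, ih, h1, ReflTransGen.refl⟩
      · exact Or.inl (ih.tail ⟨h1, hc⟩)
    · exact Or.inr ⟨p, x, hx, h2, h3, h4.tail h1⟩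

/-- A directed walk from `X` to a node outside `X` has a last node in `X`. -/
theorem Desc.exists_last {x b : N} (h : G.Desc x b) (hx : x ∈ X) (hb : b ∉ X) :
    ∃ x' ∈ X, ∃ a, a ∉ X ∧ G.dir x' a ∧ (G.removeIn X).Desc a b := by
  induction h with
  | refl => exact absurd hx hb
  | @tail b c _ h1 ih =>
    by_cases hb' : b ∈ X
    · exact ⟨b, hb', c, hb, h1, ReflTransGen.refl⟩
    · obtain ⟨x', hx', a, ha, h2, h3⟩ := ih hb'
      exact ⟨x', hx', a, ha, h2, h3.tail ⟨h1, hb⟩⟩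

theorem Desc.removeIn_of_removeOut {a b : N} (h : (G.removeOut X).Desc a b) (hb : b ∉ X) :
    a ∉ X ∧ (G.removeIn X).Desc a b := by
  induction h using ReflTransGen.head_induction_on with
  | refl => exact ⟨hb, ReflTransGen.refl⟩
  | head h1 _ ih => exact ⟨h1.2, ih.2.head ⟨h1.1, ih.1⟩⟩

theorem Desc.removeOut_of_removeIn {a b : N} (h : (G.removeIn X).Desc a b) (ha : a ∉ X) :
    (G.removeOut X).Desc a b := by
  refine reflTransGen_mono ?_ (Desc.removeIn_tails h ha)
  exact fun _ _ h => ⟨h.1.1, h.2⟩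

end Desc

/-- The nodes outside `X` from which a directed walk leads to `Y` that avoids `X`. -/
def freeAnc (G : ADMG N) (X Y : Set N) : Set N :=
  {d | d ∉ X ∧ ∃ y ∈ Y, (G.removeIn X).Desc d y}

/-- The graph without the directed edges with which proper causal walks from `X` to `Y` begin. -/
def removeCausal (G : ADMG N) (X Y : Set N) : ADMG N where
  dir a b := G.dir a b ∧ ¬ (a ∈ X ∧ b ∈ G.freeAnc X Y)
  bi := G.bi
  bi_symm := G.bi_symm
  bi_irrefl := G.bi_irrefl
  acyclic a h := G.acyclic a (TransGen.mono (fun _ _ h => h.1) a a h)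

/-- `Y` and `R` have a common source, with directed walks to both that avoid `X`. -/
def SharedSource (G : ADMG N) (X Y R : Set N) : Prop :=
  ∃ d ∈ G.freeAnc X Y, ∃ t, t ∉ X ∧ (t = d ∨ G.bi t d) ∧ ∃ r ∈ R, (G.removeIn X).Desc t r

/-- `Y` and `x` have a common source, with directed walks to both that avoid `X`. -/
def BackSource (G : ADMG N) (X Y : Set N) (x : N) : Prop :=
  (∃ d ∈ G.freeAnc X Y, G.bi x d) ∨ ∃ d ∈ G.freeAnc X Y, ∃ t, t ∉ X ∧ (t = d ∨ G.bi t d) ∧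
    ∃ p, (G.removeIn X).Desc t p ∧ G.dir p x

theorem freeAnc_of_mem {y : N} (hy : y ∈ Y) (hyX : y ∉ X) : y ∈ G.freeAnc X Y :=
  ⟨hyX, y, hy, ReflTransGen.refl⟩

theorem freeAnc_of_dir {a b : N} (h : G.dir a b) (ha : a ∉ X) (hb : b ∈ G.freeAnc X Y) :
    a ∈ G.freeAnc X Y := by
  obtain ⟨h1, y, hy, h2⟩ := hb
  exact ⟨ha, y, hy, h2.head ⟨h, h1⟩⟩

theorem removeIn_desc_notMem {a b : N} (h : (G.removeIn X).Desc a b) :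
    ReflTransGen (fun a b => (G.removeIn X).dir a b ∧ b ∉ X) a b :=
  reflTransGen_mono (fun _ _ h => ⟨h, h.2⟩) h

/-- Without the edges into `X`, no directed walk enters `X` from outside, so no node reached with an
arrowhead is an open collider given `X`. An open walk from `Y` therefore goes up against directed
edges, may turn once at a node outside `X` or at a bidirected edge, and then only goes down. -/
theorem conn_removeIn_iff {R : Set N} (hXR : ∀ r ∈ R, r ∉ X) :
    Conn (G.removeIn X) (G.removeIn X) X Y R ↔ G.SharedSource X Y R := by
  constructor
  · intro h
    obtain ⟨r, hr, w, b, h⟩ := h.reach_end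
    have key : ∀ {w b n}, Reach (G.removeIn X) (G.removeIn X) X Y w b n →
        (b = false → ∃ y ∈ Y, (G.removeIn X).Desc n y) ∧
        (b = true → ∃ d ∈ G.freeAnc X Y, ∃ t, t ∉ X ∧ (t = d ∨ G.bi t d) ∧
          (G.removeIn X).Desc t n) := by
      intro w b n h
      induction h with
      | @start a ha => exact ⟨fun _ => ⟨a, ha, ReflTransGen.refl⟩, fun h => by simp at h⟩
      | @step w b n n' k hr hs ho ih =>
        have hcoll : (b && k.headAtStart) = false := by
          by_contra hh
          rw [Bool.not_eq_false] at hh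
          obtain ⟨c, hc, h2⟩ := ho.1 hh
          rw [Bool.and_eq_true] at hh
          obtain ⟨d, _, t, ht, _, h1⟩ := ih.2 hh.1
          exact Desc.notMem_of_removeIn (h1.trans h2) ht hc
        have hn := ho.2 hcoll
        cases k with
        | fwd =>
          refine ⟨fun h => by simp [EdgeKind.headAtEnd] at h, fun _ => ?_⟩
          cases b with
          | false =>
            exact ⟨n, ⟨hn, ih.1 rfl⟩, n, hn, Or.inl rfl, ReflTransGen.single hs⟩
          | true =>
            obtain ⟨d, hd, t, ht, h1, h2⟩ := ih.2 rfl
            exact ⟨d, hd, t, ht, h1, h2.tail hs⟩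
        | bwd =>
          refine ⟨fun _ => ?_, fun h => by simp [EdgeKind.headAtEnd] at h⟩
          obtain ⟨y, hy, h1⟩ := ih.1 (by simpa [EdgeKind.headAtStart] using hcoll)
          exact ⟨y, hy, h1.head hs⟩
        | bidir =>
          refine ⟨fun h => by simp [EdgeKind.headAtEnd] at h, fun _ => ?_⟩
          have h1 := ih.1 (by simpa [EdgeKind.headAtStart] using hcoll)
          exact ⟨n, ⟨hn, h1⟩, n', hs.2.2, Or.inr (G.bi_symm _ _ hs.1), ReflTransGen.refl⟩
    cases b with
    | false =>
      exact ⟨r, ⟨hXR r hr, (key h).1 rfl⟩, r, hXR r hr, Or.inl rfl, r, hr, ReflTransGen.refl⟩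
    | true =>
      obtain ⟨d, hd, t, ht, h1, h2⟩ := (key h).2 rfl
      exact ⟨d, hd, t, ht, h1, r, hr, h2⟩
  · rintro ⟨d, ⟨hd, y, hy, h1⟩, t, ht, h2, r, hr, h3⟩
    obtain ⟨w, r1⟩ := (Reach.start (H := G.removeIn X) (K := G.removeIn X) (C := X) hy).up
      (removeIn_desc_notMem h1)
    obtain ⟨w', b', r2⟩ : ∃ w b, Reach (G.removeIn X) (G.removeIn X) X Y w b t := by
      rcases h2 with rfl | h2
      · exact ⟨w, _, r1⟩
      · exact ⟨_, _, r1.step (k := EdgeKind.bidir) ⟨G.bi_symm _ _ h2, hd, ht⟩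
          (by rw [Bool.false_and]; exact jopen_false.2 hd)⟩
    obtain ⟨w'', b'', r3⟩ := r2.down (Desc.removeIn_tails h3 ht)
    exact r3.conn (Reach.start hr) (hXR r hr)

/-- Given the empty set no collider is open, so a walk from `x` goes up, turns once, and goes down
to `Y`. It cannot start downwards, because the directed edges out of `X` are gone; for the same
reason it uses no other directed edge with tail in `X`. -/
theorem conn_removeOut_iff {x : N} (hXY : ∀ y ∈ Y, y ∉ X) (hx : x ∈ X) :
    Conn (G.removeOut X) (G.removeOut X) ∅ {x} Y ↔ G.BackSource X Y x := by
  constructor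
  · intro h
    obtain ⟨y, hy, w, b, h⟩ := h.reach_end
    have key : ∀ {w b n}, Reach (G.removeOut X) (G.removeOut X) ∅ {x} w b n →
        (b = false → n = x ∨ n ∉ X ∧ ∃ p, (G.removeIn X).Desc n p ∧ G.dir p x) ∧
        (b = true → ∃ d, (G.removeOut X).Desc d n ∧ (G.bi x d ∨ ∃ t, t ∉ X ∧ (t = d ∨ G.bi t d) ∧
          ∃ p, (G.removeIn X).Desc t p ∧ G.dir p x)) := by
      intro w b n h
      induction h with
      | @start a ha => exact ⟨fun _ => Or.inl ha, fun h => by simp at h⟩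
      | @step w b n n' k hr hs ho ih =>
        have hcoll : (b && k.headAtStart) = false := by
          by_contra hh
          rw [Bool.not_eq_false] at hh
          obtain ⟨c, hc, h2⟩ := ho.1 hh
          exact hc
        cases k with
        | fwd =>
          refine ⟨fun h => by simp [EdgeKind.headAtEnd] at h, fun _ => ?_⟩
          cases b with
          | false =>
            rcases ih.1 rfl with rfl | ⟨h1, h2⟩
            · exact absurd hx hs.2
            · exact ⟨n, ReflTransGen.single hs, Or.inr ⟨n, h1, Or.inl rfl, h2⟩⟩
          | true =>
            obtain ⟨d, hd, h1⟩ := ih.2 rfl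
            exact ⟨d, hd.tail hs, h1⟩
        | bwd =>
          refine ⟨fun _ => Or.inr ⟨hs.2, ?_⟩, fun h => by simp [EdgeKind.headAtEnd] at h⟩
          rcases ih.1 (by simpa [EdgeKind.headAtStart] using hcoll) with rfl | ⟨h1, p, h2, h3⟩
          · exact ⟨n', ReflTransGen.refl, hs.1⟩
          · exact ⟨p, h2.head ⟨hs.1, h1⟩, h3⟩
        | bidir =>
          refine ⟨fun h => by simp [EdgeKind.headAtEnd] at h, fun _ => ?_⟩
          refine ⟨n', ReflTransGen.refl, ?_⟩
          rcases ih.1 (by simpa [EdgeKind.headAtStart] using hcoll) with rfl | ⟨h1, h2⟩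
          · exact Or.inl hs
          · exact Or.inr ⟨n, h1, Or.inr hs, h2⟩
    have hyX := hXY y hy
    cases b with
    | false =>
      rcases (key h).1 rfl with rfl | ⟨_, h1⟩
      · exact absurd hx hyX
      · exact Or.inr ⟨y, freeAnc_of_mem hy hyX, y, hyX, Or.inl rfl, h1⟩
    | true =>
      obtain ⟨d, hd, h1⟩ := (key h).2 rfl
      obtain ⟨h2, h3⟩ := Desc.removeIn_of_removeOut hd hyX
      have hdD : d ∈ G.freeAnc X Y := ⟨h2, y, hy, h3⟩
      rcases h1 with h1 | ⟨t, ht, h1, h4⟩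
      · exact Or.inl ⟨d, hdD, h1⟩
      · exact Or.inr ⟨d, hdD, t, ht, h1, h4⟩
  · intro h
    have r0 : Reach (G.removeOut X) (G.removeOut X) ∅ {x} 0 false x := Reach.start rfl
    obtain ⟨d, hd, w, b, r1⟩ : ∃ d ∈ G.freeAnc X Y, ∃ w b,
        Reach (G.removeOut X) (G.removeOut X) ∅ {x} w b d := by
      rcases h with ⟨d, hd, h⟩ | ⟨d, hd, t, ht, h, p, h1, h2⟩
      · exact ⟨d, hd, _, _, r0.step (k := EdgeKind.bidir) h
          (by rw [Bool.false_and]; exact jopen_false.2 (Set.notMem_empty x))⟩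
      · have r1 := r0.step (k := EdgeKind.bwd) (n' := p) ⟨h2, Desc.notMem_of_removeIn h1 ht⟩
          (by rw [Bool.false_and]; exact jopen_false.2 (Set.notMem_empty x))
        obtain ⟨w, r2⟩ := r1.up (reflTransGen_mono (fun _ _ h => ⟨h, Set.notMem_empty _⟩)
          (Desc.removeOut_of_removeIn h1 ht))
        rcases h with rfl | h
        · exact ⟨t, hd, _, _, r2⟩
        · exact ⟨d, hd, _, _, r2.step (k := EdgeKind.bidir) h
            (by rw [Bool.false_and]; exact jopen_false.2 (Set.notMem_empty _))⟩
    obtain ⟨hdX, y, hy, h1⟩ := hd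
    obtain ⟨w', r2⟩ := (Reach.start (H := G.removeOut X) (K := G.removeOut X) (C := ∅) hy).up
      (reflTransGen_mono (fun _ _ h => ⟨h, Set.notMem_empty _⟩) (Desc.removeOut_of_removeIn h1 hdX))
    exact r1.conn r2 (Set.notMem_empty _)

section RemoveCausal

theorem removeCausal_dir {a b : N} (h : G.dir a b) (ha : a ∉ X) : (G.removeCausal X Y).dir a b :=
  ⟨h, fun h' => ha h'.1⟩

theorem removeCausal_tails {a b : N} (h : (G.removeIn X).Desc a b) (ha : a ∉ X)
    (hC : ∀ n, (G.removeIn X).Desc a n → n ∉ C) :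
    ReflTransGen (fun a b => (G.removeCausal X Y).dir a b ∧ b ∉ C) a b := by
  induction h with
  | refl => exact ReflTransGen.refl
  | tail h0 h1 ih =>
    exact ih.tail ⟨removeCausal_dir h1.1 (Desc.notMem_of_removeIn h0 ha), hC _ (h0.tail h1)⟩

theorem reach_of_freeAnc {d : N} (hd : d ∈ G.freeAnc X Y)
    (hC : ∀ n, (G.removeIn X).Desc d n → n ∉ C) :
    ∃ w, Reach (G.removeCausal X Y) G C Y w false d := by
  obtain ⟨h1, y, hy, h2⟩ := hd
  exact (Reach.start hy).up (removeCausal_tails h2 h1 hC)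

theorem reach_of_dir_mem {d p x : N} (hx : x ∈ X) (hxC : x ∉ C) (hd : d ∉ X)
    (h1 : (G.removeIn X).Desc d p) (h2 : G.dir p x)
    (hC : ∀ n, (G.removeIn X).Desc d n → n ∉ C) :
    ∃ w, Reach (G.removeCausal X Y) G C X w false d := by
  have r0 : Reach (G.removeCausal X Y) G C X 0 false x := Reach.start hx
  exact (r0.step (k := EdgeKind.bwd) (removeCausal_dir h2 (Desc.notMem_of_removeIn h1 hd))
    (by rw [Bool.false_and]; exact jopen_false.2 hxC)).up (removeCausal_tails h1 hd hC)

/-- By `hC`, a directed walk from `d` to `X ∪ C` must meet `X` before it can reach `C`. Up to its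
first node `x` in `X` it yields the open walk x ← ⋯ ← d → ⋯ → y, all of whose edges have tails
outside `X` and so survive in `removeCausal`. -/
theorem conn_of_freeAnc_of_ancOf {d : N} (hXC : ∀ x ∈ X, x ∉ C) (hd : d ∈ G.freeAnc X Y)
    (hC : ∀ n, (G.removeIn X).Desc d n → n ∉ C) (ha : G.AncOf (X ∪ C) d) :
    Conn (G.removeCausal X Y) G C X Y := by
  obtain ⟨c, hc, h⟩ := ha
  obtain ⟨w, r1⟩ := reach_of_freeAnc hd hC
  rcases Desc.removeIn_or (X := X) h with h1 | ⟨p, x, hx, h1, h2, -⟩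
  · rcases hc with hc | hc
    · exact absurd hc (Desc.notMem_of_removeIn h1 hd.1)
    · exact absurd hc (hC _ h1)
  · obtain ⟨w', r2⟩ := reach_of_dir_mem hx (hXC x hx) hd.1 h1 h2 hC
    exact r2.conn r1 (hC _ ReflTransGen.refl)

/-- The first edge that is not forward creates a collider, which is open and lies below `n`. -/
theorem Walk.ancOf_of_not_isCausal {a b n : N} (h : G.Step EdgeKind.fwd a n) (q : G.Walk n b)
    (ho : (Walk.cons EdgeKind.fwd h q).IsOpen C) (hq : ¬ q.IsCausal) : G.AncOf C n := by
  induction q generalizing a with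
  | nil => exact absurd trivial hq
  | @cons n n' b k h' q ih =>
    cases k with
    | fwd =>
      have := ih h' ho.2 fun hc => hq ⟨rfl, hc⟩
      exact this.of_dir h'
    | bwd => exact ho.1.1 ⟨trivial, trivial⟩
    | bidir => exact ho.1.1 ⟨trivial, trivial⟩

theorem Walk.edgesIn_removeCausal {a b : N} (p : G.Walk a b) (ha : a ∉ X) (hp : p.IsProper X) :
    p.EdgesIn (G.removeCausal X Y) := by
  induction p with
  | nil => trivial
  | @cons a n b k h q ih =>
    have hn : n ∉ X := hp n (by simp [tailNodes])
    refine ⟨?_, ih hn fun c hc => hp c (by simp [tailNodes, hc])⟩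
    cases k with
    | fwd => exact removeCausal_dir h ha
    | bwd => exact removeCausal_dir h hn
    | bidir => exact h

/-- The proper non-causal walks are those without an edge that starts a proper causal walk. -/
theorem conn_removeCausal_iff (hXY : ∀ y ∈ Y, y ∉ X) (hXC : ∀ x ∈ X, x ∉ C)
    (hYC : ∀ y ∈ Y, y ∉ C)
    (hF : ∀ d ∈ G.freeAnc X Y, (∃ x ∈ X, G.Desc x d) → ∀ n, (G.removeIn X).Desc d n → n ∉ C) :
    Conn (G.removeCausal X Y) G C X Y ↔ ∃ x ∈ X, ∃ y ∈ Y, ∃ p : G.Walk x y,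
      p.IsPath ∧ p.IsProper X ∧ ¬ p.IsCausal ∧ p.IsOpen C := by
  constructor
  · intro h
    have hle : ∀ k a b, (G.removeCausal X Y).Step k a b → G.Step k a b := by
      intro k a b h
      cases k with
      | fwd => exact h.1
      | bwd => exact h.1
      | bidir => exact h
    obtain ⟨x, hx, y, hy, p, h1, h2, h3, h4⟩ := h.exists_path hle hXC hYC
    refine ⟨x, hx, y, hy, p, h1, h3, fun hc => ?_, h2⟩
    rcases h4 hc with rfl | ⟨c, hc, h5, h6⟩
    · exact hXY _ hy hx
    · exact h5.2 ⟨hx, hc, y, hy, reflTransGen_mono (fun _ _ h => ⟨h.1.1, h.2⟩) h6⟩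
  · rintro ⟨x, hx, y, hy, p, -, h1, h2, h3⟩
    cases p with
    | nil => exact absurd trivial h2
    | @cons _ n _ k h q =>
      have hn : n ∉ X := h1 n (by simp [Walk.tailNodes])
      have hq : q.EdgesIn (G.removeCausal X Y) :=
        q.edgesIn_removeCausal hn fun c hc => h1 c (by simp [Walk.tailNodes, hc])
      -- Only the first edge can be a deleted one, as later nodes avoid `X`. If it is deleted, the
      -- non-causal walk has an open collider below `n`, and another open walk that starts with an
      -- arrowhead at `X` takes its place.
      by_cases hcase : k = EdgeKind.fwd ∧ n ∈ G.freeAnc X Y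
      · obtain ⟨rfl, hnD⟩ := hcase
        obtain ⟨c, hc, h4⟩ := q.ancOf_of_not_isCausal h h3 fun hc => h2 ⟨rfl, hc⟩
        exact conn_of_freeAnc_of_ancOf hXC hnD
          (hF n hnD ⟨x, hx, ReflTransGen.single h⟩) ⟨c, Or.inr hc, h4⟩
      · have hs : (G.removeCausal X Y).Step k x n := by
          cases k with
          | fwd => exact ⟨h, fun h' => hcase ⟨rfl, h'.2⟩⟩
          | bwd => exact removeCausal_dir h hn
          | bidir => exact h
        exact Walk.conn (Walk.cons k h q) h3 ⟨hs, hq⟩ hy (hYC y hy) (Reach.start hx)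
          fun _ _ _ => by rw [Bool.false_and]; exact jopen_false.2 (hXC x hx)

end RemoveCausal

section Causal

theorem Walk.IsCausal.transGen {a b : N} {p : G.Walk a b} (hp : p.IsCausal) :
    ∀ n ∈ p.tailNodes, TransGen G.dir a n := by
  induction p with
  | nil => simp [tailNodes]
  | @cons a c b k h q ih =>
    obtain ⟨rfl, hq⟩ := hp
    intro n hn
    simp only [tailNodes, List.mem_cons] at hn
    rcases hn with rfl | hn
    · exact TransGen.single h
    · exact TransGen.head h (ih hq n hn)

theorem Walk.IsCausal.isPath {a b : N} {p : G.Walk a b} (hp : p.IsCausal) : p.IsPath := by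
  induction p with
  | nil => simp [IsPath, nodes, tailNodes]
  | @cons a c b k h q ih =>
    have h1 : (a :: c :: q.tailNodes).Nodup :=
      List.nodup_cons.2 ⟨fun hm => G.acyclic a (hp.transGen a hm), ih hp.2⟩
    exact h1

theorem exists_causal_walk {a b y : N} (h : (G.removeIn X).Desc a b) (ha : a ∉ X)
    (q : G.Walk b y) (hq : q.IsCausal) (hqX : q.IsProper X) :
    ∃ p : G.Walk a y, p.IsCausal ∧ p.IsProper X ∧ ∀ n ∈ q.nodes, n ∈ p.nodes := by
  induction h using ReflTransGen.head_induction_on with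
  | refl => exact ⟨q, hq, hqX, fun _ h => h⟩
  | @head a c h1 _ ih =>
    obtain ⟨p, hp1, hp2, hp3⟩ := ih h1.2
    refine ⟨Walk.cons EdgeKind.fwd h1.1 p, ⟨rfl, hp1⟩, ?_, fun n hn => ?_⟩
    · intro n hn
      simp only [Walk.tailNodes, List.mem_cons] at hn
      rcases hn with rfl | hn
      · exact h1.2
      · exact hp2 n hn
    · have := hp3 n hn
      simp only [Walk.nodes, Walk.tailNodes, List.mem_cons] at this ⊢
      exact Or.inr this

theorem Walk.IsCausal.desc {a b : N} {p : G.Walk a b} (hp : p.IsCausal) (hX : p.IsProper X) :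
    ∀ n ∈ p.nodes, (G.removeIn X).Desc a n ∧ (G.removeIn X).Desc n b := by
  induction p with
  | nil =>
    intro n hn
    simp only [nodes, tailNodes, List.mem_singleton] at hn
    subst hn
    exact ⟨ReflTransGen.refl, ReflTransGen.refl⟩
  | @cons a c b k h q ih =>
    obtain ⟨rfl, hq⟩ := hp
    have hc : c ∉ X := hX c (by simp [tailNodes])
    have ih := ih hq fun n hn => hX n (by simp [tailNodes, hn])
    have h1 : (G.removeIn X).dir a c := ⟨h, hc⟩
    intro n hn
    simp only [nodes, tailNodes, List.mem_cons] at hn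
    rcases hn with rfl | hn
    · exact ⟨ReflTransGen.refl, (ih c (by simp [nodes])).2.head h1⟩
    · obtain ⟨h2, h3⟩ := ih n (by simpa [nodes] using hn)
      exact ⟨h2.head h1, h3⟩

/-- Nodes outside `X` on proper causal paths, in terms of directed walks that avoid `X`. -/
theorem exists_proper_causal_path_iff {w : N} :
    (∃ x ∈ X, ∃ y ∈ Y, ∃ p : G.Walk x y, p.IsPath ∧ p.IsCausal ∧ p.IsProper X ∧ w ∈ p.nodes ∧
      w ∉ X) ↔ w ∈ G.freeAnc X Y ∧
        ∃ x ∈ X, ∃ a, a ∉ X ∧ G.dir x a ∧ (G.removeIn X).Desc a w := by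
  constructor
  · rintro ⟨x, hx, y, hy, p, -, hc, hp, hw, hwX⟩
    cases p with
    | nil =>
      simp only [Walk.nodes, Walk.tailNodes, List.mem_singleton] at hw
      exact absurd (hw ▸ hx) hwX
    | @cons _ a _ k h q =>
      obtain ⟨rfl, hc⟩ := hc
      simp only [Walk.nodes, Walk.tailNodes, List.mem_cons] at hw
      rcases hw with rfl | hw
      · exact absurd hx hwX
      · obtain ⟨h1, h2⟩ := hc.desc (X := X) (fun n hn => hp n (by simp [Walk.tailNodes, hn])) w
          (by simpa [Walk.nodes] using hw)
        exact ⟨⟨hwX, y, hy, h2⟩, x, hx, a, hp a (by simp [Walk.tailNodes]), h, h1⟩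
  · rintro ⟨⟨hw, y, hy, h1⟩, x, hx, a, ha, h2, h3⟩
    obtain ⟨q, hq1, hq2, -⟩ := exists_causal_walk h1 hw (Walk.nil y) trivial
      (fun n hn => by simp [Walk.tailNodes] at hn)
    obtain ⟨p, hp1, hp2, hp3⟩ := exists_causal_walk h3 ha q hq1 hq2
    have hc : (Walk.cons EdgeKind.fwd h2 p).IsCausal := ⟨rfl, hp1⟩
    refine ⟨x, hx, y, hy, Walk.cons EdgeKind.fwd h2 p, hc.isPath, hc, ?_, ?_, hw⟩
    · intro n hn
      simp only [Walk.tailNodes, List.mem_cons] at hn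
      rcases hn with rfl | hn
      · exact ha
      · exact hp2 n hn
    · have := hp3 w (by simp [Walk.nodes])
      simp only [Walk.nodes, Walk.tailNodes, List.mem_cons] at this ⊢
      exact Or.inr this

end Causal

end ADMG

/-! ### The walk form of the m-adjustment criterion -/

section MGraphs

variable {V : Type*} {Vm : Finset V}

theorem inl_mem_varNodes {S : Finset V} {v : V} :
    (Sum.inl v : MNode Vm) ∈ varNodes Vm S ↔ v ∈ S :=
  ⟨fun ⟨_, hw, he⟩ => Sum.inl.inj he ▸ hw, fun h => ⟨v, h, rfl⟩⟩

theorem inr_notMem_varNodes {S : Finset V} {r : {v : V // v ∈ Vm}} :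
    (Sum.inr r : MNode Vm) ∉ varNodes Vm S := by
  rintro ⟨_, _, h⟩
  cases h

theorem notMem_varNodes_of_disjoint {S T : Finset V} (h : Disjoint S T) :
    ∀ n ∈ varNodes Vm S, n ∉ varNodes Vm T := by
  rintro _ ⟨v, hv, rfl⟩ hT
  exact Finset.disjoint_left.1 h hv (inl_mem_varNodes.1 hT)

theorem notMem_varNodes_of_indNodes {S T : Finset V} :
    ∀ n ∈ indNodes Vm S, n ∉ varNodes Vm T := by
  rintro _ ⟨r, _, rfl⟩
  exact inr_notMem_varNodes

theorem notMem_indNodes_of_varNodes {S T : Finset V} :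
    ∀ n ∈ varNodes Vm T, n ∉ indNodes Vm S := fun n hn hr => notMem_varNodes_of_indNodes n hr hn

theorem MGraph.exists_inl_of_desc (G : MGraph V Vm) {a : MNode Vm} {v : V}
    (h : G.toADMG.Desc a (Sum.inl v)) : ∃ w, a = Sum.inl w := by
  induction h using Relation.ReflTransGen.head_induction_on with
  | refl => exact ⟨v, rfl⟩
  | @head a c h1 _ ih =>
    obtain ⟨w, rfl⟩ := ih
    cases a with
    | inl a => exact ⟨a, rfl⟩
    | inr r => exact absurd h1 (G.no_indicator_parent r w)

variable [DecidableEq V]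

open ADMG in
/-- The m-adjustment criterion in terms of directed walks and of open walks. -/
structure MGraph.WalkCriterion (G : MGraph V Vm) (X Y Z : Finset V) : Prop where
  no_forbidden : ∀ d ∈ G.toADMG.freeAnc (varNodes Vm X) (varNodes Vm Y),
    (∃ x ∈ varNodes Vm X, G.toADMG.Desc x d) →
    ∀ z ∈ varNodes Vm Z, ¬ (G.toADMG.removeIn (varNodes Vm X)).Desc d z
  not_conn : ¬ Conn (G.toADMG.removeCausal (varNodes Vm X) (varNodes Vm Y)) G.toADMG
    (varNodes Vm Z ∪ indNodes Vm (X ∪ Y ∪ Z)) (varNodes Vm X) (varNodes Vm Y)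
  not_shared : ¬ G.toADMG.SharedSource (varNodes Vm X) (varNodes Vm Y) (indNodes Vm (X ∪ Y ∪ Z))
  not_back : ∀ x ∈ varNodes Vm X, G.toADMG.AncOf (indNodes Vm (X ∪ Y ∪ Z)) x →
    ¬ G.toADMG.BackSource (varNodes Vm X) (varNodes Vm Y) x

open ADMG

/-- Condition (a) covers `Z`. For an indicator below `d`, the node `d` itself is a common source of
`Y` and the indicator, which (c) forbids. -/
theorem MGraph.forbidden_notMem {G : MGraph V Vm} {X Y Z : Finset V}
    (hA : ∀ d ∈ G.toADMG.freeAnc (varNodes Vm X) (varNodes Vm Y),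
      (∃ x ∈ varNodes Vm X, G.toADMG.Desc x d) →
      ∀ z ∈ varNodes Vm Z, ¬ (G.toADMG.removeIn (varNodes Vm X)).Desc d z)
    (hC : ¬ G.toADMG.SharedSource (varNodes Vm X) (varNodes Vm Y) (indNodes Vm (X ∪ Y ∪ Z))) :
    ∀ d ∈ G.toADMG.freeAnc (varNodes Vm X) (varNodes Vm Y),
      (∃ x ∈ varNodes Vm X, G.toADMG.Desc x d) →
      ∀ n, (G.toADMG.removeIn (varNodes Vm X)).Desc d n →
        n ∉ varNodes Vm Z ∪ indNodes Vm (X ∪ Y ∪ Z) := by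
  rintro d hd hx n hn (hz | hr)
  · exact hA d hd hx n hz hn
  · exact hC ⟨d, hd, d, hd.1, Or.inl rfl, n, hr, hn⟩

theorem MGraph.mAdjustmentCriterion_iff (G : MGraph V Vm) {X Y Z : Finset V}
    (hXY : Disjoint X Y) (hXZ : Disjoint X Z) (hYZ : Disjoint Y Z) :
    G.MAdjustmentCriterion X Y Z ↔ G.WalkCriterion X Y Z := by
  have hYX := notMem_varNodes_of_disjoint (Vm := Vm) hXY.symm
  have hXC : ∀ x ∈ varNodes Vm X, x ∉ varNodes Vm Z ∪ indNodes Vm (X ∪ Y ∪ Z) := by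
    rintro x hx (h | h)
    · exact notMem_varNodes_of_disjoint hXZ x hx h
    · exact notMem_indNodes_of_varNodes x hx h
  have hYC : ∀ x ∈ varNodes Vm Y, x ∉ varNodes Vm Z ∪ indNodes Vm (X ∪ Y ∪ Z) := by
    rintro x hx (h | h)
    · exact notMem_varNodes_of_disjoint hYZ x hx h
    · exact notMem_indNodes_of_varNodes x hx h
  -- A free ancestor of `Y` below `X` lies on a proper causal path, which starts at the last node of
  -- `X` on the directed walk.
  have eA : (∀ x ∈ varNodes Vm X, ∀ y ∈ varNodes Vm Y, ∀ p : G.toADMG.Walk x y,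
      p.IsPath → p.IsCausal → p.IsProper (varNodes Vm X) →
      ∀ w ∈ p.nodes, w ∉ varNodes Vm X →
      ∀ z ∈ varNodes Vm Z, ¬ (G.toADMG.removeIn (varNodes Vm X)).Desc w z) ↔
      ∀ d ∈ G.toADMG.freeAnc (varNodes Vm X) (varNodes Vm Y),
        (∃ x ∈ varNodes Vm X, G.toADMG.Desc x d) →
        ∀ z ∈ varNodes Vm Z, ¬ (G.toADMG.removeIn (varNodes Vm X)).Desc d z := by
    constructor
    · rintro h d hd ⟨x, hx, h1⟩ z hz
      obtain ⟨x', hx', a, ha, h2, h3⟩ := h1.exists_last hx hd.1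
      obtain ⟨x, hx, y, hy, p, h4, h5, h6, h7, h8⟩ :=
        exists_proper_causal_path_iff.2 ⟨hd, x', hx', a, ha, h2, h3⟩
      exact h x hx y hy p h4 h5 h6 d h7 h8 z hz
    · intro h x hx y hy p h4 h5 h6 w h7 h8 z hz
      obtain ⟨h1, x', hx', a, ha, h2, h3⟩ :=
        exists_proper_causal_path_iff.1 ⟨x, hx, y, hy, p, h4, h5, h6, h7, h8⟩
      exact h w h1 ⟨x', hx', (Desc.of_removeIn h3).head h2⟩ z hz
  have eC := (dSep_iff (K := G.toADMG.removeIn (varNodes Vm X)) (C := varNodes Vm X) hYX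
    (notMem_varNodes_of_indNodes (S := X ∪ Y ∪ Z))).trans
      (not_congr (conn_removeIn_iff notMem_varNodes_of_indNodes))
  have eD : ∀ x ∈ varNodes Vm X, (G.toADMG.removeOut (varNodes Vm X)).DSep {x} (varNodes Vm Y) ∅ ↔
      ¬ G.toADMG.BackSource (varNodes Vm X) (varNodes Vm Y) x := fun x hx =>
    (dSep_iff (fun _ _ => Set.notMem_empty _) (fun _ _ => Set.notMem_empty _)).trans
      (not_congr (conn_removeOut_iff hYX hx))
  constructor
  · rintro ⟨h1, h2, h3, h4⟩
    rw [eA] at h1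
    rw [eC] at h3
    refine ⟨h1, fun hc => ?_, h3, fun x hx ha => (eD x hx).1 (h4 x hx ha)⟩
    obtain ⟨x, hx, y, hy, p, h5, h6, h7, h8⟩ :=
      (conn_removeCausal_iff hYX hXC hYC (MGraph.forbidden_notMem h1 h3)).1 hc
    exact h2 x hx y hy p h5 h6 h7 h8
  · rintro ⟨h1, h2, h3, h4⟩
    refine ⟨eA.2 h1, fun x hx y hy p h5 h6 h7 h8 => h2 ?_, eC.2 h3,
      fun x hx ha => (eD x hx).2 (h4 x hx ha)⟩
    exact (conn_removeCausal_iff hYX hXC hYC (MGraph.forbidden_notMem h1 h3)).2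
      ⟨x, hx, y, hy, p, h5, h6, h7, h8⟩

end MGraphs

/-! ### Independence in product measures and in structural causal models -/

open MeasureTheory

/-- Independence of events about disjoint sets of coordinates of a product measure. -/
theorem measureReal_pi_inter {ι : Type*} [Fintype ι] {Ω : ι → Type*}
    [∀ i, MeasurableSpace (Ω i)] (μ : ∀ i, Measure (Ω i)) [∀ i, IsProbabilityMeasure (μ i)]
    (p : ι → Prop) {S T : Set (∀ i, Ω i)} (hSm : MeasurableSet S) (hTm : MeasurableSet T)
    (hS : ∀ u u' : ∀ i, Ω i, (∀ i, p i → u i = u' i) → (u ∈ S ↔ u' ∈ S))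
    (hT : ∀ u u' : ∀ i, Ω i, (∀ i, ¬ p i → u i = u' i) → (u ∈ T ↔ u' ∈ T)) :
    (Measure.pi μ).real (S ∩ T) = (Measure.pi μ).real S * (Measure.pi μ).real T := by
  classical
  -- Arbitrary values for the irrelevant coordinates, used to write `S` and `T` as cylinders.
  have u₀ : ∀ i, Ω i := fun i => (nonempty_of_isProbabilityMeasure (μ i)).some
  let e := MeasurableEquiv.piEquivPiSubtypeProd Ω p
  have he := measurePreserving_piEquivPiSubtypeProd μ p
  let S' : Set (∀ i : Subtype p, Ω i) := {a | e.symm (a, fun i => u₀ i) ∈ S}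
  let T' : Set (∀ i : {i // ¬ p i}, Ω i) := {b | e.symm (fun i => u₀ i, b) ∈ T}
  have hS' : MeasurableSet S' :=
    (e.symm.measurable.comp (measurable_id.prodMk measurable_const)) hSm
  have hT' : MeasurableSet T' :=
    (e.symm.measurable.comp (measurable_const.prodMk measurable_id)) hTm
  have h1 : ∀ u, u ∈ S ↔ (e u).1 ∈ S' := fun u => hS _ _ fun i hi => by
    simp [e, MeasurableEquiv.piEquivPiSubtypeProd, Equiv.piEquivPiSubtypeProd, hi]
  have h2 : ∀ u, u ∈ T ↔ (e u).2 ∈ T' := fun u => hT _ _ fun i hi => by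
    simp [e, MeasurableEquiv.piEquivPiSubtypeProd, Equiv.piEquivPiSubtypeProd, hi]
  have e1 : S = e ⁻¹' (S' ×ˢ Set.univ) := by ext u; simp [h1]
  have e2 : T = e ⁻¹' (Set.univ ×ˢ T') := by ext u; simp [h2]
  have e3 : S ∩ T = e ⁻¹' (S' ×ˢ T') := by ext u; simp [h1, h2]
  rw [e3, e1, e2]
  have key : ∀ A B, MeasurableSet A → MeasurableSet B → (Measure.pi μ).real (e ⁻¹' (A ×ˢ B)) =
      (Measure.pi fun i : Subtype p => μ i).real A *
        (Measure.pi fun i : {i // ¬ p i} => μ i).real B := by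
    intro A B hA hB
    rw [measureReal_def, he.measure_preimage (hA.prod hB).nullMeasurableSet, Measure.prod_prod,
      ENNReal.toReal_mul]
    rfl
  rw [key _ _ hS' hT', key _ _ hS' .univ, key _ _ .univ hT']
  simp

namespace ADMG

variable {N : Type*}

theorem wellFounded_dir [Finite N] (G : ADMG N) : WellFounded G.dir := by
  have : IsTrans N (Relation.TransGen G.dir) := ⟨fun _ _ _ h1 h2 => h1.trans h2⟩
  have : Std.Irrefl (Relation.TransGen G.dir) := ⟨G.acyclic⟩
  exact Subrelation.wf (fun h => Relation.TransGen.single h)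
    (Finite.wellFounded_of_trans_of_irrefl (Relation.TransGen G.dir))

/-- The nodes that are linked to `A` by sets of variables on which a factor of the joint
distribution depends, without passing through variables in `C`. -/
inductive Linked (G : ADMG N) (C A : Set N) : N → Prop
  | base {a : N} (h : a ∈ A) : Linked G C A a
  | bi {i j : N} (hi : Linked G C A i) (h : G.bi i j) : Linked G C A j
  | down {i j : N} (hi : Linked G C A i) (hC : i ∉ C) (h : G.dir i j) : Linked G C A j
  | up {i j : N} (hi : Linked G C A i) (h : G.dir j i) (hC : j ∉ C) : Linked G C A j

end ADMG

namespace SCM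

variable {N : Type*} {G : ADMG N} {Val : N → Type}

theorem Solves.unique [Finite N] {M : SCM G Val} {u : ∀ k, M.Noise k} {v v' : ∀ i, Val i}
    (h : M.Solves u v) (h' : M.Solves u v') : v = v' := by
  funext i
  induction i using G.wellFounded_dir.induction with
  | _ i ih =>
    rw [h i, h' i]
    exact M.f_parents i v v' u ih

theorem exists_solves [Finite N] [∀ i, Nonempty (Val i)] (M : SCM G Val)
    (u : ∀ k, M.Noise k) : ∃ v, M.Solves u v := by
  classical
  let F : ∀ i, (∀ j, G.dir j i → Val j) → Val i := fun i r =>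
    M.f i (fun j => if h : G.dir j i then r j h else Classical.arbitrary _) u
  refine ⟨G.wellFounded_dir.fix F, fun i => ?_⟩
  rw [WellFounded.fix_eq]
  refine M.f_parents i _ _ u fun j hj => ?_
  rw [dif_pos hj]

/-- The solution of the structural equations. -/
noncomputable def sol [Finite N] [∀ i, Nonempty (Val i)] (M : SCM G Val)
    (u : ∀ k, M.Noise k) : ∀ i, Val i := (M.exists_solves u).choose

theorem measurableSet_eqns [Finite N] (M : SCM G Val) (S : Set N) (v : ∀ i, Val i) :
    MeasurableSet {u | ∀ i ∈ S, M.f i v u = v i} := by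
  have : {u | ∀ i ∈ S, M.f i v u = v i} = ⋂ i : S, {u | M.f i v u = v i} := by
    ext; simp
  rw [this]
  exact MeasurableSet.iInter fun i => M.f_measurable i v (v i)

section Sol

variable [Finite N] [∀ i, Nonempty (Val i)] (M : SCM G Val)

theorem solves_sol (u : ∀ k, M.Noise k) : M.Solves u (M.sol u) := (M.exists_solves u).choose_spec

theorem sol_eq_iff {u : ∀ k, M.Noise k} {v : ∀ i, Val i} : M.sol u = v ↔ M.Solves u v :=
  ⟨fun h => h ▸ M.solves_sol u, fun h => (M.solves_sol u).unique h⟩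

theorem prob_eq (E : Set (∀ i, Val i)) :
    M.prob E = (Measure.pi M.law).real {u | M.sol u ∈ E} := by
  unfold prob
  congr 1
  ext u
  constructor
  · rintro ⟨v, hv, h⟩
    rw [Set.mem_ofPred_eq, M.sol_eq_iff.2 h]
    exact hv
  · exact fun h => ⟨_, h, M.solves_sol u⟩

theorem measurableSet_sol [∀ i, Finite (Val i)] (E : Set (∀ i, Val i)) :
    MeasurableSet {u | M.sol u ∈ E} := by
  have : {u | M.sol u ∈ E} = ⋃ v : E, {u | ∀ i ∈ Set.univ, M.f i v.1 u = v.1 i} := by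
    ext u
    simp only [Set.mem_ofPred_eq, Set.mem_univ, forall_const, Set.mem_iUnion, Subtype.exists,
      exists_prop]
    constructor
    · exact fun h => ⟨_, h, fun i => (M.solves_sol u i).symm⟩
    · rintro ⟨v, hv, h⟩
      rwa [M.sol_eq_iff.2 fun i => (h i).symm]
  rw [this]
  exact MeasurableSet.iUnion fun v => M.measurableSet_eqns _ _

theorem prob_eq_sum [Fintype (∀ i, Val i)] [∀ i, Finite (Val i)] (E : Set (∀ i, Val i))
    [DecidablePred (· ∈ E)] : M.prob E = ∑ v, if v ∈ E then M.prob {v} else 0 := by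
  rw [← Finset.sum_filter]
  simp only [prob_eq]
  rw [← measureReal_biUnion_finset]
  · congr 1
    ext u
    simp
  · intro v _ w _ hvw
    refine Set.disjoint_left.2 fun u h1 h2 => hvw ?_
    simp only [Set.mem_singleton_iff, Set.mem_ofPred_eq] at h1 h2
    rw [← h1, h2]
  · exact fun v _ => M.measurableSet_sol _

/-- The law of the solution factorizes along every partition of the nodes into two parts that are
not joined by bidirected edges. -/
theorem prob_singleton (U : Set N) (hU : ∀ i j, i ∈ U → G.bi i j → j ∈ U) (v : ∀ i, Val i) :
    M.prob {v} = (Measure.pi M.law).real {u | ∀ i ∈ U, M.f i v u = v i} *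
      (Measure.pi M.law).real {u | ∀ i ∈ Uᶜ, M.f i v u = v i} := by
  -- The noises are split into those that enter some equation of `U` and the others. A noise of the
  -- first kind enters no equation outside `U`, since it would force a bidirected edge out of `U`.
  rw [prob_eq, ← measureReal_pi_inter M.law (fun k => ∃ i ∈ U, i ∈ M.scope k)
    (M.measurableSet_eqns U v) (M.measurableSet_eqns Uᶜ v)]
  · congr 1
    ext u
    simp only [Set.mem_singleton_iff, Set.mem_ofPred_eq, Set.mem_inter_iff, sol_eq_iff]
    constructor
    · exact fun h => ⟨fun i _ => (h i).symm, fun i _ => (h i).symm⟩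
    · rintro ⟨h1, h2⟩ i
      by_cases hi : i ∈ U
      · exact (h1 i hi).symm
      · exact (h2 i hi).symm
  · intro u u' h
    refine forall₂_congr fun i hi => ?_
    rw [M.f_noise i v u u' fun k hk => h k ⟨i, hi, hk⟩]
  · intro u u' h
    refine forall₂_congr fun i hi => ?_
    rw [M.f_noise i v u u' fun k hk => h k ?_]
    rintro ⟨j, hj, hjk⟩
    have hne : j ≠ i := fun he => hi (he ▸ hj)
    exact hi (hU j i hj (M.bi_of_scope k j i hjk hk hne))

/-- Conditional independence of `A` and `B` given `C`, if `B` is not linked to `A`. -/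
theorem cond_indep [∀ i, Finite (Val i)] {A B C : Set N} (hAC : ∀ a ∈ A, a ∉ C)
    (hB : ∀ b ∈ B, ¬ G.Linked C A b) {EA EB : Set (∀ i, Val i)} (c : ∀ i, Val i)
    (hEA : ∀ v w : ∀ i, Val i, (∀ i ∈ A, v i = w i) → (v ∈ EA ↔ w ∈ EA))
    (hEB : ∀ v w : ∀ i, Val i, (∀ i ∈ B, v i = w i) → (v ∈ EB ↔ w ∈ EB)) :
    M.prob (EA ∩ EB ∩ {v | ∀ i ∈ C, v i = c i}) * M.prob {v | ∀ i ∈ C, v i = c i} =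
      M.prob (EA ∩ {v | ∀ i ∈ C, v i = c i}) * M.prob (EB ∩ {v | ∀ i ∈ C, v i = c i}) := by
  classical
  have := Fintype.ofFinite N
  have : ∀ i, Fintype (Val i) := fun i => Fintype.ofFinite _
  set EC : Set (∀ i, Val i) := {v | ∀ i ∈ C, v i = c i} with hEC
  let U : Set N := {i | G.Linked C A i}
  -- A pair of assignments with the same values on `C` exchanges its values on `U` outside `C`. The
  -- equations of `U` involve only variables in `U ∪ C`, and the others none in `U \ C`, so by the
  -- factorization the exchange preserves the product of the two probabilities. The independence is
  -- then a bijection between sums over pairs.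
  let sw : (∀ i, Val i) → (∀ i, Val i) → (∀ i, Val i) := fun v w i =>
    if i ∈ U ∧ i ∉ C then v i else w i
  have hswC : ∀ v w, v ∈ EC → w ∈ EC → sw v w ∈ EC := fun v w hv hw i hi => by
    simp only [sw, hi, not_true, and_false, if_false]
    exact hw i hi
  have hP : ∀ v w, v ∈ EC → w ∈ EC →
      M.prob {v} * M.prob {w} = M.prob {sw v w} * M.prob {sw w v} := by
    have hbi : ∀ i j, i ∈ U → G.bi i j → j ∈ U := fun i j hi h => hi.bi h
    have hα : ∀ v w, v ∈ EC → w ∈ EC → ∀ i ∈ U, ∀ u,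
        M.f i (sw v w) u = sw v w i ↔ M.f i v u = v i := by
      intro v w hv hw
      have hsw : ∀ i, i ∈ U ∨ i ∈ C → sw v w i = v i := by
        intro i hi
        by_cases hC : i ∈ C
        · rw [hswC v w hv hw i hC, hv i hC]
        · simp only [sw, hi.resolve_right hC, hC, not_false_eq_true, and_self, if_true]
      intro i hi u
      rw [hsw i (Or.inl hi), M.f_parents i (sw v w) v u fun j hj => hsw j ?_]
      by_cases hC : j ∈ C
      · exact Or.inr hC
      · exact Or.inl (hi.up hj hC)
    have hβ : ∀ v w, ∀ i ∈ Uᶜ, ∀ u, M.f i (sw v w) u = sw v w i ↔ M.f i w u = w i := by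
      intro v w
      have hsw : ∀ i, ¬ (i ∈ U ∧ i ∉ C) → sw v w i = w i := fun i hi => if_neg hi
      intro i hi u
      rw [hsw i fun h => hi h.1, M.f_parents i (sw v w) w u fun j hj => hsw j ?_]
      exact fun h => hi (ADMG.Linked.down h.1 h.2 hj)
    intro v w hv hw
    simp only [M.prob_singleton U hbi]
    have a1 : {u | ∀ i ∈ U, M.f i (sw v w) u = sw v w i} = {u | ∀ i ∈ U, M.f i v u = v i} :=
      Set.ext fun u => forall₂_congr fun i hi => hα v w hv hw i hi u
    have a2 : {u | ∀ i ∈ U, M.f i (sw w v) u = sw w v i} = {u | ∀ i ∈ U, M.f i w u = w i} :=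
      Set.ext fun u => forall₂_congr fun i hi => hα w v hw hv i hi u
    have a3 : {u | ∀ i ∈ Uᶜ, M.f i (sw v w) u = sw v w i} = {u | ∀ i ∈ Uᶜ, M.f i w u = w i} :=
      Set.ext fun u => forall₂_congr fun i hi => hβ v w i hi u
    have a4 : {u | ∀ i ∈ Uᶜ, M.f i (sw w v) u = sw w v i} = {u | ∀ i ∈ Uᶜ, M.f i v u = v i} :=
      Set.ext fun u => forall₂_congr fun i hi => hβ w v i hi u
    rw [a1, a2, a3, a4]
    ring
  have hswsw : ∀ v w, sw (sw v w) (sw w v) = v := by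
    intro v w
    funext i
    simp only [sw]
    split_ifs <;> rfl
  have hA : ∀ v w, sw v w ∈ EA ↔ v ∈ EA := fun v w => hEA _ _ fun i hi =>
    if_pos ⟨ADMG.Linked.base hi, hAC i hi⟩
  have hBw : ∀ v w, sw v w ∈ EB ↔ w ∈ EB := fun v w => hEB _ _ fun i hi =>
    if_neg fun h => hB i hi h.1
  rw [M.prob_eq_sum (EA ∩ EB ∩ EC), M.prob_eq_sum EC, M.prob_eq_sum (EA ∩ EC),
    M.prob_eq_sum (EB ∩ EC), Finset.sum_mul_sum, Finset.sum_mul_sum, ← Finset.sum_product',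
    ← Finset.sum_product']
  let e : (∀ i, Val i) × (∀ i, Val i) ≃ (∀ i, Val i) × (∀ i, Val i) :=
    { toFun := fun q => (sw q.1 q.2, sw q.2 q.1)
      invFun := fun q => (sw q.1 q.2, sw q.2 q.1)
      left_inv := fun q => Prod.ext (hswsw _ _) (hswsw _ _)
      right_inv := fun q => Prod.ext (hswsw _ _) (hswsw _ _) }
  refine Finset.sum_equiv e (by simp) ?_
  rintro ⟨v, w⟩ -
  have hC1 : sw v w ∈ EC ∧ sw w v ∈ EC ↔ v ∈ EC ∧ w ∈ EC := by
    constructor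
    · rintro ⟨h1, h2⟩
      have h3 := hswC _ _ h1 h2
      have h4 := hswC _ _ h2 h1
      rw [hswsw] at h3 h4
      exact ⟨h3, h4⟩
    · exact fun ⟨h1, h2⟩ => ⟨hswC _ _ h1 h2, hswC _ _ h2 h1⟩
  change (if v ∈ EA ∩ EB ∩ EC then M.prob {v} else 0) * (if w ∈ EC then M.prob {w} else 0) =
    (if sw v w ∈ EA ∩ EC then M.prob {sw v w} else 0) *
      (if sw w v ∈ EB ∩ EC then M.prob {sw w v} else 0)
  simp only [Set.mem_inter_iff, hA, hBw]
  by_cases hC : v ∈ EC ∧ w ∈ EC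
  · have hC' := hC1.2 hC
    simp only [hC.1, hC.2, hC'.1, hC'.2, and_true, if_true]
    by_cases h1 : v ∈ EA <;> by_cases h2 : v ∈ EB <;> simp [h1, h2, hP v w hC.1 hC.2]
  · have hC' := mt hC1.1 hC
    have e1 : (if (v ∈ EA ∧ v ∈ EB) ∧ v ∈ EC then M.prob {v} else 0) *
        (if w ∈ EC then M.prob {w} else 0) = 0 := by
      rw [not_and_or] at hC
      rcases hC with h | h <;> simp [h]
    have e2 : (if v ∈ EA ∧ sw v w ∈ EC then M.prob {sw v w} else 0) *
        (if v ∈ EB ∧ sw w v ∈ EC then M.prob {sw w v} else 0) = 0 := by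
      rw [not_and_or] at hC'
      rcases hC' with h | h <;> simp [h]
    rw [e1, e2]

end Sol

end SCM

/-! ### The counterfactual Y and the factual X and C in one model -/

namespace ADMG

variable {N : Type*} {G : ADMG N} {X Y C R : Set N}

/-- The ancestors of `X ∪ C`, and the ancestors of `Y` by directed walks that avoid `X`. -/
def adjNodes (G : ADMG N) (X Y C : Set N) : Set N := {i | G.AncOf (X ∪ C) i} ∪ G.freeAnc X Y

/-- The graph without the edges that start proper causal walks, on the nodes `adjNodes`. -/
def adjGraph (G : ADMG N) (X Y C : Set N) : ADMG N where
  dir a b := (G.removeCausal X Y).dir a b ∧ b ∈ G.adjNodes X Y C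
  bi a b := G.bi a b ∧ a ∈ G.adjNodes X Y C ∧ b ∈ G.adjNodes X Y C
  bi_symm a b h := ⟨G.bi_symm a b h.1, h.2.2, h.2.1⟩
  bi_irrefl a h := G.bi_irrefl a h.1
  acyclic a h := (G.removeCausal X Y).acyclic a
    (Relation.TransGen.mono (fun _ _ h => h.1) a a h)

/-- If `i` does not lead to `C`, then as an element of `adjNodes` it leads to `X` or, avoiding `X`,
to `Y`. In the first case a directed walk read backwards from `X` arrives at `i` without an
arrowhead. In the second the given walk could be continued openly to `Y`, contrary to `hn`. -/
theorem reach_or_ancOf (hXC : ∀ x ∈ X, x ∉ C) (hn : ¬ Conn (G.removeCausal X Y) G C X Y) {i : N}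
    {w : ℕ} {h : Bool} (hr : Reach (G.removeCausal X Y) G C X w h i)
    (hi : i ∈ G.adjNodes X Y C) :
    G.AncOf C i ∨ (∃ w, Reach (G.removeCausal X Y) G C X w false i) ∧ i ∉ C := by
  by_cases ha : G.AncOf C i
  · exact Or.inl ha
  have hC : ∀ n, (G.removeIn X).Desc i n → n ∉ C :=
    fun n hd hnC => ha ⟨n, hnC, Desc.of_removeIn hd⟩
  have hiC := hC i Relation.ReflTransGen.refl
  refine Or.inr ⟨?_, hiC⟩
  by_cases hiX : i ∈ X
  · exact ⟨0, Reach.start hiX⟩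
  rcases hi with ⟨c, hc, hd⟩ | hi
  · rcases Desc.removeIn_or (X := X) hd with h1 | ⟨p, x, hx, h1, h2, -⟩
    · rcases hc with hc | hc
      · exact absurd hc (Desc.notMem_of_removeIn h1 hiX)
      · exact absurd hc (hC _ h1)
    · exact reach_of_dir_mem hx (hXC x hx) hiX h1 h2 hC
  · obtain ⟨w', r⟩ := reach_of_freeAnc hi hC
    exact absurd (hr.conn r hiC) hn

/-- The moralization argument. Links may pass a collider freely, open walks may not; but all nodes
concerned are in `adjNodes`, so by `reach_or_ancOf` a collider is either open or can be reached
afresh without an arrowhead. The induction keeps track of arrival with an arrowhead, or without one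
outside `C`. -/
theorem Linked.reach (hXC : ∀ x ∈ X, x ∉ C) (hn : ¬ Conn (G.removeCausal X Y) G C X Y) {i : N}
    (h : (G.adjGraph X Y C).Linked C X i) :
    (∃ w, Reach (G.removeCausal X Y) G C X w true i) ∨
      (∃ w, Reach (G.removeCausal X Y) G C X w false i) ∧ i ∉ C := by
  induction h with
  | base h => exact Or.inr ⟨⟨0, Reach.start h⟩, hXC _ h⟩
  | @bi i j _ h ih =>
    left
    have aux : ∀ {w}, Reach (G.removeCausal X Y) G C X w false i → i ∉ C →
        ∃ w, Reach (G.removeCausal X Y) G C X w true j := fun r hC =>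
      ⟨_, r.step (k := EdgeKind.bidir) h.1 (by rw [Bool.false_and]; exact jopen_false.2 hC)⟩
    rcases ih with ⟨w, r⟩ | ⟨⟨w, r⟩, hC⟩
    · rcases reach_or_ancOf hXC hn r h.2.1 with ha | ⟨⟨w', r'⟩, hC⟩
      · exact ⟨_, r.step (k := EdgeKind.bidir) h.1 (jopen_true.2 ha)⟩
      · exact aux r' hC
    · exact aux r hC
  | @down i j _ hC h ih =>
    left
    have aux : ∀ {w b}, Reach (G.removeCausal X Y) G C X w b i →
        ∃ w, Reach (G.removeCausal X Y) G C X w true j := fun r =>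
      ⟨_, r.step (k := EdgeKind.fwd) h.1
        (by rw [EdgeKind.headAtStart, Bool.and_false]; exact jopen_false.2 hC)⟩
    rcases ih with ⟨w, r⟩ | ⟨⟨w, r⟩, -⟩
    · exact aux r
    · exact aux r
  | @up i j _ h hC ih =>
    refine Or.inr ⟨?_, hC⟩
    have aux : ∀ {w}, Reach (G.removeCausal X Y) G C X w false i → i ∉ C →
        ∃ w, Reach (G.removeCausal X Y) G C X w false j := fun r hC =>
      ⟨_, r.step (k := EdgeKind.bwd) h.1 (by rw [Bool.false_and]; exact jopen_false.2 hC)⟩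
    rcases ih with ⟨w, r⟩ | ⟨⟨w, r⟩, hC⟩
    · rcases reach_or_ancOf hXC hn r h.2 with ha | ⟨⟨w', r'⟩, hC⟩
      · exact ⟨_, r.step (k := EdgeKind.bwd) h.1 (jopen_true.2 ha)⟩
      · exact aux r' hC
    · exact aux r hC

theorem not_linked (hXC : ∀ x ∈ X, x ∉ C) (hYC : ∀ y ∈ Y, y ∉ C)
    (hn : ¬ Conn (G.removeCausal X Y) G C X Y) :
    ∀ y ∈ Y, ¬ (G.adjGraph X Y C).Linked C X y := by
  intro y hy h
  rcases h.reach hXC hn with ⟨w, r⟩ | ⟨⟨w, r⟩, -⟩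
  · exact hn (r.conn (Reach.start hy) (hYC y hy))
  · exact hn (r.conn (Reach.start hy) (hYC y hy))

/-- A directed walk from `t` to `R` either avoids `X`, so that `Y` and `R` share a source, or its
first node in `X` lies above `R` and shares a source with `Y`. If `t` itself is in `X`, the
bidirected edge to `d` serves. -/
theorem sharedSource_or_backSource {d t : N} (hd : d ∈ G.freeAnc X Y) (ht : G.AncOf R t)
    (h : t = d ∨ G.bi t d) :
    G.SharedSource X Y R ∨ ∃ x ∈ X, G.AncOf R x ∧ G.BackSource X Y x := by
  by_cases htX : t ∈ X
  · rcases h with rfl | h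
    · exact absurd htX hd.1
    · exact Or.inr ⟨t, htX, ht, Or.inl ⟨d, hd, h⟩⟩
  · obtain ⟨r, hr, h1⟩ := ht
    rcases Desc.removeIn_or (X := X) h1 with h2 | ⟨p, x, hx, h2, h3, h4⟩
    · exact Or.inl ⟨d, hd, t, htX, h, r, hr, h2⟩
    · exact Or.inr ⟨x, hx, ⟨r, hr, h4⟩, Or.inr ⟨d, hd, t, htX, h, p, h2, h3⟩⟩

end ADMG

namespace SCM

open ADMG

variable {N : Type*} {G : ADMG N} {Val : N → Type} {X Y C R : Set N}

open Classical in
/-- The model on `adjGraph` in which `x` is substituted for the variables in `X` in the equations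
of the ancestors of `Y`. -/
noncomputable def adjModel [∀ i, Nonempty (Val i)] (M : SCM G Val) (X Y C : Set N)
    (x : ∀ i, Option (Val i)) (hx : ∀ i, i ∈ X → ∃ a, x i = some a) :
    SCM (G.adjGraph X Y C) Val where
  Exo := M.Exo
  exoFintype := M.exoFintype
  Noise := M.Noise
  noiseMeasurableSpace := M.noiseMeasurableSpace
  law := M.law
  lawProbability := M.lawProbability
  scope k := M.scope k ∩ G.adjNodes X Y C
  bi_of_scope k i j hi hj h := ⟨M.bi_of_scope k i j hi.1 hj.1 h, hi.2, hj.2⟩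
  f i v u := if i ∈ G.adjNodes X Y C then
      if i ∈ G.freeAnc X Y then M.f i (fun j => (x j).getD (v j)) u else M.f i v u
    else Classical.arbitrary _
  f_parents i v v' u h := by
    split_ifs with h1 h2
    · refine M.f_parents i _ _ u fun j hj => ?_
      -- In these equations the parents in `X` are overwritten by constants, so the edges deleted in
      -- `removeCausal` are not needed.
      by_cases hX : j ∈ X
      · obtain ⟨a, ha⟩ := hx j hX
        simp [ha]
      · rw [h j ⟨⟨hj, fun h' => hX h'.1⟩, h1⟩]
    · exact M.f_parents i _ _ u fun j hj => h j ⟨⟨hj, fun h' => h2 h'.2⟩, h1⟩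
    · rfl
  f_noise i v u u' h := by
    split_ifs with h1 h2
    · exact M.f_noise i _ _ _ fun k hk => h k ⟨hk, h1⟩
    · exact M.f_noise i _ _ _ fun k hk => h k ⟨hk, h1⟩
    · rfl
  f_measurable i v a := by
    split_ifs with h1 h2
    · exact M.f_measurable i _ a
    · exact M.f_measurable i _ a
    · exact MeasurableSet.const _

variable [Finite N] [∀ i, Nonempty (Val i)] (M : SCM G Val) (x : ∀ i, Option (Val i))

/-- The solution of the structural equations under an intervention. -/
noncomputable def doSol (u : ∀ k, M.Noise k) : ∀ i, Val i := (M.intervene x).sol u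

theorem doSol_of_none (u : ∀ k, M.Noise k) {i : N} (hi : x i = none) :
    M.doSol x u i = M.f i (M.doSol x u) u := by
  have h := (M.intervene x).solves_sol u i
  simp only [intervene, hi] at h
  exact h

theorem doSol_of_some (u : ∀ k, M.Noise k) {i : N} {a : Val i} (hi : x i = some a) :
    M.doSol x u i = a := by
  have h := (M.intervene x).solves_sol u i
  simp only [intervene, hi] at h
  exact h

/-- Consistency: the intervention has no effect if the variables take its values anyway. -/
theorem doSol_eq_sol {u : ∀ k, M.Noise k} (h : ∀ i a, x i = some a → M.sol u i = a) :
    M.doSol x u = M.sol u := by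
  refine (M.intervene x).sol_eq_iff.2 fun i => ?_
  change M.sol u i = (x i).getD (M.f i (M.sol u) u)
  cases hi : x i with
  | none => exact M.solves_sol u i
  | some a => exact h i a hi

section AdjModel

variable {x} (hX : ∀ i, i ∈ X → ∃ a, x i = some a)

/-- The substitution affects only equations of free ancestors of `Y` with a parent in `X`, and by
`hsep` no such node is an ancestor of `X ∪ C`. This part of the model stays factual. -/
theorem adjModel_sol_of_ancOf (u : ∀ k, M.Noise k)
    (hsep : ∀ d ∈ G.freeAnc X Y, ∀ j ∈ X, G.dir j d → ¬ G.AncOf (X ∪ C) d)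
    (hX' : ∀ i, i ∉ X → x i = none) {i : N} (hi : G.AncOf (X ∪ C) i) :
    (M.adjModel X Y C x hX).sol u i = M.sol u i := by
  induction i using G.wellFounded_dir.induction with
  | _ i ih =>
  rw [(M.adjModel X Y C x hX).solves_sol u i, M.solves_sol u i]
  have h1 : i ∈ G.adjNodes X Y C := Or.inl hi
  simp only [adjModel, h1, if_true]
  split_ifs with h2
  · refine M.f_parents i _ _ u fun j hj => ?_
    rw [hX' j fun hjX => hsep i h2 j hjX hj hi]
    exact ih j hj (hi.of_dir hj)
  · exact M.f_parents i _ _ u fun j hj => ih j hj (hi.of_dir hj)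

/-- A parent of a free ancestor is in `X`, where the intervened value is substituted, or is again a
free ancestor. This part of the model is counterfactual. -/
theorem adjModel_sol_of_freeAnc (u : ∀ k, M.Noise k)
    (hX' : ∀ i, i ∉ X → x i = none) {i : N} (hi : i ∈ G.freeAnc X Y) :
    (M.adjModel X Y C x hX).sol u i = M.doSol x u i := by
  induction i using G.wellFounded_dir.induction with
  | _ i ih =>
  rw [(M.adjModel X Y C x hX).solves_sol u i, doSol_of_none M x u (hX' i hi.1)]
  have h1 : i ∈ G.adjNodes X Y C := Or.inr hi
  simp only [adjModel, h1, hi, if_true]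
  refine M.f_parents i _ _ u fun j hj => ?_
  by_cases hjX : j ∈ X
  · obtain ⟨a, ha⟩ := hX j hjX
    rw [doSol_of_some M x u ha, ha]
    rfl
  · rw [hX' j hjX]
    exact ih j hj (freeAnc_of_dir hj hjX hi)

/-- The counterfactual `Y` is independent of the factual `X` given `C`. -/
theorem cond_indep_intervene [∀ i, Finite (Val i)] (hX : ∀ i, i ∈ X → ∃ a, x i = some a)
    (hX' : ∀ i, i ∉ X → x i = none) (hXY : ∀ y ∈ Y, y ∉ X) (hXC : ∀ x ∈ X, x ∉ C)
    (hYC : ∀ y ∈ Y, y ∉ C)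
    (hF : ∀ d ∈ G.freeAnc X Y, (∃ x ∈ X, G.Desc x d) → ∀ n, (G.removeIn X).Desc d n → n ∉ C)
    (hn : ¬ Conn (G.removeCausal X Y) G C X Y) {EA EB : Set (∀ i, Val i)} (c : ∀ i, Val i)
    (hEA : ∀ v w : ∀ i, Val i, (∀ i ∈ X, v i = w i) → (v ∈ EA ↔ w ∈ EA))
    (hEB : ∀ v w : ∀ i, Val i, (∀ i ∈ Y, v i = w i) → (v ∈ EB ↔ w ∈ EB)) :
    (Measure.pi M.law).real {u | M.sol u ∈ EA ∧ M.doSol x u ∈ EB ∧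
        ∀ i ∈ C, M.sol u i = c i} * (Measure.pi M.law).real {u | ∀ i ∈ C, M.sol u i = c i} =
      (Measure.pi M.law).real {u | M.sol u ∈ EA ∧ ∀ i ∈ C, M.sol u i = c i} *
      (Measure.pi M.law).real {u | M.doSol x u ∈ EB ∧ ∀ i ∈ C, M.sol u i = c i} := by
  -- A node that violated this would be the source of an open walk between `X` and `Y` in
  -- `removeCausal`, so factual and counterfactual parts do not conflict.
  have hsep : ∀ d ∈ G.freeAnc X Y, ∀ j ∈ X, G.dir j d → ¬ G.AncOf (X ∪ C) d :=
    fun d hd j hj hjd ha => hn (conn_of_freeAnc_of_ancOf hXC hd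
      (hF d hd ⟨j, hj, Relation.ReflTransGen.single hjd⟩) ha)
  have key := (M.adjModel X Y C x hX).cond_indep hXC (not_linked hXC hYC hn) (EA := EA)
    (EB := EB) c hEA hEB
  have e1 : ∀ u : ∀ k, M.Noise k, (M.adjModel X Y C x hX).sol u ∈ EA ↔ M.sol u ∈ EA := fun u =>
    hEA _ _ fun i hi => M.adjModel_sol_of_ancOf hX u hsep hX' (AncOf.of_mem (Or.inl hi))
  have e2 : ∀ u : ∀ k, M.Noise k, (M.adjModel X Y C x hX).sol u ∈ EB ↔
      M.doSol x u ∈ EB := fun u =>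
    hEB _ _ fun i hi => M.adjModel_sol_of_freeAnc hX u hX' (freeAnc_of_mem hi (hXY i hi))
  have e3 : ∀ u : ∀ k, M.Noise k, (∀ i ∈ C, (M.adjModel X Y C x hX).sol u i = c i) ↔
      ∀ i ∈ C, M.sol u i = c i := fun u => forall₂_congr fun i hi => by
    rw [M.adjModel_sol_of_ancOf hX u hsep hX' (AncOf.of_mem (Or.inr hi))]
  simp only [prob_eq] at key
  have f1 : {u : ∀ k, M.Noise k | (M.adjModel X Y C x hX).sol u ∈
      EA ∩ EB ∩ {v | ∀ i ∈ C, v i = c i}} = {u | M.sol u ∈ EA ∧ M.doSol x u ∈ EB ∧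
        ∀ i ∈ C, M.sol u i = c i} := by
    ext u
    exact ((and_congr (and_congr (e1 u) (e2 u)) (e3 u)).trans and_assoc)
  have f2 : {u : ∀ k, M.Noise k | (M.adjModel X Y C x hX).sol u ∈ {v | ∀ i ∈ C, v i = c i}} =
      {u | ∀ i ∈ C, M.sol u i = c i} := Set.ext e3
  have f3 : {u : ∀ k, M.Noise k | (M.adjModel X Y C x hX).sol u ∈
      EA ∩ {v | ∀ i ∈ C, v i = c i}} = {u | M.sol u ∈ EA ∧ ∀ i ∈ C, M.sol u i = c i} :=
    Set.ext fun u => and_congr (e1 u) (e3 u)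
  have f4 : {u : ∀ k, M.Noise k | (M.adjModel X Y C x hX).sol u ∈
      EB ∩ {v | ∀ i ∈ C, v i = c i}} =
        {u | M.doSol x u ∈ EB ∧ ∀ i ∈ C, M.sol u i = c i} :=
    Set.ext fun u => and_congr (e2 u) (e3 u)
  have g : ∀ {S T : Set (∀ k, M.Noise k)}, S = T →
      (Measure.pi M.law).real S = (Measure.pi M.law).real T := fun h => by rw [h]
  exact (congrArg₂ (· * ·) (g f1) (g f2)).symm.trans
    (key.trans (congrArg₂ (· * ·) (g f3) (g f4)))

end AdjModel

theorem sol_congr_of_ancOf {u u' : ∀ k, M.Noise k}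
    (h : ∀ k, (∃ i, G.AncOf R i ∧ i ∈ M.scope k) → u k = u' k) {i : N} (hi : G.AncOf R i) :
    M.sol u i = M.sol u' i := by
  induction i using G.wellFounded_dir.induction with
  | _ i ih =>
  rw [M.solves_sol u i, M.solves_sol u' i, M.f_noise i _ u u' fun k hk => h k ⟨i, hi, hk⟩]
  exact M.f_parents i _ _ u' fun j hj => ih j hj (hi.of_dir hj)

variable {x} in
theorem doSol_congr_of_freeAnc (hX : ∀ i, i ∈ X → ∃ a, x i = some a)
    (hX' : ∀ i, i ∉ X → x i = none) {u u' : ∀ k, M.Noise k}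
    (h : ∀ k, (∃ i ∈ G.freeAnc X Y, i ∈ M.scope k) → u k = u' k) {i : N}
    (hi : i ∈ G.freeAnc X Y) : M.doSol x u i = M.doSol x u' i := by
  induction i using G.wellFounded_dir.induction with
  | _ i ih =>
  rw [doSol_of_none M x u (hX' i hi.1), doSol_of_none M x u' (hX' i hi.1),
    M.f_noise i _ u u' fun k hk => h k ⟨i, hi, hk⟩]
  refine M.f_parents i _ _ u' fun j hj => ?_
  by_cases hjX : j ∈ X
  · obtain ⟨a, ha⟩ := hX j hjX
    rw [doSol_of_some M x u ha, doSol_of_some M x u' ha]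
  · exact ih j hj (freeAnc_of_dir hj hjX hi)

variable {x} in
/-- The counterfactual `Y` is independent of the factual `R`. -/
theorem indep_intervene [∀ i, Finite (Val i)] (hX : ∀ i, i ∈ X → ∃ a, x i = some a)
    (hX' : ∀ i, i ∉ X → x i = none) (hXY : ∀ y ∈ Y, y ∉ X)
    (hS : ¬ G.SharedSource X Y R) (hB : ∀ x ∈ X, G.AncOf R x → ¬ G.BackSource X Y x)
    {EB ER : Set (∀ i, Val i)}
    (hEB : ∀ v w : ∀ i, Val i, (∀ i ∈ Y, v i = w i) → (v ∈ EB ↔ w ∈ EB))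
    (hER : ∀ v w : ∀ i, Val i, (∀ i ∈ R, v i = w i) → (v ∈ ER ↔ w ∈ ER)) :
    (Measure.pi M.law).real {u | M.doSol x u ∈ EB ∧ M.sol u ∈ ER} =
      (Measure.pi M.law).real {u | M.doSol x u ∈ EB} *
        (Measure.pi M.law).real {u | M.sol u ∈ ER} := by
  -- The counterfactual `Y` depends only on noises of its free ancestors, the factual `R` only on
  -- noises of ancestors of `R`. A noise common to both would yield `t = d` or a bidirected edge,
  -- hence a forbidden common source.
  refine measureReal_pi_inter M.law (fun k => ∃ i ∈ G.freeAnc X Y, i ∈ M.scope k)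
    ((M.intervene x).measurableSet_sol EB) (M.measurableSet_sol ER) ?_ ?_
  · exact fun u u' h => hEB _ _ fun i hi =>
      M.doSol_congr_of_freeAnc hX hX' h (freeAnc_of_mem hi (hXY i hi))
  · refine fun u u' h => hER _ _ fun i hi => M.sol_congr_of_ancOf ?_ (AncOf.of_mem hi)
    rintro k ⟨t, ht, htk⟩
    refine h k ?_
    rintro ⟨d, hd, hdk⟩
    have htd : t = d ∨ G.bi t d := or_iff_not_imp_left.2 (M.bi_of_scope k t d htk hdk)
    rcases sharedSource_or_backSource hd ht htd with h1 | ⟨j, hj, h1, h2⟩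
    · exact hS h1
    · exact hB j hj h1 h2

end SCM

/-! ### Sufficiency of the criterion -/

section Soundness

variable {V : Type*} {Vm : Finset V}

instance MVal.finite {Dom : V → Type} [∀ v, Finite (Dom v)] (i : MNode Vm) :
    Finite (MVal Vm Dom i) := by
  cases i with
  | inl v => exact inferInstanceAs (Finite (Dom v))
  | inr r => exact inferInstanceAs (Finite Bool)

instance MVal.nonempty {Dom : V → Type} [∀ v, Nonempty (Dom v)] (i : MNode Vm) :
    Nonempty (MVal Vm Dom i) := by
  cases i with
  | inl v => exact inferInstanceAs (Nonempty (Dom v))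
  | inr r => exact inferInstanceAs (Nonempty Bool)

theorem mem_varEvent_congr {Dom : V → Type} (S : Finset V) (s : ∀ v : S, Dom v)
    (a b : ∀ i, MVal Vm Dom i) (h : ∀ i ∈ varNodes Vm S, a i = b i) :
    a ∈ varEvent Vm S s ↔ b ∈ varEvent Vm S s := by
  refine forall_congr' fun v => ?_
  rw [h (Sum.inl v.1) ⟨v.1, v.2, rfl⟩]

theorem mem_indEvent_congr {Dom : V → Type} (S : Finset V)
    (a b : ∀ i, MVal Vm Dom i) (h : ∀ i ∈ indNodes Vm S, a i = b i) :
    a ∈ indEvent Vm S ↔ b ∈ indEvent Vm S := by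
  refine forall₂_congr fun r hr => ?_
  rw [h (Sum.inr r) ⟨r, hr, rfl⟩]

variable [DecidableEq V]

/-- An assignment with prescribed values on `Z` at which all indicators are `1`. -/
noncomputable def varAssign (Vm : Finset V) {Dom : V → Type} [∀ v, Nonempty (Dom v)]
    (Z : Finset V) (z : ∀ v : Z, Dom v) : ∀ i, MVal Vm Dom i
  | Sum.inl v => if h : v ∈ Z then z ⟨v, h⟩ else Classical.arbitrary (Dom v)
  | Sum.inr _ => true

theorem forall_eq_varAssign_iff {Dom : V → Type} [∀ v, Nonempty (Dom v)] (Z S : Finset V)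
    (z : ∀ v : Z, Dom v) (a : ∀ i, MVal Vm Dom i) :
    (∀ i ∈ varNodes Vm Z ∪ indNodes Vm S, a i = varAssign Vm Z z i) ↔
      a ∈ varEvent Vm Z z ∧ a ∈ indEvent Vm S := by
  constructor
  · intro h
    refine ⟨fun v => ?_, fun r hr => h _ (Or.inr ⟨r, hr, rfl⟩)⟩
    rw [h _ (Or.inl ⟨v.1, v.2, rfl⟩)]
    exact dif_pos v.2
  · rintro ⟨h1, h2⟩ i (⟨v, hv, rfl⟩ | ⟨r, hr, rfl⟩)
    · rw [h1 ⟨v, hv⟩]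
      have h3 : varAssign Vm Z z (Sum.inl v) = z ⟨v, hv⟩ := dif_pos hv
      exact h3.symm
    · exact h2 r hr

theorem doAssign_of_mem {Dom : V → Type} {X : Finset V} (x : ∀ v : X, Dom v) {v : V}
    (h : v ∈ X) : doAssign Vm X x (Sum.inl v) = some (x ⟨v, h⟩) := dif_pos h

theorem doAssign_of_notMem {Dom : V → Type} {X : Finset V} (x : ∀ v : X, Dom v) {i : MNode Vm}
    (h : i ∉ varNodes Vm X) : doAssign Vm X x i = none := by
  cases i with
  | inl v => exact dif_neg fun hv => h (inl_mem_varNodes.2 hv)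
  | inr r => rfl

variable [Fintype V]

theorem doSol_eq_sol_of_mem {Dom : V → Type} [∀ v, Nonempty (Dom v)] {G : ADMG (MNode Vm)}
    (M : SCM G (MVal Vm Dom)) {X : Finset V} {x : ∀ v : X, Dom v} {u : ∀ k, M.Noise k}
    (h : M.sol u ∈ varEvent Vm X x) : M.doSol (doAssign Vm X x) u = M.sol u := by
  refine M.doSol_eq_sol _ fun i a hi => ?_
  cases i with
  | inl v =>
    by_cases hv : v ∈ X
    · rw [doAssign_of_mem x hv] at hi
      cases hi
      exact h ⟨v, hv⟩
    · rw [doAssign_of_notMem x fun h => hv (inl_mem_varNodes.1 h)] at hi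
      cases hi
  | inr r => cases hi

theorem sum_measureReal_varEvent {Dom : V → Type} [∀ v, Fintype (Dom v)]
    [∀ v, Nonempty (Dom v)] {G : ADMG (MNode Vm)} (M : SCM G (MVal Vm Dom)) (Z : Finset V)
    {S : Set (∀ k, M.Noise k)} (hS : MeasurableSet S) :
    ∑ z : ∀ v : Z, Dom v, (Measure.pi M.law).real {u | u ∈ S ∧ M.sol u ∈ varEvent Vm Z z} =
      (Measure.pi M.law).real S := by
  rw [← measureReal_biUnion_finset]
  · congr 1
    ext u
    simp only [Finset.mem_univ, Set.iUnion_true, Set.mem_iUnion, Set.mem_ofPred_eq,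
      exists_and_left, and_iff_left_iff_imp]
    exact fun _ => ⟨fun v => M.sol u (Sum.inl v.1), fun v => rfl⟩
  · intro z _ z' _ hne
    refine Set.disjoint_left.2 fun u h1 h2 => hne ?_
    funext v
    exact (h1.2 v).symm.trans (h2.2 v)
  · exact fun z _ => hS.inter (M.measurableSet_sol (varEvent Vm Z z))

/-- By consistency and `hCI`, each term of the formula is P(Y_x = y, z, R_W = 1) / P(R_W = 1). The
sum over z leaves P(Y_x = y | R_W = 1), which is the causal effect by `hind`. -/
theorem MGraph.WalkCriterion.isMAdjustmentSet {G : MGraph V Vm} {X Y Z : Finset V}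
    (h : G.WalkCriterion X Y Z) (hXY : Disjoint X Y) (hXZ : Disjoint X Z) (hYZ : Disjoint Y Z) :
    G.IsMAdjustmentSet X Y Z := by
  intro Dom _ _ M x y R1 hR hpos
  have hYX := notMem_varNodes_of_disjoint (Vm := Vm) hXY.symm
  have hXC : ∀ x ∈ varNodes Vm X, x ∉ varNodes Vm Z ∪ indNodes Vm (X ∪ Y ∪ Z) := by
    rintro x hx (h | h)
    · exact notMem_varNodes_of_disjoint hXZ x hx h
    · exact notMem_indNodes_of_varNodes x hx h
  have hYC : ∀ x ∈ varNodes Vm Y, x ∉ varNodes Vm Z ∪ indNodes Vm (X ∪ Y ∪ Z) := by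
    rintro x hx (h | h)
    · exact notMem_varNodes_of_disjoint hYZ x hx h
    · exact notMem_indNodes_of_varNodes x hx h
  have hX1 : ∀ i, i ∈ varNodes Vm X → ∃ a, doAssign Vm X x i = some a := by
    rintro _ ⟨v, hv, rfl⟩
    exact ⟨_, doAssign_of_mem x hv⟩
  have hX2 : ∀ i, i ∉ varNodes Vm X → doAssign Vm X x i = none := fun i hi =>
    doAssign_of_notMem x hi
  set μ := Measure.pi M.law with hμ
  set D : (∀ k, M.Noise k) → ∀ i, MVal Vm Dom i := M.doSol (doAssign Vm X x) with hD
  have hDm : MeasurableSet {u | D u ∈ varEvent Vm Y y} :=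
    (M.intervene (doAssign Vm X x)).measurableSet_sol _
  have hind : μ.real {u | D u ∈ varEvent Vm Y y ∧ M.sol u ∈ R1} =
      μ.real {u | D u ∈ varEvent Vm Y y} * μ.real {u | M.sol u ∈ R1} :=
    M.indep_intervene hX1 hX2 hYX h.not_shared h.not_back (mem_varEvent_congr Y y)
      (mem_indEvent_congr (X ∪ Y ∪ Z))
  have hCI : ∀ z : ∀ v : Z, Dom v,
      μ.real {u | M.sol u ∈ varEvent Vm X x ∧ D u ∈ varEvent Vm Y y ∧
        M.sol u ∈ varEvent Vm Z z ∧ M.sol u ∈ R1} *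
        μ.real {u | M.sol u ∈ varEvent Vm Z z ∧ M.sol u ∈ R1} =
      μ.real {u | M.sol u ∈ varEvent Vm X x ∧ M.sol u ∈ varEvent Vm Z z ∧ M.sol u ∈ R1} *
        μ.real {u | D u ∈ varEvent Vm Y y ∧ M.sol u ∈ varEvent Vm Z z ∧ M.sol u ∈ R1} := by
    intro z
    have := M.cond_indep_intervene hX1 hX2 hYX hXC hYC
      (MGraph.forbidden_notMem h.no_forbidden h.not_shared) h.not_conn (varAssign Vm Z z)
      (mem_varEvent_congr X x) (mem_varEvent_congr Y y)
    simpa only [forall_eq_varAssign_iff] using this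
  have hdo : (M.intervene (doAssign Vm X x)).prob (varEvent Vm Y y) =
      μ.real {u | D u ∈ varEvent Vm Y y} := (M.intervene (doAssign Vm X x)).prob_eq _
  have hR' : μ.real {u | M.sol u ∈ R1} ≠ 0 := by rwa [← M.prob_eq]
  have hterm : ∀ z : ∀ v : Z, Dom v,
      M.condProb (varEvent Vm Y y) (varEvent Vm X x ∩ varEvent Vm Z z ∩ R1) *
        M.condProb (varEvent Vm Z z) R1 =
      μ.real {u | (D u ∈ varEvent Vm Y y ∧ M.sol u ∈ R1) ∧ M.sol u ∈ varEvent Vm Z z} /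
        μ.real {u | M.sol u ∈ R1} := by
    intro z
    have e1 : M.prob (varEvent Vm Y y ∩ (varEvent Vm X x ∩ varEvent Vm Z z ∩ R1)) =
        μ.real {u | M.sol u ∈ varEvent Vm X x ∧ D u ∈ varEvent Vm Y y ∧
          M.sol u ∈ varEvent Vm Z z ∧ M.sol u ∈ R1} := by
      rw [M.prob_eq]
      congr 1
      ext u
      simp only [Set.mem_ofPred_eq, Set.mem_inter_iff]
      constructor
      · rintro ⟨h1, ⟨h2, h3⟩, h4⟩
        refine ⟨h2, ?_, h3, h4⟩
        rw [hD, doSol_eq_sol_of_mem M h2]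
        exact h1
      · rintro ⟨h2, h1, h3, h4⟩
        rw [hD, doSol_eq_sol_of_mem M h2] at h1
        exact ⟨h1, ⟨h2, h3⟩, h4⟩
    have e2 : M.prob (varEvent Vm X x ∩ varEvent Vm Z z ∩ R1) =
        μ.real {u | M.sol u ∈ varEvent Vm X x ∧ M.sol u ∈ varEvent Vm Z z ∧ M.sol u ∈ R1} := by
      rw [M.prob_eq]
      congr 1
      ext u
      exact and_assoc
    have e3 : M.prob (varEvent Vm Z z ∩ R1) =
        μ.real {u | M.sol u ∈ varEvent Vm Z z ∧ M.sol u ∈ R1} := M.prob_eq _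
    have e4 : {u | (D u ∈ varEvent Vm Y y ∧ M.sol u ∈ R1) ∧ M.sol u ∈ varEvent Vm Z z} =
        {u | D u ∈ varEvent Vm Y y ∧ M.sol u ∈ varEvent Vm Z z ∧ M.sol u ∈ R1} := by
      ext u
      simp only [Set.mem_ofPred_eq]
      tauto
    have hp := hpos z
    have hc := hCI z
    rw [e2, e3] at hp
    rw [SCM.condProb, SCM.condProb, e1, e2, e3, e4, M.prob_eq R1, ← hμ]
    -- For a `z` of weight zero both sides vanish; otherwise `hpos` makes the division by the
    -- probability of (x, z, R_W = 1) legitimate.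
    by_cases h0 : μ.real {u | M.sol u ∈ varEvent Vm Z z ∧ M.sol u ∈ R1} = 0
    · have h1 : μ.real {u | D u ∈ varEvent Vm Y y ∧ M.sol u ∈ varEvent Vm Z z ∧
          M.sol u ∈ R1} = 0 := by
        refine le_antisymm ?_ measureReal_nonneg
        rw [← h0]
        exact measureReal_mono fun u hu => hu.2
      rw [h0, h1]
      simp
    · have hx := hp h0
      field_simp
      linarith
  rw [hdo, Finset.sum_congr rfl fun z _ => hterm z, ← Finset.sum_div]
  rw [eq_div_iff hR', ← hind]
  exact (sum_measureReal_varEvent M Z (hDm.inter (M.measurableSet_sol R1))).symm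

end Soundness

/-! ### Independent biased bits and their parity -/

section BitMeasure

/-- The law of a bit that equals `true` with probability `1 / 4`. -/
noncomputable def quarterBit : Measure Bool :=
  ENNReal.ofReal (3 / 4) • Measure.dirac false + ENNReal.ofReal (1 / 4) • Measure.dirac true

/-- The weights of `quarterBit`. -/
noncomputable def bitWeight (b : Bool) : ℝ := if b then 1 / 4 else 3 / 4

/-- The sign of a bit. -/
def bitSign (b : Bool) : ℝ := if b then -1 else 1

theorem bitSign_xor (a b : Bool) : bitSign (xor a b) = bitSign a * bitSign b := by
  cases a <;> cases b <;> simp [bitSign]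

theorem bitWeight_pos (b : Bool) : 0 < bitWeight b := by
  cases b <;> simp [bitWeight]

instance : IsProbabilityMeasure quarterBit := by
  constructor
  simp only [quarterBit, Measure.coe_add, Measure.coe_smul, Pi.add_apply, Pi.smul_apply,
    measure_univ, smul_eq_mul, mul_one]
  rw [← ENNReal.ofReal_add (by norm_num) (by norm_num)]
  norm_num

theorem quarterBit_real_singleton (b : Bool) : quarterBit.real {b} = bitWeight b := by
  rw [measureReal_def]
  cases b
  · simp [quarterBit, bitWeight]
    norm_num
  · simp [quarterBit, bitWeight]

variable {E : Type} [Fintype E]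

/-- The law of independent bits that equal `true` with probability `1 / 4`. -/
noncomputable def bitLaw (E : Type) [Fintype E] : Measure (E → Bool) :=
  Measure.pi fun _ : E => quarterBit

instance : IsProbabilityMeasure (bitLaw E) := by
  unfold bitLaw
  infer_instance

theorem bitLaw_real_singleton (u : E → Bool) : (bitLaw E).real {u} = ∏ e, bitWeight (u e) := by
  rw [bitLaw, measureReal_def, Measure.pi_singleton, ENNReal.toReal_prod]
  exact Finset.prod_congr rfl fun e _ => quarterBit_real_singleton (u e)

theorem bitLaw_real_eq_sum [DecidableEq E] (S : Set (E → Bool)) [DecidablePred (· ∈ S)] :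
    (bitLaw E).real S = ∑ u, if u ∈ S then ∏ e, bitWeight (u e) else 0 := by
  rw [← Finset.sum_filter]
  simp only [← bitLaw_real_singleton]
  rw [← measureReal_biUnion_finset]
  · congr 1
    ext u
    simp
  · intro v _ w _ hvw
    exact Set.disjoint_singleton.2 hvw
  · exact fun v _ => MeasurableSet.singleton v

theorem bitLaw_real_pos {S : Set (E → Bool)} {u : E → Bool} (hu : u ∈ S) :
    0 < (bitLaw E).real S := by
  have h1 : 0 < (bitLaw E).real {u} := by
    rw [bitLaw_real_singleton]
    exact Finset.prod_pos fun e _ => bitWeight_pos _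
  exact h1.trans_le (measureReal_mono (Set.singleton_subset_iff.2 hu))

theorem bitLaw_real_eval (e : E) : (bitLaw E).real {u | u e = false} = 3 / 4 := by
  have h := (measurePreserving_eval (fun _ : E => quarterBit) e).measure_preimage
    (MeasurableSet.singleton false).nullMeasurableSet
  have h2 : (bitLaw E).real (Function.eval e ⁻¹' ({false} : Set Bool)) = quarterBit.real {false} := by
    rw [measureReal_def, bitLaw, h, measureReal_def]
  have h3 : {u : E → Bool | u e = false} = Function.eval e ⁻¹' ({false} : Set Bool) := rfl
  rw [h3, h2, quarterBit_real_singleton]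
  rfl

theorem bitLaw_bool_real : (bitLaw Bool).real {u | u false = u true} = 5 / 8 := by
  have h : {u : Bool → Bool | u false = u true} = {fun _ => false} ∪ {fun _ => true} := by
    ext u
    simp only [Set.mem_ofPred_eq, Set.mem_union, Set.mem_singleton_iff, funext_iff,
      Bool.forall_bool]
    cases u false <;> cases u true <;> simp
  rw [h, measureReal_union (by simp [funext_iff]) (MeasurableSet.singleton _),
    bitLaw_real_singleton, bitLaw_real_singleton]
  norm_num [bitWeight]

theorem sum_prod_bits [DecidableEq E] (g : E → Bool → ℝ) :
    ∑ u : E → Bool, ∏ e, g e (u e) = ∏ e, (g e true + g e false) := by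
  have h := Finset.prod_univ_sum (fun _ : E => (Finset.univ : Finset Bool)) g
  rw [Fintype.piFinset_univ] at h
  rw [← h]
  simp

/-- The parity of independent biased bits is not independent of any one of them. -/
theorem bitLaw_parity (s : E) :
    (bitLaw E).real {u | u s = false} * (bitLaw E).real {u | ∏ e, bitSign (u e) = 1} ≠
      (bitLaw E).real {u | ∏ e, bitSign (u e) = 1 ∧ u s = false} := by
  classical
  have hsq : ∀ u : E → Bool, (∏ e, bitSign (u e)) = 1 ∨ (∏ e, bitSign (u e)) = -1 := by
    intro u
    rw [← sq_eq_one_iff, ← Finset.prod_pow]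
    exact Finset.prod_eq_one fun e _ => by cases u e <;> simp [bitSign]
  have s0 : ∑ u : E → Bool, ∏ e, bitWeight (u e) = 1 := by
    rw [sum_prod_bits fun _ b => bitWeight b]
    exact Finset.prod_eq_one fun e _ => by norm_num [bitWeight]
  have s2 : ∑ u : E → Bool, (∏ e, bitWeight (u e)) * ∏ e, bitSign (u e) =
      (1 / 2) ^ Fintype.card E := by
    simp only [← Finset.prod_mul_distrib]
    rw [sum_prod_bits fun _ b => bitWeight b * bitSign b, ← Finset.card_univ]
    exact Finset.prod_eq_pow_card fun e _ => by norm_num [bitWeight, bitSign]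
  -- A sign has mean 1/2, but at `s` it occurs squared and contributes 1; hence the factor 2
  -- relative to `s2`.
  have s3 : ∑ u : E → Bool, (∏ e, bitWeight (u e)) * (bitSign (u s) * ∏ e, bitSign (u e)) =
      2 * (1 / 2) ^ Fintype.card E := by
    have h1 : ∀ u : E → Bool, (∏ e, bitWeight (u e)) * (bitSign (u s) * ∏ e, bitSign (u e)) =
        ∏ e, (if e = s then bitWeight (u e) else bitWeight (u e) * bitSign (u e)) := by
      intro u
      have h2 : ∀ b, bitSign b * bitSign b = 1 := fun b => by cases b <;> simp [bitSign]
      rw [← Finset.mul_prod_erase _ (fun e => bitWeight (u e)) (Finset.mem_univ s),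
        ← Finset.mul_prod_erase _ (fun e => bitSign (u e)) (Finset.mem_univ s),
        ← Finset.mul_prod_erase _ _ (Finset.mem_univ s), if_pos rfl,
        Finset.prod_congr rfl fun e he => if_neg (Finset.ne_of_mem_erase he),
        Finset.prod_mul_distrib]
      linear_combination (bitWeight (u s) * (∏ e ∈ Finset.univ.erase s, bitWeight (u e)) *
        ∏ e ∈ Finset.univ.erase s, bitSign (u e)) * h2 (u s)
    rw [Finset.sum_congr rfl fun u _ => h1 u,
      sum_prod_bits fun e b => if e = s then bitWeight b else bitWeight b * bitSign b,
      ← Finset.mul_prod_erase _ _ (Finset.mem_univ s), if_pos rfl, if_pos rfl,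
      Finset.prod_congr rfl fun e he => by
        rw [if_neg (Finset.ne_of_mem_erase he), if_neg (Finset.ne_of_mem_erase he)],
      Finset.prod_const, Finset.card_erase_of_mem (Finset.mem_univ s), Finset.card_univ]
    have hc : 0 < Fintype.card E := Fintype.card_pos_iff.2 ⟨s⟩
    obtain ⟨c, hc⟩ := Nat.exists_eq_succ_of_ne_zero hc.ne'
    rw [hc]
    norm_num [bitWeight, bitSign, pow_succ]
    ring
  have e1 := bitLaw_real_eval s
  have e2 : (bitLaw E).real {u | ∏ e, bitSign (u e) = 1} =
      (1 + (1 / 2) ^ Fintype.card E) / 2 := by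
    -- The indicator of even parity is (1 + ∏ sign) / 2; below, it is multiplied by the indicator (1
    -- + sign) / 2 of a single bit.
    have h1 : (bitLaw E).real {u | ∏ e, bitSign (u e) = 1} = ∑ u : E → Bool,
        ((∏ e, bitWeight (u e)) + (∏ e, bitWeight (u e)) * ∏ e, bitSign (u e)) / 2 := by
      rw [bitLaw_real_eq_sum]
      refine Finset.sum_congr rfl fun u _ => ?_
      rcases hsq u with h | h <;> simp only [Set.mem_ofPred_eq, h] <;> norm_num
    rw [h1, ← Finset.sum_div, Finset.sum_add_distrib, s0, s2]
  have e3 : (bitLaw E).real {u | ∏ e, bitSign (u e) = 1 ∧ u s = false} =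
      (3 / 2 + 3 * (1 / 2) ^ Fintype.card E) / 4 := by
    have s1 : ∑ u : E → Bool, (∏ e, bitWeight (u e)) * bitSign (u s) = 1 / 2 := by
      have h4 : ∀ u : E → Bool, (∏ e, bitWeight (u e)) * bitSign (u s) =
          2 * (if u ∈ {u : E → Bool | u s = false} then ∏ e, bitWeight (u e) else 0) -
            ∏ e, bitWeight (u e) := by
        intro u
        by_cases h : u s = false
        · simp [h, bitSign]; ring
        · simp [h, bitSign]
      rw [Finset.sum_congr rfl fun u _ => h4 u, Finset.sum_sub_distrib, ← Finset.mul_sum,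
        ← bitLaw_real_eq_sum, e1, s0]
      norm_num
    have h1 : (bitLaw E).real {u | ∏ e, bitSign (u e) = 1 ∧ u s = false} = ∑ u : E → Bool,
        ((∏ e, bitWeight (u e)) + (∏ e, bitWeight (u e)) * bitSign (u s) +
          (∏ e, bitWeight (u e)) * (∏ e, bitSign (u e)) +
          (∏ e, bitWeight (u e)) * (bitSign (u s) * ∏ e, bitSign (u e))) / 4 := by
      rw [bitLaw_real_eq_sum]
      refine Finset.sum_congr rfl fun u _ => ?_
      have hs : u s = false ∧ bitSign (u s) = 1 ∨ ¬ u s = false ∧ bitSign (u s) = -1 := by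
        cases u s <;> simp [bitSign]
      rcases hsq u with h | h
      · rcases hs with ⟨h', hs⟩ | ⟨h', hs⟩
        · rw [if_pos ⟨h, h'⟩, h, hs]
          ring
        · rw [if_neg fun hu => h' hu.2, h, hs]
          ring
      · have hn : u ∉ {u : E → Bool | ∏ e, bitSign (u e) = 1 ∧ u s = false} := by
          rintro ⟨hu, -⟩
          rw [h] at hu
          norm_num at hu
        rw [if_neg hn, h]
        rcases hs with ⟨-, hs⟩ | ⟨-, hs⟩ <;> rw [hs] <;> ring
    rw [h1, ← Finset.sum_div, Finset.sum_add_distrib, Finset.sum_add_distrib,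
      Finset.sum_add_distrib, s0, s1, s2, s3]
    ring
  rw [e1, e2, e3]
  -- With n the number of bits, the two sides differ by (3/8) · (1/2)^n. The bias is essential: with
  -- two or more fair bits they would agree.
  have : (0 : ℝ) < (1 / 2) ^ Fintype.card E := by positivity
  intro h
  linarith

end BitMeasure

/-! ### Binary models and what the adjustment formula says in them -/

section BitModels

variable {V : Type*} {Vm : Finset V}

/-- The bits encoding an assignment; an indicator is encoded by the negation of its value. -/
def toBits (v : ∀ i, MVal Vm (fun _ => Bool) i) : MNode Vm → Bool
  | Sum.inl a => v (Sum.inl a)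
  | Sum.inr r => Bool.not (v (Sum.inr r))

/-- The assignment encoded by bits; an indicator is encoded by the negation of its value. -/
def ofBits (b : MNode Vm → Bool) : ∀ i, MVal Vm (fun _ => Bool) i
  | Sum.inl a => b (Sum.inl a)
  | Sum.inr r => Bool.not (b (Sum.inr r))

theorem toBits_ofBits (b : MNode Vm → Bool) : toBits (ofBits b) = b := by
  funext i
  cases i with
  | inl a => rfl
  | inr r => exact Bool.not_not _

theorem ofBits_congr {b b' : MNode Vm → Bool} {i : MNode Vm} (h : b i = b' i) :
    ofBits b i = ofBits b' i := by
  cases i with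
  | inl a => exact h
  | inr r => exact congrArg Bool.not h

theorem toBits_congr {v v' : ∀ i, MVal Vm (fun _ => Bool) i} {i : MNode Vm} (h : v i = v' i) :
    toBits v i = toBits v' i := by
  cases i with
  | inl a => exact h
  | inr r => exact congrArg Bool.not h

/-- A system of structural equations with binary variables and binary noises. -/
structure BitModel (G : MGraph V Vm) (E : Type) where
  scope : E → Set (MNode Vm)
  bi_of_scope : ∀ k i j, i ∈ scope k → j ∈ scope k → i ≠ j → G.bi i j
  f : MNode Vm → (MNode Vm → Bool) → (E → Bool) → Bool
  f_parents : ∀ i b b' u, (∀ j, G.dir j i → b j = b' j) → f i b u = f i b' u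
  f_noise : ∀ i b u u', (∀ k, i ∈ scope k → u k = u' k) → f i b u = f i b u'

namespace BitModel

variable {G : MGraph V Vm} {E : Type} [Fintype E]

/-- The structural causal model with independent biased noises. -/
noncomputable def model (B : BitModel G E) : SCM G.toADMG (MVal Vm fun _ => Bool) where
  Exo := E
  exoFintype := inferInstance
  Noise _ := Bool
  noiseMeasurableSpace _ := inferInstance
  law _ := quarterBit
  lawProbability _ := inferInstance
  scope := B.scope
  bi_of_scope := B.bi_of_scope
  f i v u := ofBits (fun j => B.f j (toBits v) u) i
  f_parents i _ _ u h := ofBits_congr (B.f_parents i _ _ u fun j hj => toBits_congr (h j hj))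
  f_noise i _ u u' h := ofBits_congr (B.f_noise i _ u u' h)
  f_measurable _ _ _ := Set.Finite.measurableSet (Set.toFinite _)

variable [Fintype V]

/-- The solution of the equations. -/
noncomputable def sol (B : BitModel G E) (u : E → Bool) : MNode Vm → Bool :=
  toBits (B.model.sol u)

theorem sol_apply (B : BitModel G E) (u : E → Bool) (i : MNode Vm) :
    B.sol u i = B.f i (B.sol u) u := by
  have h := B.model.solves_sol u i
  have h2 : toBits (B.model.sol u) i =
      toBits (ofBits fun j => B.f j (toBits (B.model.sol u)) u) i := toBits_congr h
  rwa [toBits_ofBits] at h2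

theorem sol_eq (B : BitModel G E) {u : E → Bool} {b : MNode Vm → Bool}
    (h : ∀ i, b i = B.f i b u) : B.sol u = b := by
  have h2 : B.model.sol u = ofBits b := by
    refine B.model.sol_eq_iff.2 fun i =>
      ofBits_congr (b' := fun j => B.f j (toBits (ofBits b)) u) ?_
    rw [toBits_ofBits]
    exact h i
  rw [sol, h2, toBits_ofBits]

variable [DecidableEq V]

/-- The solution of the equations under the intervention that sets the variables in `X`. -/
noncomputable def doSol (B : BitModel G E) (X : Finset V) (xv : MNode Vm → Bool) (u : E → Bool) :
    MNode Vm → Bool :=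
  toBits (B.model.doSol (doAssign Vm X fun v => xv (Sum.inl v.1)) u)

theorem doSol_of_mem (B : BitModel G E) {X : Finset V} (xv : MNode Vm → Bool) (u : E → Bool)
    {i : MNode Vm} (hi : i ∈ varNodes Vm X) : B.doSol X xv u i = xv i := by
  obtain ⟨v, hv, rfl⟩ := hi
  refine B.model.doSol_of_some _ u (i := Sum.inl v) ?_
  simp [doAssign, hv]

theorem doSol_of_notMem (B : BitModel G E) {X : Finset V} (xv : MNode Vm → Bool) (u : E → Bool)
    {i : MNode Vm} (hi : i ∉ varNodes Vm X) :
    B.doSol X xv u i = B.f i (B.doSol X xv u) u := by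
  have h := B.model.doSol_of_none _ u
    (doAssign_of_notMem (Dom := fun _ => Bool) (fun v : X => xv (Sum.inl v.1)) hi)
  have h2 : B.doSol X xv u i =
      toBits (ofBits fun j => B.f j (B.doSol X xv u) u) i := toBits_congr h
  rwa [toBits_ofBits] at h2

/-- All indicators of the variables in `S` are `1`. -/
def Observed (S : Finset V) (b : MNode Vm → Bool) : Prop := ∀ r ∈ indNodes Vm S, b r = false

theorem observed_iff {S : Finset V} {v : ∀ i, MVal Vm (fun _ => Bool) i} :
    Observed S (toBits v) ↔ v ∈ indEvent Vm S := by
  constructor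
  · intro h r hr
    exact (congrArg Bool.not (h (Sum.inr r) ⟨r, hr, rfl⟩)).symm.trans (Bool.not_not _) |>.symm
  · rintro h _ ⟨r, hr, rfl⟩
    exact congrArg Bool.not (h r hr)

theorem forall_mem_varNodes {S : Finset V} {p : MNode Vm → Prop} :
    (∀ n ∈ varNodes Vm S, p n) ↔ ∀ v ∈ S, p (Sum.inl v) :=
  ⟨fun h v hv => h _ ⟨v, hv, rfl⟩, by rintro h _ ⟨v, hv, rfl⟩; exact h v hv⟩

/-- If `y` is a function of `z` given `x` and that all variables are observed, then the
adjustment formula says that the causal effect is the probability of the corresponding event. -/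
theorem adjustment_eq {X Y Z : Finset V} (h : G.IsMAdjustmentSet X Y Z) (B : BitModel G E)
    (xv : MNode Vm → Bool) (hz : (MNode Vm → Bool) → Prop)
    (h0 : ∃ u, Observed (X ∪ Y ∪ Z) (B.sol u))
    (hpos : ∀ u, Observed (X ∪ Y ∪ Z) (B.sol u) → ∃ u', Observed (X ∪ Y ∪ Z) (B.sol u') ∧
      (∀ n ∈ varNodes Vm Z, B.sol u' n = B.sol u n) ∧
      ∀ n ∈ varNodes Vm X, B.sol u' n = xv n)
    (hdet : ∀ u, Observed (X ∪ Y ∪ Z) (B.sol u) → (∀ n ∈ varNodes Vm X, B.sol u n = xv n) →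
      ((∀ n ∈ varNodes Vm Y, B.sol u n = false) ↔ hz (B.sol u)))
    (hZ : ∀ b b', (∀ n ∈ varNodes Vm Z, b n = b' n) → (hz b ↔ hz b')) :
    (bitLaw E).real {u | ∀ n ∈ varNodes Vm Y, B.doSol X xv u n = false} *
        (bitLaw E).real {u | Observed (X ∪ Y ∪ Z) (B.sol u)} =
      (bitLaw E).real {u | Observed (X ∪ Y ∪ Z) (B.sol u) ∧ hz (B.sol u)} := by
  classical
  simp only [forall_mem_varNodes] at hpos hdet hZ ⊢
  have hp : ∀ F, B.model.prob F = (bitLaw E).real {u : E → Bool | B.model.sol u ∈ F} :=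
    fun F => B.model.prob_eq F
  have hne : ∀ {F} {u : E → Bool}, B.model.sol u ∈ F → B.model.prob F ≠ 0 := by
    intro F u hu
    rw [hp]
    exact (bitLaw_real_pos (S := {u : E → Bool | B.model.sol u ∈ F}) hu).ne'
  have hex : ∀ {F}, B.model.prob F ≠ 0 → ∃ u : E → Bool, B.model.sol u ∈ F := by
    intro F hF
    by_contra hc
    refine hF ?_
    rw [hp]
    exact (congrArg _ (Set.eq_empty_iff_forall_notMem.2 fun u hu => hc ⟨u, hu⟩)).trans
      measureReal_empty
  obtain ⟨u0, h0⟩ := h0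
  have hR : B.model.prob (indEvent Vm (X ∪ Y ∪ Z)) ≠ 0 := hne (observed_iff.1 h0)
  have hxz : ∀ z : ∀ v : Z, Bool,
      B.model.prob (varEvent Vm (Dom := fun _ => Bool) Z z ∩ indEvent Vm (X ∪ Y ∪ Z)) ≠ 0 →
      B.model.prob (varEvent Vm (Dom := fun _ => Bool) X (fun v => xv (Sum.inl v.1)) ∩
        varEvent Vm (Dom := fun _ => Bool) Z z ∩ indEvent Vm (X ∪ Y ∪ Z)) ≠ 0 := by
    intro z hz1
    obtain ⟨u, hu1, hu2⟩ := hex hz1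
    obtain ⟨u', h1, h2, h3⟩ := hpos u (observed_iff.2 hu2)
    exact hne (u := u') ⟨⟨fun v => h3 v.1 v.2, fun v => (h2 v.1 v.2).trans (hu1 v)⟩,
      observed_iff.1 h1⟩
  have key := h (fun _ => Bool) B.model (fun v => xv (Sum.inl v.1)) (fun _ => false) hR hxz
  have hdo : (B.model.intervene (doAssign Vm X fun v => xv (Sum.inl v.1))).prob
      (varEvent Vm (Dom := fun _ => Bool) Y fun _ => false) =
      (bitLaw E).real {u | ∀ v ∈ Y, B.doSol X xv u (Sum.inl v) = false} := by
    rw [SCM.prob_eq]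
    refine congrArg (bitLaw E).real (Set.ext fun u => ?_)
    exact ⟨fun hu v hv => hu ⟨v, hv⟩, fun hu v => hu v.1 v.2⟩
  rw [hdo] at key
  have hR' : B.model.prob (indEvent Vm (X ∪ Y ∪ Z)) =
      (bitLaw E).real {u | Observed (X ∪ Y ∪ Z) (B.sol u)} := by
    rw [hp]
    exact congrArg _ (Set.ext fun u => observed_iff.symm)
  rw [key, ← hR', Finset.sum_mul]
  have hsum := sum_measureReal_varEvent B.model Z (B.model.measurableSet_sol
    {v | Observed (X ∪ Y ∪ Z) (toBits v) ∧ hz (toBits v)})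
  refine Eq.trans (Finset.sum_congr rfl fun z _ => ?_) hsum
  rw [SCM.condProb, SCM.condProb, mul_assoc, div_mul_cancel₀ _ hR]
  by_cases hz0 : B.model.prob (varEvent Vm (Dom := fun _ => Bool) Z z ∩
      indEvent Vm (X ∪ Y ∪ Z)) = 0
  · rw [hz0, mul_zero]
    symm
    refine le_antisymm ?_ measureReal_nonneg
    rw [← hz0, SCM.prob_eq]
    exact measureReal_mono fun u hu => ⟨hu.2, observed_iff.1 hu.1.1⟩
  · have hx := hxz z hz0
    obtain ⟨u1, hu1, hu2⟩ := hex hz0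
    have hcongr : ∀ u : E → Bool, B.model.sol u ∈ varEvent Vm (Dom := fun _ => Bool) Z z →
        (hz (B.sol u) ↔ hz (B.sol u1)) := fun u hu =>
      hZ _ _ fun v hv => (hu ⟨v, hv⟩).trans (hu1 ⟨v, hv⟩).symm
    -- Within one value `z` the truth of `hz` is constant, so the conditional probability of Y = 0
    -- is 1 or 0 accordingly.
    by_cases hh : hz (B.sol u1)
    · have e1 : B.model.prob (varEvent Vm (Dom := fun _ => Bool) Y (fun _ => false) ∩
          (varEvent Vm (Dom := fun _ => Bool) X (fun v => xv (Sum.inl v.1)) ∩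
          varEvent Vm (Dom := fun _ => Bool) Z z ∩ indEvent Vm (X ∪ Y ∪ Z))) =
          B.model.prob (varEvent Vm (Dom := fun _ => Bool) X (fun v => xv (Sum.inl v.1)) ∩
          varEvent Vm (Dom := fun _ => Bool) Z z ∩ indEvent Vm (X ∪ Y ∪ Z)) := by
        rw [hp, hp]
        refine congrArg _ (Set.ext fun u => ⟨fun hu => hu.2, fun hu => ⟨?_, hu⟩⟩)
        have := (hdet u (observed_iff.2 hu.2) fun v hv => hu.1.1 ⟨v, hv⟩).2
          ((hcongr u hu.1.2).2 hh)
        exact fun v => this v.1 v.2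
      rw [e1, div_self hx, one_mul, SCM.prob_eq]
      refine congrArg _ (Set.ext fun u => ⟨fun hu => ⟨⟨observed_iff.2 hu.2,
        (hcongr u hu.1).2 hh⟩, hu.1⟩, fun hu => ⟨hu.2, observed_iff.1 hu.1.1⟩⟩)
    · have e1 : B.model.prob (varEvent Vm (Dom := fun _ => Bool) Y (fun _ => false) ∩
          (varEvent Vm (Dom := fun _ => Bool) X (fun v => xv (Sum.inl v.1)) ∩
          varEvent Vm (Dom := fun _ => Bool) Z z ∩ indEvent Vm (X ∪ Y ∪ Z))) = 0 := by
        by_contra hc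
        obtain ⟨u, hu⟩ := hex hc
        refine hh ((hcongr u hu.2.1.2).1 ((hdet u (observed_iff.2 hu.2.2)
          fun v hv => hu.2.1.1 ⟨v, hv⟩).1 fun v hv => hu.1 ⟨v, hv⟩))
      rw [e1, zero_div, zero_mul]
      symm
      refine Eq.trans (congrArg _ (Set.eq_empty_iff_forall_notMem.2 fun u hu => ?_))
        measureReal_empty
      exact hh ((hcongr u hu.2).1 hu.1.2)

end BitModel

end BitModels

/-! ### Models that are linear over the field with two elements -/

section Wirings

variable {V : Type*} {Vm : Finset V}

/-- The bit sent along an optional connection. -/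
def sig {α : Type*} (o : Option α) (b : α → Bool) : Bool := o.elim false b

theorem sig_none {α : Type*} (b : α → Bool) : sig none b = false := rfl

theorem sig_some {α : Type*} (a : α) (b : α → Bool) : sig (some a) b = b a := rfl

/-- A linear model: every bit is the sum of at most two parents and at most two noises. -/
structure Wiring (G : MGraph V Vm) (E : Type) where
  src : Bool → MNode Vm → Option (MNode Vm)
  noise : Bool → MNode Vm → Option E
  dir_of_src : ∀ {s i j}, src s i = some j → G.dir j i
  bi_of_noise : ∀ {s s' i j k}, noise s i = some k → noise s' j = some k → i ≠ j → G.bi i j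

namespace Wiring

variable {G : MGraph V Vm} {E : Type} [Fintype E]

/-- The value of a node given the other nodes and the noises. -/
def eqn (W : Wiring G E) (i : MNode Vm) (b : MNode Vm → Bool) (u : E → Bool) : Bool :=
  xor (xor (sig (W.src false i) b) (sig (W.src true i) b))
    (xor (sig (W.noise false i) u) (sig (W.noise true i) u))

/-- The binary model of a wiring. -/
def toBitModel (W : Wiring G E) : BitModel G E where
  scope k := {i | ∃ s, W.noise s i = some k}
  bi_of_scope := by
    rintro k i j ⟨s, hs⟩ ⟨s', hs'⟩ hij
    exact W.bi_of_noise hs hs' hij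
  f := W.eqn
  f_parents i b b' u h := by
    have h1 : ∀ s, sig (W.src s i) b = sig (W.src s i) b' := by
      intro s
      cases hs : W.src s i with
      | none => rfl
      | some j => exact h j (W.dir_of_src hs)
    rw [eqn, eqn, h1, h1]
  f_noise i b u u' h := by
    have h1 : ∀ s, sig (W.noise s i) u = sig (W.noise s i) u' := by
      intro s
      cases hs : W.noise s i with
      | none => rfl
      | some k => exact h k ⟨s, hs⟩
    rw [eqn, eqn, h1, h1]

variable [Fintype V] (W : Wiring G E)

/-- The solution of the equations. -/
noncomputable def sol (u : E → Bool) : MNode Vm → Bool := W.toBitModel.sol u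

theorem sol_apply (u : E → Bool) (i : MNode Vm) : W.sol u i = W.eqn i (W.sol u) u :=
  W.toBitModel.sol_apply u i

theorem sol_eq {u : E → Bool} {b : MNode Vm → Bool} (h : ∀ i, b i = W.eqn i b u) : W.sol u = b :=
  W.toBitModel.sol_eq h

/-- Indicators are encoded by the negation of their values, so in this solution everything is
observed. As every noise vector has positive probability, so has R_W = 1. -/
theorem sol_zero : W.sol (fun _ => false) = fun _ => false := by
  have h1 : ∀ {α : Type _} (o : Option α), sig o (fun _ => false) = false := by
    intro α o
    cases o <;> rfl
  refine W.sol_eq fun i => ?_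
  rw [eqn, h1, h1]
  have h2 : ∀ (o : Option E), sig o (fun _ => false) = false := by
    intro o
    cases o <;> rfl
  rw [h2, h2]
  rfl

theorem eqn_of_none {i : MNode Vm} (h1 : ∀ s, W.src s i = none) (h2 : ∀ s, W.noise s i = none)
    (b : MNode Vm → Bool) (u : E → Bool) : W.eqn i b u = false := by
  simp [eqn, h1, h2, sig_none]

/-- Bits that are copied along directed edges from a root agree with the root. -/
theorem copy_eq {b : MNode Vm → Bool} {S : Set (MNode Vm)} {c : Bool}
    (h : ∀ i ∈ S, b i = c ∨ ∃ j ∈ S, G.dir j i ∧ b i = b j) : ∀ i ∈ S, b i = c := by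
  intro i
  induction i using G.toADMG.wellFounded_dir.induction with
  | _ i ih =>
    intro hi
    rcases h i hi with h1 | ⟨j, hj, h1, h2⟩
    · exact h1
    · rw [h2, ih j h1 hj]

variable [DecidableEq V]

/-- The solution of the equations under an intervention. -/
noncomputable def doSol (X : Finset V) (xv : MNode Vm → Bool) (u : E → Bool) : MNode Vm → Bool :=
  W.toBitModel.doSol X xv u

theorem doSol_of_mem {X : Finset V} (xv : MNode Vm → Bool) (u : E → Bool)
    {i : MNode Vm} (hi : i ∈ varNodes Vm X) : W.doSol X xv u i = xv i :=
  W.toBitModel.doSol_of_mem xv u hi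

theorem doSol_of_notMem {X : Finset V} (xv : MNode Vm → Bool) (u : E → Bool)
    {i : MNode Vm} (hi : i ∉ varNodes Vm X) :
    W.doSol X xv u i = W.eqn i (W.doSol X xv u) u :=
  W.toBitModel.doSol_of_notMem xv u hi

theorem adjustment_eq {X Y Z : Finset V} (h : G.IsMAdjustmentSet X Y Z) (W : Wiring G E)
    (xv : MNode Vm → Bool) (hz : (MNode Vm → Bool) → Prop)
    (hpos : ∀ u, (∀ r ∈ indNodes Vm (X ∪ Y ∪ Z), W.sol u r = false) →
      ∃ u', (∀ r ∈ indNodes Vm (X ∪ Y ∪ Z), W.sol u' r = false) ∧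
        (∀ n ∈ varNodes Vm Z, W.sol u' n = W.sol u n) ∧
        ∀ n ∈ varNodes Vm X, W.sol u' n = xv n)
    (hdet : ∀ u, (∀ r ∈ indNodes Vm (X ∪ Y ∪ Z), W.sol u r = false) →
      (∀ n ∈ varNodes Vm X, W.sol u n = xv n) →
      ((∀ n ∈ varNodes Vm Y, W.sol u n = false) ↔ hz (W.sol u)))
    (hZ : ∀ b b', (∀ n ∈ varNodes Vm Z, b n = b' n) → (hz b ↔ hz b')) :
    (bitLaw E).real {u | ∀ n ∈ varNodes Vm Y, W.doSol X xv u n = false} *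
        (bitLaw E).real {u | ∀ r ∈ indNodes Vm (X ∪ Y ∪ Z), W.sol u r = false} =
      (bitLaw E).real
        {u | (∀ r ∈ indNodes Vm (X ∪ Y ∪ Z), W.sol u r = false) ∧ hz (W.sol u)} :=
  W.toBitModel.adjustment_eq h xv hz
    ⟨fun _ => false, fun r _ => congrFun W.sol_zero r⟩ hpos hdet hZ

theorem bitLaw_observed_pos {S : Finset V} :
    0 < (bitLaw E).real {u | ∀ r ∈ indNodes Vm S, W.sol u r = false} :=
  bitLaw_real_pos (u := fun _ => false) fun r _ => congrFun W.sol_zero r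

end Wiring

end Wirings

/-! ### Necessity of conditions (c) and (a) -/

section Between

variable {N : Type*}

/-- The nodes on the directed walks from `a` to `b`. -/
def ADMG.between (H : ADMG N) (a b : N) : Set N := {i | H.Desc a i ∧ H.Desc i b}

theorem ADMG.between_exists_parent {H : ADMG N} {a b i : N} (hi : i ∈ H.between a b)
    (hia : i ≠ a) : ∃ j ∈ H.between a b, H.dir j i := by
  rcases Relation.ReflTransGen.cases_tail hi.1 with h | ⟨j, h1, h2⟩
  · exact absurd h hia
  · exact ⟨j, ⟨h1, (Relation.ReflTransGen.single h2).trans hi.2⟩, h2⟩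

end Between

namespace MGraph.IsMAdjustmentSet

open ADMG

variable {V : Type*} {Vm : Finset V} [Fintype V] [DecidableEq V] {G : MGraph V Vm}
  {X Y Z : Finset V}

/-- One noise feeds `d` and `t` and is copied down to `y` and to `r`. Given R_W = 1 all bits are 0,
so the formula gives Y = 0 probability 1. The walks avoid `X`, so under the intervention `y` is
still that noise, which is 0 with probability 3/4 only. -/
theorem not_sharedSource (h : G.IsMAdjustmentSet X Y Z) :
    ¬ G.toADMG.SharedSource (varNodes Vm X) (varNodes Vm Y) (indNodes Vm (X ∪ Y ∪ Z)) := by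
  classical
  rintro ⟨d, ⟨hdX, y, hy, hdy⟩, t, htX, htd, r, hr, htr⟩
  set H := G.toADMG.removeIn (varNodes Vm X) with hH
  set S := H.between d y ∪ H.between t r with hS
  have hpar : ∀ i, i ∈ S ∧ ¬ (i = d ∨ i = t) → ∃ j ∈ S, G.dir j i := by
    rintro i ⟨hi, hne⟩
    rw [not_or] at hne
    rcases hi with hi | hi
    · obtain ⟨j, hj, hji⟩ := between_exists_parent hi hne.1
      exact ⟨j, Or.inl hj, hji.1⟩
    · obtain ⟨j, hj, hji⟩ := between_exists_parent hi hne.2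
      exact ⟨j, Or.inr hj, hji.1⟩
  have hSX : ∀ i ∈ S, i ∉ varNodes Vm X := by
    rintro i (hi | hi)
    · exact Desc.notMem_of_removeIn hi.1 hdX
    · exact Desc.notMem_of_removeIn hi.1 htX
  have hdS : d ∈ S := Or.inl ⟨Relation.ReflTransGen.refl, hdy⟩
  have htS : t ∈ S := Or.inr ⟨Relation.ReflTransGen.refl, htr⟩
  let W : Wiring G Unit :=
    { src := fun s i => if hi : s = false ∧ i ∈ S ∧ ¬ (i = d ∨ i = t) then
        some (hpar i hi.2).choose else none
      noise := fun s i => if s = false ∧ (i = d ∨ i = t) then some () else none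
      dir_of_src := by
        intro s i j hj
        split_ifs at hj with hi
        cases hj
        exact (hpar i hi.2).choose_spec.2
      bi_of_noise := by
        intro s s' i j k hi hj hij
        split_ifs at hi hj with h1 h2
        have h3 : t = d ∨ G.bi d t := htd.imp id fun h => G.bi_symm _ _ h
        grind }
  have hcopy : ∀ (b : MNode Vm → Bool) (u : Unit → Bool), (∀ i ∈ S, b i = W.eqn i b u) →
      ∀ i ∈ S, b i = u () := by
    intro b u hb
    refine Wiring.copy_eq (G := G) fun i hi => ?_
    rw [hb i hi]
    by_cases hr : i = d ∨ i = t
    · left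
      simp [W, Wiring.eqn, hr, sig]
    · right
      refine ⟨_, (hpar i ⟨hi, hr⟩).choose_spec.1, (hpar i ⟨hi, hr⟩).choose_spec.2, ?_⟩
      simp [W, Wiring.eqn, hr, sig, hi]
  have hnone : ∀ i, i ∉ S → ∀ b u, W.eqn i b u = false := by
    intro i hi b u
    have hr : ¬ (i = d ∨ i = t) := by
      rintro (rfl | rfl)
      · exact hi hdS
      · exact hi htS
    refine W.eqn_of_none (fun s => ?_) (fun s => ?_) b u
    · simp [W, hi]
    · simp [W, hr]
  have hzero : ∀ u, (∀ r ∈ indNodes Vm (X ∪ Y ∪ Z), W.sol u r = false) →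
      ∀ i, W.sol u i = false := by
    intro u hu i
    have hc := hcopy (W.sol u) u fun i _ => W.sol_apply u i
    by_cases hi : i ∈ S
    · rw [hc i hi, ← hc r (Or.inr ⟨htr, Relation.ReflTransGen.refl⟩), hu r hr]
    · rw [W.sol_apply, hnone i hi]
  have key := W.adjustment_eq h (fun _ => false) (fun _ => True)
    (fun u hu => ⟨u, hu, fun _ _ => rfl, fun n _ => hzero u hu n⟩)
    (fun u hu _ => ⟨fun _ => trivial, fun _ n _ => hzero u hu n⟩)
    (fun _ _ _ => Iff.rfl)
  simp only [and_true] at key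
  have hle : (bitLaw Unit).real {u | ∀ n ∈ varNodes Vm Y, W.doSol X (fun _ => false) u n = false} ≤
      3 / 4 := by
    rw [← bitLaw_real_eval ()]
    refine measureReal_mono fun u hu => ?_
    have hc := hcopy _ u fun i hi => W.doSol_of_notMem (fun _ => false) u (hSX i hi)
    have := hc y (Or.inl ⟨hdy, Relation.ReflTransGen.refl⟩)
    exact this.symm.trans (hu y hy)
  have hpos := W.bitLaw_observed_pos (S := X ∪ Y ∪ Z)
  nlinarith

/-- The node `x0` is the last element of `X` on a directed walk to `d`, and `a` the next node. The
bit of `a` is that of `x0` plus a noise and is copied to `y` and `z`. Under do(x0 = 0), `y` is 0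
with probability 3/4; since `z` determines `y`, the formula gives P(z = 0) = 5/8. Indicators stay
constant. -/
theorem no_forbidden (hXY : Disjoint X Y) (hXZ : Disjoint X Z) (h : G.IsMAdjustmentSet X Y Z) :
    ∀ d ∈ G.toADMG.freeAnc (varNodes Vm X) (varNodes Vm Y),
      (∃ x ∈ varNodes Vm X, G.toADMG.Desc x d) →
      ∀ z ∈ varNodes Vm Z, ¬ (G.toADMG.removeIn (varNodes Vm X)).Desc d z := by
  classical
  rintro d ⟨hdX, y, hy, hdy⟩ ⟨x, hx, hxd⟩ z hz hdz
  obtain ⟨x0, hx0, a, haX, hxa, had⟩ := Desc.exists_last hxd hx hdX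
  set H := G.toADMG.removeIn (varNodes Vm X) with hH
  set S := H.between a y ∪ H.between a z with hS
  have hpar : ∀ i, i ∈ S ∧ i ≠ a → ∃ j ∈ S, G.dir j i := by
    rintro i ⟨hi, hne⟩
    rcases hi with hi | hi
    · obtain ⟨j, hj, hji⟩ := between_exists_parent hi hne
      exact ⟨j, Or.inl hj, hji.1⟩
    · obtain ⟨j, hj, hji⟩ := between_exists_parent hi hne
      exact ⟨j, Or.inr hj, hji.1⟩
  have hSX : ∀ i ∈ S, i ∉ varNodes Vm X := by
    rintro i (hi | hi)
    · exact Desc.notMem_of_removeIn hi.1 haX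
    · exact Desc.notMem_of_removeIn hi.1 haX
  -- Every node of `S` leads to a substantive variable, which an indicator cannot do.
  have hSR : ∀ i ∈ S, i ∉ indNodes Vm (X ∪ Y ∪ Z) := by
    obtain ⟨v, -, rfl⟩ := hy
    obtain ⟨v', -, rfl⟩ := hz
    rintro i (hi | hi)
    · obtain ⟨w, rfl⟩ := G.exists_inl_of_desc (Desc.of_removeIn hi.2)
      rintro ⟨r, -, hr⟩
      cases hr
    · obtain ⟨w, rfl⟩ := G.exists_inl_of_desc (Desc.of_removeIn hi.2)
      rintro ⟨r, -, hr⟩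
      cases hr
  have hyS : y ∈ S := Or.inl ⟨had.trans hdy, Relation.ReflTransGen.refl⟩
  have hzS : z ∈ S := Or.inr ⟨had.trans hdz, Relation.ReflTransGen.refl⟩
  have haS : a ∈ S := Or.inl ⟨Relation.ReflTransGen.refl, had.trans hdy⟩
  have hx0a : x0 ≠ a := fun h => haX (h ▸ hx0)
  have hx0S : x0 ∉ S := fun h => hSX _ h hx0
  let W : Wiring G Bool :=
    { src := fun s i => if hi : s = false ∧ i ∈ S ∧ i ≠ a then
        some (hpar i hi.2).choose else if s = true ∧ i = a then some x0 else none
      noise := fun s i => if s = false ∧ i = x0 then some false else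
        if s = true ∧ i = a then some true else none
      dir_of_src := by
        intro s i j hj
        split_ifs at hj with hi h2
        · cases hj
          exact (hpar i hi.2).choose_spec.2
        · cases hj
          rw [h2.2]
          exact hxa
      bi_of_noise := by
        intro s s' i j k hi hj hij
        grind }
  have hcopy : ∀ (b : MNode Vm → Bool) (u : Bool → Bool), (∀ i ∈ S, b i = W.eqn i b u) →
      ∀ i ∈ S, b i = xor (b x0) (u true) := by
    intro b u hb
    refine Wiring.copy_eq (G := G) fun i hi => ?_
    rw [hb i hi]
    by_cases hr : i = a
    · left
      simp [W, Wiring.eqn, hr, sig, hx0a.symm]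
    · right
      refine ⟨_, (hpar i ⟨hi, hr⟩).choose_spec.1, (hpar i ⟨hi, hr⟩).choose_spec.2, ?_⟩
      have : i ≠ x0 := fun h => hx0S (h ▸ hi)
      simp [W, Wiring.eqn, hr, sig, hi, this]
  have hnone : ∀ i, i ∉ S → i ≠ x0 → ∀ b u, W.eqn i b u = false := by
    intro i hi hix b u
    have hr : i ≠ a := fun h => hi (h ▸ haS)
    refine W.eqn_of_none (fun s => ?_) (fun s => ?_) b u
    · simp [W, hi, hr]
    · simp [W, hr, hix]
  have hsx : ∀ u, W.sol u x0 = u false := by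
    intro u
    rw [W.sol_apply]
    simp [W, Wiring.eqn, hx0S, hx0a, sig]
  have hsS : ∀ u, ∀ i ∈ S, W.sol u i = xor (u false) (u true) := by
    intro u i hi
    rw [← hsx u]
    exact hcopy _ u (fun i _ => W.sol_apply u i) i hi
  have hsn : ∀ u i, i ∉ S → i ≠ x0 → W.sol u i = false := by
    intro u i hi hix
    rw [W.sol_apply, hnone i hi hix]
  have hobs : ∀ u, ∀ r ∈ indNodes Vm (X ∪ Y ∪ Z), W.sol u r = false := fun u r hr =>
    hsn u r (fun hS => hSR r hS hr) fun he => notMem_varNodes_of_indNodes r hr (he ▸ hx0)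
  have hdS : ∀ u, ∀ i ∈ S, W.doSol X (fun _ => false) u i = u true := by
    intro u i hi
    rw [hcopy _ u (fun i hi => W.doSol_of_notMem (fun _ => false) u (hSX i hi)) i hi,
      W.doSol_of_mem _ u hx0, Bool.false_xor]
  have key := W.adjustment_eq h (fun _ => false) (fun b => b z = false)
    (fun u _ => by
      -- The noise of `x0` is silenced and that of `a` takes over the sum, so `x0` becomes 0 and `z`
      -- is unchanged.
      refine ⟨fun e => if e then xor (u false) (u true) else false, hobs _, fun n hn => ?_,
        fun n hn => ?_⟩
      · by_cases hnS : n ∈ S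
        · rw [hsS _ n hnS, hsS _ n hnS]
          simp
        · have : n ≠ x0 := fun he => notMem_varNodes_of_disjoint hXZ n (he ▸ hx0) hn
          rw [hsn _ n hnS this, hsn _ n hnS this]
      · by_cases hnx : n = x0
        · rw [hnx, hsx]
          simp
        · exact hsn _ n (fun hS => hSX n hS hn) hnx)
    (fun u _ hu => by
      constructor
      · intro hY
        rw [hsS u z hzS, ← hsS u y hyS]
        exact hY y hy
      · intro hz n hn
        have hnx : n ≠ x0 := fun he => notMem_varNodes_of_disjoint hXY n (he ▸ hx0) hn
        by_cases hnS : n ∈ S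
        · rw [hsS u n hnS, ← hsS u z hzS]
          exact hz
        · exact hsn u n hnS hnx)
    (fun b b' hb => by rw [hb z hz])
  have e1 : {u : Bool → Bool | ∀ n ∈ varNodes Vm Y, W.doSol X (fun _ => false) u n = false} =
      {u | u true = false} := by
    ext u
    constructor
    · intro hu
      exact (hdS u y hyS).symm.trans (hu y hy)
    · intro hu n hn
      have hnX : n ∉ varNodes Vm X := fun hX => notMem_varNodes_of_disjoint hXY n hX hn
      by_cases hnS : n ∈ S
      · rw [hdS u n hnS]
        exact hu
      · rw [W.doSol_of_notMem _ u hnX, hnone n hnS fun he => hnX (he ▸ hx0)]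
  have e2 : {u : Bool → Bool | ∀ r ∈ indNodes Vm (X ∪ Y ∪ Z), W.sol u r = false} = Set.univ :=
    Set.eq_univ_of_forall hobs
  have e3 : {u : Bool → Bool | (∀ r ∈ indNodes Vm (X ∪ Y ∪ Z), W.sol u r = false) ∧
      W.sol u z = false} = {u | u false = u true} := by
    ext u
    rw [Set.mem_ofPred_eq, Set.mem_ofPred_eq, hsS u z hzS]
    refine ⟨fun hu => ?_, fun hu => ⟨hobs u, ?_⟩⟩
    · simpa using hu.2
    · simpa using hu
  rw [e1, e2, e3, bitLaw_real_eval, bitLaw_bool_real] at key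
  norm_num at key

end MGraph.IsMAdjustmentSet

/-! ### Sending bits along a walk -/

theorem sig_xor {α : Type*} (o : Option α) (b b' : α → Bool) :
    sig o (fun a => xor (b a) (b' a)) = xor (sig o b) (sig o b') := by
  cases o <;> rfl

/-- Linearity: adding a fixed noise vector flips a fixed set of nodes. Positivity in the formula
will follow from a vector that flips the start of the walk and nothing in `C`. -/
theorem Wiring.sol_xor {V : Type*} {Vm : Finset V} {G : MGraph V Vm} {E : Type} [Fintype E]
    [Fintype V] (W : Wiring G E) (u u' : E → Bool) :
    W.sol (fun e => xor (u e) (u' e)) = fun i => xor (W.sol u i) (W.sol u' i) := by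
  refine W.sol_eq fun i => ?_
  rw [W.sol_apply u i, W.sol_apply u' i]
  simp only [Wiring.eqn, sig_xor]
  generalize sig (W.src false i) (W.sol u) = a1
  generalize sig (W.src false i) (W.sol u') = a2
  generalize sig (W.src true i) (W.sol u) = a3
  generalize sig (W.src true i) (W.sol u') = a4
  generalize sig (W.noise false i) u = a5
  generalize sig (W.noise false i) u' = a6
  generalize sig (W.noise true i) u = a7
  generalize sig (W.noise true i) u' = a8
  revert a1 a2 a3 a4 a5 a6 a7 a8
  decide

namespace ADMG

variable {N : Type*}

/-- The neighbours on a walk from which the `t`-th node receives its bit. -/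
def edgeSrc (m : ℕ) (nd : ℕ → N) (kd : ℕ → EdgeKind) : Bool → ℕ → Option N
  | false, 0 => none
  | false, t + 1 => match kd t with
    | EdgeKind.fwd => some (nd t)
    | _ => none
  | true, t => if t < m then match kd t with
    | EdgeKind.bwd => some (nd (t + 1))
    | _ => none else none

/-- The noises from which the `t`-th node of a walk receives its bit: the common noise
`(t, true)` for a bidirected edge `t`, and its own noise `(t, false)` for a node without
arrowheads. -/
def edgeNoise (m : ℕ) (kd : ℕ → EdgeKind) : Bool → ℕ → Option (ℕ × Bool)
  | false, 0 => bif dep kd m 0 then none else some (0, false)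
  | false, t + 1 => match kd t with
    | EdgeKind.bidir => some (t, true)
    | EdgeKind.fwd => none
    | EdgeKind.bwd => bif dep kd m (t + 1) then none else some (t + 1, false)
  | true, t => if t < m then match kd t with
    | EdgeKind.bidir => some (t, true)
    | _ => none else none

/-- The bit carried by the `t`-th edge of a walk. -/
def edgeSig (nd : ℕ → N) (kd : ℕ → EdgeKind) (b : N → Bool) (v : ℕ × Bool → Bool) (t : ℕ) :
    Bool :=
  match kd t with
  | EdgeKind.fwd => b (nd t)
  | EdgeKind.bwd => b (nd (t + 1))
  | EdgeKind.bidir => v (t, true)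

/-- The bit received by the `t`-th node of a walk. -/
def edgeEqn (m : ℕ) (nd : ℕ → N) (kd : ℕ → EdgeKind) (b : N → Bool) (v : ℕ × Bool → Bool)
    (t : ℕ) : Bool :=
  xor (xor (sig (edgeSrc m nd kd false t) b) (sig (edgeSrc m nd kd true t) b))
    (xor (sig (edgeNoise m kd false t) v) (sig (edgeNoise m kd true t) v))

variable {m : ℕ} {nd : ℕ → N} {kd : ℕ → EdgeKind} {b : N → Bool} {v : ℕ × Bool → Bool}

theorem edgeSig_zero (hm : 0 < m) (h : b (nd 0) = edgeEqn m nd kd b v 0) :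
    edgeSig nd kd b v 0 = b (nd 0) := by
  cases hk : kd 0 <;>
    simp [edgeSig, hk, edgeEqn, edgeSrc, edgeNoise, dep, hm, EdgeKind.headAtStart, sig] at h ⊢ <;>
    exact h.symm

theorem edgeSig_last {t : ℕ} (h : b (nd (t + 1)) = edgeEqn (t + 1) nd kd b v (t + 1)) :
    edgeSig nd kd b v t = b (nd (t + 1)) := by
  cases hk : kd t <;>
    simp [edgeSig, hk, edgeEqn, edgeSrc, edgeNoise, sig] at h ⊢ <;>
    exact h.symm

/-- A chain node passes on the bit it receives, and a node without arrowheads sends its own bit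
along both edges; only a collider, being the sum of the two incoming bits, makes them differ. -/
theorem edgeSig_succ {t : ℕ} (ht : t + 1 < m)
    (h : b (nd (t + 1)) = edgeEqn m nd kd b v (t + 1)) :
    edgeSig nd kd b v (t + 1) =
      xor (edgeSig nd kd b v t) (coll kd (t + 1) && b (nd (t + 1))) := by
  cases hk : kd t <;> cases hk' : kd (t + 1) <;>
    simp [edgeSig, hk, hk', edgeEqn, edgeSrc, edgeNoise, sig, ht, dep, coll, arr,
      EdgeKind.headAtStart, EdgeKind.headAtEnd] at h ⊢ <;> simp [h]
  rw [Bool.xor_comm (b _), ← Bool.xor_assoc, Bool.xor_self, Bool.false_xor]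

/-- The sum of the bits of the first colliders of a walk. -/
def collSum (kd : ℕ → EdgeKind) (e : ℕ → Bool) : ℕ → Bool
  | 0 => false
  | t + 1 => xor (collSum kd e t) (coll kd (t + 1) && e (t + 1))

theorem collSum_congr {e e' : ℕ → Bool} {t : ℕ}
    (h : ∀ s, s ≤ t → coll kd s = true → e s = e' s) : collSum kd e t = collSum kd e' t := by
  induction t with
  | zero => rfl
  | succ t ih =>
    rw [collSum, collSum, ih fun s hs => h s (by omega)]
    cases hc : coll kd (t + 1) with
    | false => rfl
    | true => rw [h _ le_rfl hc]

theorem edgeSig_eq (h : ∀ t ≤ m, b (nd t) = edgeEqn m nd kd b v t) {t : ℕ} (ht : t < m) :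
    edgeSig nd kd b v t = xor (b (nd 0)) (collSum kd (fun s => b (nd s)) t) := by
  induction t with
  | zero => rw [edgeSig_zero ht (h 0 ht.le), collSum, Bool.xor_false]
  | succ t ih =>
    rw [edgeSig_succ ht (h _ ht.le), ih (by omega), collSum, Bool.xor_assoc]

/-- The bits at the ends of the walk differ by the sum of the bits of the colliders. -/
theorem end_eq (hm : 0 < m) (h : ∀ t ≤ m, b (nd t) = edgeEqn m nd kd b v t) :
    b (nd m) = xor (b (nd 0)) (collSum kd (fun s => b (nd s)) (m - 1)) := by
  obtain ⟨t, rfl⟩ := Nat.exists_eq_succ_of_ne_zero hm.ne'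
  rw [← edgeSig_last (h _ le_rfl), edgeSig_eq h t.lt_succ_self]
  rfl

/-- If the last edges of a walk point forward, its last bit comes from the node before them. -/
theorem end_eq_of_forall_fwd {j : ℕ} (hj : j ≤ m) (hf : ∀ t, j ≤ t → t < m → kd t = EdgeKind.fwd)
    (h : ∀ t, j < t → t ≤ m → b (nd t) = edgeEqn m nd kd b v t) : b (nd m) = b (nd j) := by
  induction hj using Nat.decreasingInduction with
  | self => rfl
  | of_succ t ht ih =>
    rw [ih (fun s hs => hf s (by omega)) (fun s hs => h s (by omega)), h (t + 1) (by omega) ht]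
    have h1 := hf t le_rfl ht
    by_cases h2 : t + 1 < m
    · have h3 := hf (t + 1) (by omega) h2
      simp [edgeEqn, edgeSrc, edgeNoise, sig, h1, h3]
    · simp [edgeEqn, edgeSrc, edgeNoise, sig, h1, h2]

/-- The bit of a node that receives nothing along directed edges is a noise. -/
theorem exists_noise {j : ℕ} (hk : kd j ≠ EdgeKind.fwd) (hj : j < m)
    (hf : ∀ t, j + 1 ≤ t → t < m → kd t = EdgeKind.fwd) :
    ∃ k : ℕ × Bool, k.1 ≤ m ∧ ∀ (b : N → Bool) v, edgeEqn m nd kd b v (j + 1) = v k := by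
  have h2 : j + 1 < m → kd (j + 1) = EdgeKind.fwd := hf _ le_rfl
  cases hk' : kd j with
  | fwd => exact absurd hk' hk
  | bwd =>
    refine ⟨(j + 1, false), hj, fun b v => ?_⟩
    by_cases h3 : j + 1 < m
    · simp [edgeEqn, edgeSrc, edgeNoise, sig, hk', h3, h2 h3, dep, EdgeKind.headAtStart]
    · simp [edgeEqn, edgeSrc, edgeNoise, sig, hk', h3, dep]
  | bidir =>
    refine ⟨(j, true), hj.le, fun b v => ?_⟩
    by_cases h3 : j + 1 < m
    · simp [edgeEqn, edgeSrc, edgeNoise, sig, hk', h3, h2 h3]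
    · simp [edgeEqn, edgeSrc, edgeNoise, sig, hk', h3]

/-- If all noises are `true` and precisely the noncolliders are `true`, the equations hold. -/
theorem edgeEqn_true {t : ℕ} (ht : t ≤ m)
    (hb : ∀ s ≤ m, b (nd s) = !(arr kd s && dep kd m s)) (hv : ∀ k, v k = true) :
    b (nd t) = edgeEqn m nd kd b v t := by
  have h0 := hb t ht
  rcases t with _ | t
  · by_cases hm : 0 < m
    · have h1 := hb 1 hm
      cases hk : kd 0 <;>
        simp [edgeEqn, edgeSrc, edgeNoise, sig, dep, hm, hk, EdgeKind.headAtStart,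
          EdgeKind.headAtEnd, arr, hv] at h0 h1 ⊢ <;> simp [h0, h1]
    · simp [edgeEqn, edgeSrc, edgeNoise, sig, dep, hm, arr, hv] at h0 ⊢
      exact h0
  · have h1 := hb t (by omega)
    by_cases hm : t + 1 < m
    · have h2 := hb (t + 2) hm
      have hm' : t < m := by omega
      cases hk : kd t <;> cases hk' : kd (t + 1) <;>
        simp [edgeEqn, edgeSrc, edgeNoise, sig, dep, hm, hm', hk, hk', EdgeKind.headAtStart,
          EdgeKind.headAtEnd, arr, hv] at h0 h1 h2 ⊢ <;> simp [h0, h1, h2]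
    · have hm' : t < m := by omega
      cases hk : kd t <;>
        simp [edgeEqn, edgeSrc, edgeNoise, sig, dep, hm, hm', hk, EdgeKind.headAtStart,
          EdgeKind.headAtEnd, arr, hv] at h0 h1 ⊢ <;> simp [h0, h1]

theorem edgeSrc_false {t : ℕ} {j : N} (h : edgeSrc m nd kd false t = some j) :
    ∃ s, t = s + 1 ∧ kd s = EdgeKind.fwd ∧ j = nd s := by
  rcases t with _ | t
  · cases h
  · cases hk : kd t <;> simp [edgeSrc, hk] at h
    exact ⟨t, rfl, hk, h.symm⟩

theorem edgeSrc_true {t : ℕ} {j : N} (h : edgeSrc m nd kd true t = some j) :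
    t < m ∧ kd t = EdgeKind.bwd ∧ j = nd (t + 1) := by
  by_cases ht : t < m
  · cases hk : kd t <;> simp [edgeSrc, hk, ht] at h
    exact ⟨ht, rfl, h.symm⟩
  · simp [edgeSrc, ht] at h

/-- The Boolean separates private noises from those of bidirected edges, so a noise read by two
different nodes of the walk belongs to a bidirected edge between them. -/
theorem edgeNoise_spec {s : Bool} {t : ℕ} (ht : t ≤ m) {k : ℕ × Bool}
    (h : edgeNoise m kd s t = some k) : k.1 ≤ m ∧ (k = (t, false) ∨
      k.2 = true ∧ k.1 < m ∧ kd k.1 = EdgeKind.bidir ∧ (t = k.1 ∨ t = k.1 + 1)) := by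
  cases s
  · rcases t with _ | t
    · cases hd : dep kd m 0 <;> simp [edgeNoise, hd] at h
      subst h
      simp
    · cases hk : kd t <;> simp [edgeNoise, hk] at h
      · cases hd : dep kd m (t + 1) <;> simp [hd] at h
        subst h
        simp [ht]
      · subst h
        exact ⟨by omega, Or.inr ⟨rfl, ht, hk, Or.inr rfl⟩⟩
  · by_cases ht' : t < m
    · cases hk : kd t <;> simp [edgeNoise, hk, ht'] at h
      subst h
      exact ⟨ht, Or.inr ⟨rfl, ht', hk, Or.inl rfl⟩⟩
    · simp [edgeNoise, ht'] at h

end ADMG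

/-! ### The linear model of a walk, with copies along the excursions of its colliders -/

section WalkWiring

open ADMG

variable {V : Type*} {Vm : Finset V} {G : MGraph V Vm} {m : ℕ} {nd : ℕ → MNode Vm}
  {kd : ℕ → EdgeKind} {par : MNode Vm → Option (MNode Vm)}

open Classical in
/-- The linear model in which bits are sent along a walk, and the bits of nodes off the walk are
copied. -/
noncomputable def walkWiring
    (hstep : ∀ t < m, G.toADMG.Step (kd t) (nd t) (nd (t + 1)))
    (hpar : ∀ i j, par i = some j → G.dir j i) : Wiring G (Fin (m + 1) × Bool) where
  src s i := if h : ∃ t ≤ m, nd t = i then edgeSrc m nd kd s h.choose else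
    bif s then none else par i
  noise s i := if h : ∃ t ≤ m, nd t = i then
    (edgeNoise m kd s h.choose).map fun k => (Fin.ofNat (m + 1) k.1, k.2) else none
  dir_of_src := by
    intro s i j hj
    split_ifs at hj with h
    · have h1 := h.choose_spec
      set t := h.choose
      cases s
      · obtain ⟨r, h2, h3, h4⟩ := edgeSrc_false hj
        have := hstep r (by omega)
        rw [h3] at this
        rw [← h1.2, h4, h2]
        exact this
      · obtain ⟨h2, h3, h4⟩ := edgeSrc_true hj
        have := hstep t h2
        rw [h3] at this
        rw [← h1.2, h4]
        exact this
    · cases s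
      · exact hpar i j hj
      · cases hj
  bi_of_noise := by
    intro s s' i j k hi hj hij
    split_ifs at hi with h1
    split_ifs at hj with h2
    rw [Option.map_eq_some_iff] at hi hj
    obtain ⟨k1, hk1, e1⟩ := hi
    obtain ⟨k2, hk2, e2⟩ := hj
    have g1 := h1.choose_spec
    have g2 := h2.choose_spec
    set t1 := h1.choose
    set t2 := h2.choose
    have hne : t1 ≠ t2 := fun h => hij (by rw [← g1.2, ← g2.2, h])
    obtain ⟨l1, s1⟩ := edgeNoise_spec g1.1 hk1
    obtain ⟨l2, s2⟩ := edgeNoise_spec g2.1 hk2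
    -- First components are at most `m`, so reduction modulo `m + 1` loses nothing.
    have hk : k1 = k2 := by
      rw [← e2, Prod.mk.injEq] at e1
      refine Prod.ext ?_ e1.2
      have := congrArg Fin.val e1.1
      rw [Fin.val_ofNat, Fin.val_ofNat, Nat.mod_eq_of_lt (by omega),
        Nat.mod_eq_of_lt (by omega)] at this
      exact this
    subst hk
    rcases s1 with s1 | ⟨a1, a2, a3, a4⟩
    · rcases s2 with s2 | ⟨b1, -⟩
      · rw [s1, Prod.mk.injEq] at s2
        exact absurd s2.1 hne
      · rw [s1] at b1
        cases b1
    · rcases s2 with s2 | ⟨-, -, -, b4⟩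
      · rw [s2] at a1
        cases a1
      · have hs := hstep _ a2
        rw [a3] at hs
        have hs : G.bi (nd k1.1) (nd (k1.1 + 1)) := hs
        rw [← g1.2, ← g2.2]
        rcases a4 with a4 | a4 <;> rcases b4 with b4 | b4
        · omega
        · rw [a4, b4]
          exact hs
        · rw [a4, b4]
          exact G.bi_symm _ _ hs
        · omega

variable {hstep : ∀ t < m, G.toADMG.Step (kd t) (nd t) (nd (t + 1))}
  {hpar : ∀ i j, par i = some j → G.dir j i}

/-- The noises of a walk, indexed by all natural numbers. -/
def extendNoise (u : Fin (m + 1) × Bool → Bool) (k : ℕ × Bool) : Bool :=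
  u (Fin.ofNat (m + 1) k.1, k.2)

theorem walkWiring_eqn (hinj : ∀ i j, i ≤ m → j ≤ m → nd i = nd j → i = j) {t : ℕ} (ht : t ≤ m) (b : MNode Vm → Bool)
    (u : Fin (m + 1) × Bool → Bool) :
    (walkWiring hstep hpar).eqn (nd t) b u = edgeEqn m nd kd b (extendNoise u) t := by
  have h : ∃ s ≤ m, nd s = nd t := ⟨t, ht, rfl⟩
  have ht' : h.choose = t := hinj _ _ h.choose_spec.1 ht h.choose_spec.2
  have hm : ∀ o : Option (ℕ × Bool), sig (o.map fun k => (Fin.ofNat (m + 1) k.1, k.2)) u =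
      sig o (extendNoise u) := by
    intro o
    cases o <;> rfl
  simp only [Wiring.eqn, walkWiring, dif_pos h, ht', hm, edgeEqn]

theorem walkWiring_eqn_of_ne {i : MNode Vm} (hi : ∀ t ≤ m, nd t ≠ i) (b : MNode Vm → Bool)
    (u : Fin (m + 1) × Bool → Bool) :
    (walkWiring hstep hpar).eqn i b u = sig (par i) b := by
  have h : ¬ ∃ t ≤ m, nd t = i := by
    rintro ⟨t, ht, h⟩
    exact hi t ht h
  simp [Wiring.eqn, walkWiring, h, sig_none]

end WalkWiring

namespace ADMG

variable {N : Type*} {K : ADMG N} {C : Set N} {m : ℕ} {nd : ℕ → N} {kd : ℕ → EdgeKind}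

open Classical in
/-- The predecessor of a node on the chosen directed walks from colliders to `C`. -/
noncomputable def excursionPrev (K : ADMG N) (C : Set N) (m : ℕ) (nd : ℕ → N)
    (kd : ℕ → EdgeKind) (i : N) : Option N :=
  if h : ∃ q : ℕ × ℕ, q.1 < m ∧ coll kd q.1 = true ∧ q.2 < K.depth C (nd q.1) ∧
    (K.next C)^[q.2 + 1] (nd q.1) = i then some ((K.next C)^[h.choose.2] (nd h.choose.1)) else none

variable {H : ADMG N} {A B : Set N}

theorem IsMinWalk.excursionPrev_spec (hw : IsMinWalk H K C A B m nd kd) {i j : N}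
    (h : excursionPrev K C m nd kd i = some j) :
    ∃ s l, s < m ∧ coll kd s = true ∧ l < K.depth C (nd s) ∧
      (K.next C)^[l + 1] (nd s) = i ∧ (K.next C)^[l] (nd s) = j ∧ K.dir j i := by
  unfold excursionPrev at h
  split_ifs at h with hq
  obtain ⟨h1, h2, h3, h4⟩ := hq.choose_spec
  have hj := Option.some.inj h
  refine ⟨_, _, h1, h2, h3, h4, hj, ?_⟩
  rw [← h4, ← hj]
  exact (hw.ancOf_of_coll h1 h2).dir_iterate_next h3

/-- The chosen predecessor is the expected one: excursions of different colliders are disjoint, and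
within one excursion the depth determines the position. -/
theorem IsMinWalk.excursionPrev_iterate_next (hw : IsMinWalk H K C A B m nd kd)
    (hHK : ∀ a b, K.dir a b → a ∉ A → H.dir a b) (hAC : ∀ a ∈ A, a ∉ C) (hBC : ∀ b ∈ B, b ∉ C)
    {s l : ℕ} (hs : s < m) (hc : coll kd s = true) (hl : l < K.depth C (nd s)) :
    excursionPrev K C m nd kd ((K.next C)^[l + 1] (nd s)) = some ((K.next C)^[l] (nd s)) := by
  have h : ∃ q : ℕ × ℕ, q.1 < m ∧ coll kd q.1 = true ∧ q.2 < K.depth C (nd q.1) ∧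
      (K.next C)^[q.2 + 1] (nd q.1) = (K.next C)^[l + 1] (nd s) := ⟨(s, l), hs, hc, hl, rfl⟩
  unfold excursionPrev
  rw [dif_pos h]
  obtain ⟨h1, h2, h3, h4⟩ := h.choose_spec
  set q := h.choose
  have hqs : q.1 = s := by
    rcases lt_trichotomy q.1 s with hlt | heq | hlt
    · exact absurd h4 (hw.iterate_next_ne_iterate_next hHK hAC hBC hlt hs h2 hc (by omega)
        (by omega) (by omega) (by omega))
    · exact heq
    · exact absurd h4.symm (hw.iterate_next_ne_iterate_next hHK hAC hBC hlt h1 hc h2 (by omega)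
        (by omega) (by omega) (by omega))
  rw [hqs] at h3 h4
  have e1 := ((hw.ancOf_of_coll hs hc).iterate_next (l := q.2 + 1) (by omega)).2
  have e2 := ((hw.ancOf_of_coll hs hc).iterate_next (l := l + 1) (by omega)).2
  rw [h4] at e1
  have : q.2 = l := by omega
  rw [hqs, this]

end ADMG

/-! ### Necessity of condition (b) -/

namespace MGraph.IsMAdjustmentSet

open ADMG

variable {V : Type*} {Vm : Finset V} [Fintype V] [DecidableEq V] {G : MGraph V Vm}
  {X Y Z : Finset V}

/-- Bits travel along a minimal open walk, and collider bits are copied into `C`. Given R_W = 1, the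
end bit is the start bit plus a function `g` of z, whereas under the intervention it is one noise.
Hence P(g = c | R_W = 1) would be 3/4 for both bits c. -/
theorem not_conn (hXY : Disjoint X Y) (hXZ : Disjoint X Z) (hYZ : Disjoint Y Z)
    (h : G.IsMAdjustmentSet X Y Z) :
    ¬ Conn (G.toADMG.removeCausal (varNodes Vm X) (varNodes Vm Y)) G.toADMG
      (varNodes Vm Z ∪ indNodes Vm (X ∪ Y ∪ Z)) (varNodes Vm X) (varNodes Vm Y) := by
  classical
  intro hconn
  obtain ⟨m, nd, kd, hw⟩ := hconn.exists_isMinWalk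
  set A := varNodes Vm X with hA
  set B := varNodes Vm Y with hB
  set R := indNodes Vm (X ∪ Y ∪ Z) with hR
  set C := varNodes Vm Z ∪ R with hC
  have hAB : ∀ a ∈ A, a ∉ B := fun a ha hb => notMem_varNodes_of_disjoint hXY a ha hb
  have hAC : ∀ a ∈ A, a ∉ C := by
    rintro a ha (hz | hr)
    · exact notMem_varNodes_of_disjoint hXZ a ha hz
    · exact notMem_varNodes_of_indNodes a hr ha
  have hBC : ∀ a ∈ B, a ∉ C := by
    rintro a ha (hz | hr)
    · exact notMem_varNodes_of_disjoint hYZ a ha hz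
    · exact notMem_varNodes_of_indNodes a hr ha
  have hHK : ∀ a b, (G.toADMG.removeCausal A B).dir a b → G.dir a b := fun a b h => h.1
  have hKH : ∀ a b, G.dir a b → a ∉ A → (G.toADMG.removeCausal A B).dir a b :=
    fun a b h ha => removeCausal_dir h ha
  have hm : 0 < m := by
    rcases Nat.eq_zero_or_pos m with rfl | hm
    · exact absurd hw.mem_end (hAB _ hw.start)
    · exact hm
  have hinj : ∀ i j, i ≤ m → j ≤ m → nd i = nd j → i = j := by
    intro i j hi hj hij
    rcases lt_trichotomy i j with hlt | heq | hlt
    · exact absurd hij (hw.injOn hHK hBC hlt hj)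
    · exact heq
    · exact absurd hij.symm (hw.injOn hHK hBC hlt hi)
  have hstep : ∀ t < m, G.toADMG.Step (kd t) (nd t) (nd (t + 1)) := by
    intro t ht
    have := hw.step t ht
    cases hk : kd t <;> rw [hk] at this
    · exact hHK _ _ this
    · exact hHK _ _ this
    · exact this
  let W : Wiring G (Fin (m + 1) × Bool) := walkWiring (par := excursionPrev G.toADMG C m nd kd)
    hstep fun i j hij => by
      obtain ⟨-, -, -, -, -, -, -, hd⟩ := hw.excursionPrev_spec hij
      exact hd
  have hnode : ∀ {t}, t ≤ m → ∀ b u, W.eqn (nd t) b u = edgeEqn m nd kd b (extendNoise u) t :=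
    fun ht b u => walkWiring_eqn hinj ht b u
  have hoff : ∀ {i}, (∀ t ≤ m, nd t ≠ i) → ∀ b u,
      W.eqn i b u = sig (excursionPrev G.toADMG C m nd kd i) b :=
    fun hi b u => walkWiring_eqn_of_ne hi b u
  have hA0 : ∀ n ∈ A, n ≠ nd 0 → ∀ b u, W.eqn n b u = false := by
    intro n hn hne b u
    rw [hoff fun t ht he => ?_]
    · cases hp : excursionPrev G.toADMG C m nd kd n with
      | none => rfl
      | some j =>
        obtain ⟨s, l, h1, h2, h3, h4, -⟩ := hw.excursionPrev_spec hp
        exact absurd (h4 ▸ hn) (hw.iterate_next_notMem hKH hAC hBC h1 h2 (l := l + 1) h3).1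
    · rcases Nat.eq_zero_or_pos t with rfl | ht0
      · exact hne he.symm
      · exact hw.notMem_start hAC hBC ht0 ht (he ▸ hn)
  have hB0 : ∀ n ∈ B, n ≠ nd m → ∀ b u, W.eqn n b u = false := by
    intro n hn hne b u
    rw [hoff fun t ht he => ?_]
    · cases hp : excursionPrev G.toADMG C m nd kd n with
      | none => rfl
      | some j =>
        obtain ⟨s, l, h1, h2, h3, h4, -⟩ := hw.excursionPrev_spec hp
        exact absurd (h4 ▸ hn) (hw.iterate_next_notMem hKH hAC hBC h1 h2 (l := l + 1) h3).2
    · rcases ht.lt_or_eq with ht0 | rfl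
      · exact hw.notMem_end hBC ht0 (he ▸ hn)
      · exact hne he.symm
  -- the bit of a collider reaches `C`
  have hexc : ∀ u, ∀ {s}, s < m → coll kd s = true → ∀ l ≤ G.toADMG.depth C (nd s),
      W.sol u ((G.toADMG.next C)^[l] (nd s)) = W.sol u (nd s) := by
    intro u s hs hc l hl
    induction l with
    | zero => rfl
    | succ l ih =>
      rw [← ih (by omega), W.sol_apply, hoff fun t ht he =>
        hw.iterate_next_ne hKH hAC hBC hs hc (by omega) hl ht he.symm,
        hw.excursionPrev_iterate_next hKH hAC hBC hs hc (by omega), sig_some]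
  set fin : ℕ → MNode Vm := fun s => (G.toADMG.next C)^[G.toADMG.depth C (nd s)] (nd s) with hfin
  have hfinC : ∀ {s}, s < m → coll kd s = true → fin s ∈ C := fun hs hc =>
    (hw.ancOf_of_coll hs hc).iterate_next_depth_mem
  -- The sum of the collider bits as seen at the ends of the excursions; those that end in an
  -- indicator contribute 0 given R_W = 1.
  let g : (MNode Vm → Bool) → Bool := fun b =>
    collSum kd (fun s => if fin s ∈ varNodes Vm Z then b (fin s) else false) (m - 1)
  have hg : ∀ u, (∀ r ∈ R, W.sol u r = false) → W.sol u (nd m) = xor (W.sol u (nd 0)) (g (W.sol u)) := by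
    intro u hu
    rw [end_eq (b := W.sol u) (v := extendNoise u) hm fun t ht => by rw [W.sol_apply, hnode ht]]
    refine congrArg _ (collSum_congr fun s hs hc => ?_)
    have hs' : s < m := by omega
    rw [← hexc u hs' hc _ le_rfl]
    by_cases hz : fin s ∈ varNodes Vm Z
    · rw [if_pos hz]
    · rw [if_neg hz]
      exact hu _ ((hfinC hs' hc).resolve_left hz)
  -- reversing all noises reverses the noncolliders
  let b1 : MNode Vm → Bool := fun i => decide (∃ t ≤ m, nd t = i ∧ (arr kd t && dep kd m t) = false)
  have hb1 : ∀ t ≤ m, b1 (nd t) = !(arr kd t && dep kd m t) := by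
    intro t ht
    cases hc : arr kd t && dep kd m t with
    | false => exact decide_eq_true ⟨t, ht, rfl, hc⟩
    | true =>
      refine decide_eq_false ?_
      rintro ⟨t', ht', he, hc'⟩
      rw [hinj _ _ ht' ht he, hc] at hc'
      cases hc'
  have hb1' : ∀ i, (∀ t ≤ m, nd t ≠ i) → b1 i = false := by
    intro i hi
    refine decide_eq_false ?_
    rintro ⟨t, ht, he, -⟩
    exact hi t ht he
  have hsol1 : W.sol (fun _ => true) = b1 := by
    refine W.sol_eq fun i => ?_
    by_cases hi : ∃ t ≤ m, nd t = i
    · obtain ⟨t, ht, rfl⟩ := hi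
      rw [hnode ht]
      exact edgeEqn_true ht hb1 fun _ => rfl
    · have hi' : ∀ t ≤ m, nd t ≠ i := fun t ht he => hi ⟨t, ht, he⟩
      rw [hb1' i hi', hoff hi']
      cases hp : excursionPrev G.toADMG C m nd kd i with
      | none => rfl
      | some j =>
        obtain ⟨s, l, h1, h2, h3, h4, h5, -⟩ := hw.excursionPrev_spec hp
        rw [sig_some, ← h5]
        rcases Nat.eq_zero_or_pos l with rfl | hl
        · have hd : dep kd m s = true := by
            rw [dep_of_lt h1]
            simp only [coll, Bool.and_eq_true] at h2
            exact h2.2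
          rw [Function.iterate_zero_apply, hb1 s h1.le, IsMinWalk.arr_of_coll h2, hd]
          rfl
        · exact (hb1' _ fun t ht he =>
            hw.iterate_next_ne hKH hAC hBC h1 h2 hl h3.le ht he.symm).symm
  -- A node of `C` on the open walk is necessarily a collider.
  have hb1C : ∀ c ∈ C, b1 c = false := by
    intro c hc
    refine decide_eq_false ?_
    rintro ⟨t, ht, rfl, he⟩
    have := hw.jopen (hBC _ hw.mem_end) ht
    rw [he] at this
    exact jopen_false.1 this hc
  have hb10 : b1 (nd 0) = true := by
    rw [hb1 0 hm.le]
    rfl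
  -- the last bit is a noise, also under the intervention
  obtain ⟨k, hnoise⟩ : ∃ k : Fin (m + 1) × Bool, ∀ (b : MNode Vm → Bool) u,
      (∀ i, i ∉ A → b i = W.eqn i b u) → b (nd m) = u k := by
    -- The last edge that is not forward is sought. It exists, as an all-forward walk would begin
    -- with an edge from `X` into the free ancestors of `Y`, deleted in `removeCausal`. The node
    -- after it reads a single noise, which is then copied to the end.
    have hP : ∃ j, ∀ t, j ≤ t → t < m → kd t = EdgeKind.fwd := ⟨m, fun t h1 h2 => by omega⟩
    have hj := Nat.find_spec hP
    have hjm : Nat.find hP ≤ m := Nat.find_min' hP fun t h1 h2 => by omega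
    cases hj0 : Nat.find hP with
    | zero =>
      exfalso
      rw [hj0] at hj
      have hfree : ∀ t, 0 < t → t ≤ m → nd t ∈ G.toADMG.freeAnc A B := by
        intro t ht0 ht
        induction ht using Nat.decreasingInduction with
        | self => exact freeAnc_of_mem hw.mem_end fun ha => hAB _ ha hw.mem_end
        | of_succ t ht ih =>
          have hs := hstep t ht
          rw [hj t (Nat.zero_le t) ht] at hs
          exact freeAnc_of_dir hs (hw.notMem_start hAC hBC ht0 ht.le) (ih (by omega))
      have hs := hw.step 0 hm
      rw [hj 0 le_rfl hm] at hs
      exact hs.2 ⟨hw.start, hfree 1 one_pos hm⟩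
    | succ j =>
      rw [hj0] at hj hjm
      have hnf : kd j ≠ EdgeKind.fwd := by
        intro hf
        refine Nat.find_min hP (m := j) (by omega) fun t h1 h2 => ?_
        rcases h1.lt_or_eq with h1 | rfl
        · exact hj t h1 h2
        · exact hf
      obtain ⟨k, -, hk2⟩ := exists_noise (nd := nd) hnf hjm hj
      refine ⟨(Fin.ofNat (m + 1) k.1, k.2), fun b u hb => ?_⟩
      have hb' : ∀ t, 0 < t → t ≤ m → b (nd t) = edgeEqn m nd kd b (extendNoise u) t := by
        intro t h1 h2
        rw [← hnode h2]
        exact hb _ (hw.notMem_start hAC hBC h1 h2)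
      rw [end_eq_of_forall_fwd (v := extendNoise u) hjm hj fun t h1 h2 => hb' t (by omega) h2,
        hb' (j + 1) j.succ_pos hjm, hk2]
      rfl
  have hdo : ∀ xv, {u | ∀ n ∈ B, W.doSol X xv u n = false} = {u | u k = false} := by
    intro xv
    ext u
    have h1 := hnoise (W.doSol X xv u) u fun i hi => W.doSol_of_notMem xv u hi
    rw [Set.mem_ofPred_eq, Set.mem_ofPred_eq, ← h1]
    refine ⟨fun hu => hu _ hw.mem_end, fun hu n hn => ?_⟩
    by_cases hne : n = nd m
    · rw [hne]
      exact hu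
    · rw [W.doSol_of_notMem xv u fun ha => hAB _ ha hn, hB0 n hn hne]
  have key : ∀ c : Bool, 3 / 4 * (bitLaw _).real {u | ∀ r ∈ R, W.sol u r = false} =
      (bitLaw _).real {u | (∀ r ∈ R, W.sol u r = false) ∧ xor c (g (W.sol u)) = false} := by
    intro c
    rw [← W.adjustment_eq h (fun n => if n = nd 0 then c else false)
      (fun b => xor c (g b) = false) ?_ ?_ ?_, hdo, bitLaw_real_eval]
    · intro u hu
      have hx : ∀ u, W.sol u (nd 0) = c → ∀ n ∈ A, W.sol u n = if n = nd 0 then c else false := by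
        intro u hu n hn
        by_cases hne : n = nd 0
        · rw [if_pos hne, hne, hu]
        · rw [if_neg hne, W.sol_apply, hA0 n hn hne]
      by_cases h0 : W.sol u (nd 0) = c
      · exact ⟨u, hu, fun _ _ => rfl, hx u h0⟩
      -- If the start has the wrong bit, flipping all noises corrects it and leaves `Z` and the
      -- indicators unchanged.
      · have hs := W.sol_xor u fun _ => true
        rw [hsol1] at hs
        have hs' : ∀ i, W.sol (fun e => xor (u e) true) i = xor (W.sol u i) (b1 i) :=
          congrFun hs
        refine ⟨_, fun r hr => ?_, fun n hn => ?_, hx (fun e => xor (u e) true) ?_⟩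
        · rw [hs', hb1C r (Or.inr hr), hu r hr]
          rfl
        · rw [hs', hb1C n (Or.inl hn), Bool.xor_false]
        · rw [hs', hb10]
          revert h0
          cases W.sol u (nd 0) <;> cases c <;> simp
    · intro u hu hx
      have h0 := hx _ hw.start
      rw [if_pos rfl] at h0
      have h1 := hg u hu
      rw [h0] at h1
      rw [← h1]
      refine ⟨fun hy => hy _ hw.mem_end, fun hy n hn => ?_⟩
      by_cases hne : n = nd m
      · rw [hne]
        exact hy
      · rw [W.sol_apply, hB0 n hn hne]
    · intro b b' hb
      have : g b = g b' := collSum_congr fun s _ _ => by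
        by_cases hz : fin s ∈ varNodes Vm Z
        · simp only [if_pos hz]
          exact hb _ hz
        · simp only [if_neg hz]
      rw [this]
  have hsum : (bitLaw _).real {u | (∀ r ∈ R, W.sol u r = false) ∧ xor false (g (W.sol u)) = false} +
      (bitLaw _).real {u | (∀ r ∈ R, W.sol u r = false) ∧ xor true (g (W.sol u)) = false} =
      (bitLaw _).real {u | ∀ r ∈ R, W.sol u r = false} := by
    rw [← measureReal_union]
    · congr 1
      ext u
      simp only [Set.mem_union, Set.mem_ofPred_eq]
      cases g (W.sol u) <;> simp
    · refine Set.disjoint_left.2 fun u h1 h2 => ?_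
      have e1 := h1.2
      have e2 := h2.2
      revert e1 e2
      cases g (W.sol u) <;> simp
    · exact Set.Finite.measurableSet (Set.toFinite _)
  -- The two events partition R_W = 1, so 3/4 + 3/4 would equal 1.
  rw [← key, ← key] at hsum
  have hpos := W.bitLaw_observed_pos (S := X ∪ Y ∪ Z)
  rw [← hR] at hpos
  linarith

end MGraph.IsMAdjustmentSet

/-! ### Necessity of condition (d) -/

namespace ADMG

open Relation (ReflTransGen TransGen)

variable {N : Type*} {G : ADMG N} {X Y C : Set N}

theorem removeCausal_between {a b : N} (hC : ∀ i ∈ (G.removeIn X).between a b, i ∉ C)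
    (ha : a ∉ X) (h : (G.removeIn X).Desc a b) :
    ReflTransGen (fun i j => (G.removeCausal X Y).dir i j ∧ j ∉ C) a b := by
  suffices ∀ i, (G.removeIn X).Desc i b → (G.removeIn X).Desc a i →
      ReflTransGen (fun i j => (G.removeCausal X Y).dir i j ∧ j ∉ C) i b from
    this a h ReflTransGen.refl
  intro i hi
  induction hi using ReflTransGen.head_induction_on with
  | refl => exact fun _ => ReflTransGen.refl
  | head h1 h2 ih =>
    intro h3
    exact (ih (h3.tail h1)).head ⟨removeCausal_dir h1.1 (Desc.notMem_of_removeIn h3 ha),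
      hC _ ⟨h3.tail h1, h2⟩⟩

end ADMG

namespace MGraph.IsMAdjustmentSet

open ADMG

variable {V : Type*} {Vm : Finset V} [Fintype V] [DecidableEq V] {G : MGraph V Vm}
  {X Y Z : Finset V}

/-- There is no set `S` of nodes with a common bit, with an element in `Y` and one in `Z`, from
which a node `τ 0` receives its bit, which is passed on along a directed path `τ` to an
indicator. -/
theorem not_trail (hXY : Disjoint X Y) (hXZ : Disjoint X Z) (h : G.IsMAdjustmentSet X Y Z)
    {l : ℕ} {τ : ℕ → MNode Vm} {S T : Set (MNode Vm)} {q : Option (MNode Vm)} {y z : MNode Vm}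
    (hinj : ∀ i j, i ≤ l → j ≤ l → τ i = τ j → i = j)
    (hdir : ∀ j < l, G.dir (τ j) (τ (j + 1)))
    (hτX : τ 0 ∈ varNodes Vm X) (hτY : ∀ j, 0 < j → j ≤ l → τ j ∉ varNodes Vm Y)
    (hτR : ∀ j ≤ l, τ j ∈ indNodes Vm (X ∪ Y ∪ Z) ↔ j = l)
    (hτS : ∀ j ≤ l, τ j ∉ S) (hT : T ⊆ insert (τ 0) S)
    (hbi : ∀ i ∈ T, ∀ j ∈ T, i ≠ j → G.bi i j)
    (hpar : ∀ i ∈ S, i ∉ T → ∃ j ∈ S, G.dir j i)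
    (hq : τ 0 ∈ T ∧ q = none ∨ τ 0 ∉ T ∧ ∃ p ∈ S, q = some p ∧ G.dir p (τ 0))
    (hSX : ∀ i ∈ S, i ∉ varNodes Vm X) (hSR : ∀ i ∈ S, i ∉ indNodes Vm (X ∪ Y ∪ Z))
    (hyS : y ∈ S) (hy : y ∈ varNodes Vm Y) (hzS : z ∈ S) (hz : z ∈ varNodes Vm Z) : False := by
  classical
  let trail : MNode Vm → Option ℕ := fun i =>
    if h : ∃ j ≤ l, τ j = i then some h.choose else none
  have htrail : ∀ j ≤ l, trail (τ j) = some j := by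
    intro j hj
    have h : ∃ k ≤ l, τ k = τ j := ⟨j, hj, rfl⟩
    exact (dif_pos h).trans
      (congrArg some (hinj _ _ h.choose_spec.1 hj h.choose_spec.2))
  have htrail_none : ∀ i, (∀ j ≤ l, τ j ≠ i) → trail i = none := by
    intro i hi
    refine dif_neg ?_
    rintro ⟨j, hj, he⟩
    exact hi j hj he
  have htrail_some : ∀ {i j}, trail i = some j → j ≤ l ∧ τ j = i := by
    intro i j hj
    by_cases h : ∃ k ≤ l, τ k = i
    · obtain ⟨k, hk, rfl⟩ := h
      rw [htrail k hk] at hj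
      cases hj
      exact ⟨hk, rfl⟩
    · rw [htrail_none i fun k hk he => h ⟨k, hk, he⟩] at hj
      cases hj
  -- The start of the trail receives its bit from the parent `q` in `S`, or from the common noise if
  -- `q` is `none`.
  let prev : ℕ → Option (MNode Vm) := fun j => Nat.casesOn j q fun j => some (τ j)
  -- The noise `none` is the common bit of `S`, read at the nodes of `T`; each `some j` is private
  -- to `τ j`.
  let W : Wiring G (Option (Fin (l + 1))) :=
    { src := fun s i => bif s then (trail i).bind prev else
        if hi : i ∈ S ∧ i ∉ T then some (hpar i hi.1 hi.2).choose else none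
      noise := fun s i => bif s then (trail i).map fun j => some (Fin.ofNat (l + 1) j) else
        if i ∈ T then some none else none
      dir_of_src := by
        intro s i j hj
        cases s
        · simp only [cond_false] at hj
          split_ifs at hj with hi
          cases hj
          exact (hpar i hi.1 hi.2).choose_spec.2
        · simp only [cond_true] at hj
          cases hk : trail i with
          | none =>
            rw [hk] at hj
            cases hj
          | some k =>
            rw [hk] at hj
            obtain ⟨h1, rfl⟩ := htrail_some hk
            cases k with
            | zero =>
              have hj : q = some j := hj
              rcases hq with ⟨-, hq⟩ | ⟨-, p, -, hq, hp⟩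
              · rw [hq] at hj
                cases hj
              · rw [hq] at hj
                cases hj
                exact hp
            | succ k =>
              cases hj
              exact hdir k h1
      bi_of_noise := by
        have hm : ∀ {i k}, ((trail i).map fun j => some (Fin.ofNat (l + 1) j)) = some k →
            ∃ j, k = some j ∧ i = τ j.val := by
          intro i k hk
          rw [Option.map_eq_some_iff] at hk
          obtain ⟨j, h1, rfl⟩ := hk
          obtain ⟨h2, h3⟩ := htrail_some h1
          refine ⟨_, rfl, ?_⟩
          rw [← h3, Fin.val_ofNat, Nat.mod_eq_of_lt (by omega)]
        intro s s' i j k hi hj hij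
        cases s <;> cases s' <;> simp only [cond_false, cond_true] at hi hj
        · split_ifs at hi with h1
          split_ifs at hj with h2
          exact hbi i h1 j h2 hij
        · split_ifs at hi with h1
          cases hi
          obtain ⟨j, h2, -⟩ := hm hj
          cases h2
        · split_ifs at hj with h1
          cases hj
          obtain ⟨j, h2, -⟩ := hm hi
          cases h2
        · obtain ⟨j1, rfl, h1⟩ := hm hi
          obtain ⟨j2, h3, h2⟩ := hm hj
          cases h3
          exact absurd (h1.trans h2.symm) hij }
  have hStr : ∀ i ∈ S, trail i = none := fun i hi =>
    htrail_none i fun j hj he => hτS j hj (he ▸ hi)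
  have eT : ∀ i ∈ S, i ∈ T → ∀ b u, W.eqn i b u = u none := by
    intro i hi hiT b u
    simp [W, Wiring.eqn, hStr i hi, hiT, sig]
  have eS : ∀ i ∈ S, i ∉ T → ∃ j ∈ S, G.dir j i ∧ ∀ b u, W.eqn i b u = b j := by
    intro i hi hiT
    refine ⟨_, (hpar i hi hiT).choose_spec.1, (hpar i hi hiT).choose_spec.2, fun b u => ?_⟩
    simp [W, Wiring.eqn, hStr i hi, hiT, hi, sig]
  have e0 : ∀ (b : MNode Vm → Bool) u, (∀ i ∈ S, b i = u none) →
      W.eqn (τ 0) b u = xor (u none) (u (some (Fin.ofNat (l + 1) 0))) := by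
    intro b u hb
    have h0 := htrail 0 (Nat.zero_le l)
    have h1 := hτS 0 (Nat.zero_le l)
    rcases hq with ⟨h2, h3⟩ | ⟨h2, p, h3, h4, -⟩
    · simp [W, Wiring.eqn, h0, h1, h2, h3, prev, sig]
    · simp [W, Wiring.eqn, h0, h1, h2, h4, prev, sig, hb p h3]
  have hTτ : ∀ j, j + 1 ≤ l → τ (j + 1) ∉ T := by
    intro j hj hjT
    rcases hT hjT with h1 | h1
    · exact absurd (hinj _ _ hj (Nat.zero_le l) h1) j.succ_ne_zero
    · exact hτS _ hj h1
  have e1 : ∀ j, j + 1 ≤ l → ∀ b u, W.eqn (τ (j + 1)) b u =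
      xor (b (τ j)) (u (some (Fin.ofNat (l + 1) (j + 1)))) := by
    intro j hj b u
    simp [W, Wiring.eqn, htrail _ hj, hτS _ hj, hTτ j hj, prev, sig]
  have eN : ∀ i, i ∉ S → (∀ j ≤ l, τ j ≠ i) → ∀ b u, W.eqn i b u = false := by
    intro i hi hiτ b u
    have hiT : i ∉ T := by
      intro hiT
      rcases hT hiT with h1 | h1
      · exact hiτ 0 (Nat.zero_le l) h1.symm
      · exact hi h1
    simp [W, Wiring.eqn, htrail_none i hiτ, hi, hiT, sig]
  have hcopy : ∀ (b : MNode Vm → Bool) u, (∀ i ∈ S, b i = W.eqn i b u) →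
      ∀ i ∈ S, b i = u none := by
    intro b u hb
    refine Wiring.copy_eq (G := G) fun i hi => ?_
    by_cases hiT : i ∈ T
    · left
      rw [hb i hi, eT i hi hiT]
    · right
      obtain ⟨j, hj, hd, he⟩ := eS i hi hiT
      exact ⟨j, hj, hd, by rw [hb i hi, he]⟩
  have hS : ∀ u, ∀ i ∈ S, W.sol u i = u none := fun u =>
    hcopy _ u fun i _ => W.sol_apply u i
  have hN : ∀ u i, i ∉ S → (∀ j ≤ l, τ j ≠ i) → W.sol u i = false := by
    intro u i h1 h2
    rw [W.sol_apply, eN i h1 h2]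
  have hprod : ∀ u, ∀ j ≤ l, bitSign (W.sol u (τ j)) = bitSign (u none) *
      ∏ k ∈ Finset.range (j + 1), bitSign (u (some (Fin.ofNat (l + 1) k))) := by
    intro u j hj
    induction j with
    | zero =>
      rw [W.sol_apply, e0 _ u (hS u), bitSign_xor, Finset.prod_range_one]
    | succ j ih =>
      rw [W.sol_apply, e1 j hj, bitSign_xor, ih (by omega), Finset.prod_range_succ _ (j + 1),
        mul_assoc]
  have hobs : ∀ u, (∀ r ∈ indNodes Vm (X ∪ Y ∪ Z), W.sol u r = false) ↔
      W.sol u (τ l) = false := by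
    intro u
    refine ⟨fun hu => hu _ ((hτR l le_rfl).2 rfl), fun hu r hr => ?_⟩
    by_cases h1 : ∃ j ≤ l, τ j = r
    · obtain ⟨j, hj, rfl⟩ := h1
      rw [(hτR j hj).1 hr]
      exact hu
    · exact hN u r (fun h2 => hSR r h2 hr) fun j hj he => h1 ⟨j, hj, he⟩
  -- The bit at the end of the trail is the sum of all noises, so R_W = 1 says that their parity is
  -- even. This is the event of `bitLaw_parity`.
  have hobs' : {u | ∀ r ∈ indNodes Vm (X ∪ Y ∪ Z), W.sol u r = false} =
      {u : Option (Fin (l + 1)) → Bool | ∏ e, bitSign (u e) = 1} := by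
    ext u
    have h1 : ∏ e, bitSign (u e) = bitSign (W.sol u (τ l)) := by
      rw [Fintype.prod_option, hprod u l le_rfl, ← Fin.prod_univ_eq_prod_range
        (fun k => bitSign (u (some (Fin.ofNat (l + 1) k))))]
      simp
    rw [Set.mem_ofPred_eq, Set.mem_ofPred_eq, hobs, h1]
    cases W.sol u (τ l) <;> norm_num [bitSign]
  have hYn : ∀ n ∈ varNodes Vm Y, n ∉ S → ∀ b u, W.eqn n b u = false := by
    intro n hn hnS
    refine eN n hnS ?_
    rintro j hj rfl
    rcases Nat.eq_zero_or_pos j with rfl | hj0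
    · exact notMem_varNodes_of_disjoint hXY _ hτX hn
    · exact hτY j hj0 hj hn
  have key := W.adjustment_eq h (fun _ => false) (fun b => b z = false) ?_ ?_
    fun b b' hb => by rw [hb z hz]
  · have hdo : {u | ∀ n ∈ varNodes Vm Y, W.doSol X (fun _ => false) u n = false} =
        {u | u none = false} := by
      ext u
      have hc := hcopy _ u fun i hi => W.doSol_of_notMem (fun _ => false) u (hSX i hi)
      refine ⟨fun hu => (hc y hyS).symm.trans (hu y hy), fun hu n hn => ?_⟩
      by_cases hnS : n ∈ S
      · rw [hc n hnS]
        exact hu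
      · rw [W.doSol_of_notMem _ u fun hX => notMem_varNodes_of_disjoint hXY n hX hn,
          hYn n hn hnS]
    have hR : {u | (∀ r ∈ indNodes Vm (X ∪ Y ∪ Z), W.sol u r = false) ∧ W.sol u z = false} =
        {u : Option (Fin (l + 1)) → Bool | ∏ e, bitSign (u e) = 1 ∧ u none = false} := by
      ext u
      have h1 := Set.ext_iff.1 hobs' u
      rw [Set.mem_ofPred_eq, Set.mem_ofPred_eq] at h1
      rw [Set.mem_ofPred_eq, Set.mem_ofPred_eq, h1, hS u z hzS]
    rw [hdo, hobs', hR] at key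
    exact bitLaw_parity none key
  -- The private noises allow arbitrary bits on the trail. They are chosen so that the nodes of `X`
  -- become 0 while every other node keeps its bit.
  · intro u hu
    let b : MNode Vm → Bool := fun i => if i ∈ varNodes Vm X then false else W.sol u i
    let ν : ℕ → Bool := fun j => Nat.casesOn j (xor (u none) (b (τ 0)))
      fun j => xor (b (τ j)) (b (τ (j + 1)))
    let u' : Option (Fin (l + 1)) → Bool := fun e => Option.casesOn e (u none) fun j => ν j
    have hν : ∀ j ≤ l, u' (some (Fin.ofNat (l + 1) j)) = ν j := by
      intro j hj
      have : (Fin.ofNat (l + 1) j).val = j := by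
        rw [Fin.val_ofNat, Nat.mod_eq_of_lt (by omega)]
      exact congrArg ν this
    have hbS : ∀ i ∈ S, b i = u none := by
      intro i hi
      simp only [b, if_neg (hSX i hi), hS u i hi]
    have hxor : ∀ a c : Bool, xor a (xor a c) = c := by decide
    have hb : W.sol u' = b := by
      refine W.sol_eq fun i => ?_
      by_cases hi : i ∈ S
      · rw [hbS i hi]
        by_cases hiT : i ∈ T
        · rw [eT i hi hiT]
        · obtain ⟨j, hj, -, he⟩ := eS i hi hiT
          rw [he, hbS j hj]
      · by_cases hj : ∃ j ≤ l, τ j = i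
        · obtain ⟨j, hj, rfl⟩ := hj
          cases j with
          | zero =>
            rw [e0 b u' hbS, hν 0 hj]
            exact (hxor _ _).symm
          | succ j =>
            rw [e1 j hj, hν _ hj]
            exact (hxor _ _).symm
        · have hj' : ∀ j ≤ l, τ j ≠ i := fun j h1 h2 => hj ⟨j, h1, h2⟩
          rw [eN i hi hj']
          simp only [b, hN u i hi hj', ite_self]
    refine ⟨u', fun r hr => ?_, fun n hn => ?_, fun n hn => ?_⟩
    · rw [hb]
      simp only [b, hu r hr, ite_self]
    · rw [hb]
      simp only [b, if_neg fun hX => notMem_varNodes_of_disjoint hXZ n hX hn]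
    · rw [hb]
      simp only [b, if_pos hn]
  · intro u _ _
    rw [hS u z hzS]
    refine ⟨fun hY => (hS u y hyS).symm.trans (hY y hy), fun h0 n hn => ?_⟩
    by_cases hnS : n ∈ S
    · rw [hS u n hnS, h0]
    · rw [W.sol_apply, hYn n hn hnS]

/-- A lowest violating `x` is used, with a shortest directed walk `τ` from it to `R_W`. The nodes on
the walks from the common source to `Y` and towards `x` form the set `S` of `not_trail`; the
conditions already shown necessary provide its hypotheses. -/
theorem not_backSource (hXY : Disjoint X Y) (hXZ : Disjoint X Z) (hYZ : Disjoint Y Z)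
    (h : G.IsMAdjustmentSet X Y Z) :
    ∀ x ∈ varNodes Vm X, G.toADMG.AncOf (indNodes Vm (X ∪ Y ∪ Z)) x →
      ¬ G.toADMG.BackSource (varNodes Vm X) (varNodes Vm Y) x := by
  classical
  by_contra! hcon
  have hconn := h.not_conn hXY hXZ hYZ
  have hshared := h.not_sharedSource
  set A := varNodes Vm X with hA
  set B := varNodes Vm Y with hB
  set R := indNodes Vm (X ∪ Y ∪ Z) with hR
  set C := varNodes Vm Z ∪ R with hC
  set H := G.toADMG.removeIn A with hH
  have hAB : ∀ a ∈ A, a ∉ B := fun a ha hb => notMem_varNodes_of_disjoint hXY a ha hb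
  have hAC : ∀ a ∈ A, a ∉ C := by
    rintro a ha (hz | hr)
    · exact notMem_varNodes_of_disjoint hXZ a ha hz
    · exact notMem_varNodes_of_indNodes a hr ha
  have hBC : ∀ a ∈ B, a ∉ C := by
    rintro a ha (hz | hr)
    · exact notMem_varNodes_of_disjoint hYZ a ha hz
    · exact notMem_varNodes_of_indNodes a hr ha
  -- a violation without a violation below it
  have hwf : WellFounded fun a b => Relation.TransGen G.dir b a := by
    have : IsTrans (MNode Vm) fun a b => Relation.TransGen G.dir b a :=
      ⟨fun _ _ _ h1 h2 => h2.trans h1⟩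
    have : Std.Irrefl fun a b => Relation.TransGen G.dir b a := ⟨G.acyclic⟩
    exact Finite.wellFounded_of_trans_of_irrefl _
  obtain ⟨x, ⟨hx, hxR, hxb⟩, hmin⟩ := hwf.has_min
    {x | x ∈ A ∧ G.toADMG.AncOf R x ∧ G.toADMG.BackSource A B x} hcon
  set l := G.toADMG.depth R x with hl
  set τ : ℕ → MNode Vm := fun j => (G.toADMG.next R)^[j] x with hτ
  have hdir : ∀ j < l, G.dir (τ j) (τ (j + 1)) := fun j hj => hxR.dir_iterate_next hj
  have hτR : ∀ j ≤ l, τ j ∈ R ↔ j = l := by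
    intro j hj
    refine ⟨fun h1 => ?_, ?_⟩
    · by_contra hne
      exact hxR.iterate_next_notMem (lt_of_le_of_ne hj hne) h1
    · rintro rfl
      exact hxR.iterate_next_depth_mem
  have hinj : ∀ i j, i ≤ l → j ≤ l → τ i = τ j → i = j := by
    intro i j hi hj hij
    have e1 := (hxR.iterate_next hi).2
    have e2 := (hxR.iterate_next hj).2
    have hij' : (G.toADMG.next R)^[i] x = (G.toADMG.next R)^[j] x := hij
    rw [hij'] at e1
    omega
  have hdesc : ∀ j ≤ l, G.toADMG.Desc x (τ j) := fun j hj => hxR.desc_iterate_next hj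
  have hstrict : ∀ j, 0 < j → j ≤ l → Relation.TransGen G.dir x (τ j) := by
    intro j hj0 hj
    obtain ⟨k, rfl⟩ := Nat.exists_eq_succ_of_ne_zero hj0.ne'
    exact Relation.TransGen.tail' (hdesc k (by omega)) (hdir k hj)
  -- A free ancestor of `Y` on the trail would share a source with an indicator, or with an element
  -- of `X` strictly below `x` that is above `R`; the latter contradicts the choice of `x`.
  have hτD : ∀ j, 0 < j → j ≤ l → τ j ∉ G.toADMG.freeAnc A B := by
    intro j hj0 hj hD
    obtain ⟨r, hr, hjr⟩ := (hxR.iterate_next hj).1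
    rcases Desc.removeIn_or (X := A) hjr with h1 | ⟨p, x', hx', h1, h2, h3⟩
    · exact hshared ⟨_, hD, _, hD.1, Or.inl rfl, r, hr, h1⟩
    · refine hmin x' ⟨hx', ⟨r, hr, h3⟩, Or.inr ⟨_, hD, _, hD.1, Or.inl rfl, p, h1, h2⟩⟩ ?_
      exact (hstrict j hj0 hj).trans (Relation.TransGen.tail' (Desc.of_removeIn h1) h2)
  have hτY : ∀ j, 0 < j → j ≤ l → τ j ∉ B := fun j hj0 hj hB =>
    hτD j hj0 hj (freeAnc_of_mem hB fun ha => hAB _ ha hB)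
  have hvar : ∀ {i n}, n ∈ A ∨ n ∈ B → G.toADMG.Desc i n → i ∉ R := by
    rintro i n hn hi ⟨r, -, rfl⟩
    have : ∃ v, n = Sum.inl v := by
      rcases hn with ⟨v, -, rfl⟩ | ⟨v, -, rfl⟩ <;> exact ⟨v, rfl⟩
    obtain ⟨v, rfl⟩ := this
    obtain ⟨w, hw⟩ := G.exists_inl_of_desc hi
    cases hw
  rcases hxb with ⟨d, ⟨hdA, y, hy, hdy⟩, hxd⟩ | ⟨d, ⟨hdA, y, hy, hdy⟩, t, htA, htd, p, htp, hpx⟩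
  · set S := H.between d y with hS
    have hSX : ∀ i ∈ S, i ∉ A := fun i hi => Desc.notMem_of_removeIn hi.1 hdA
    have hSR : ∀ i ∈ S, i ∉ R := fun i hi => hvar (Or.inr hy) (Desc.of_removeIn hi.2)
    have hdS : d ∈ S := ⟨Relation.ReflTransGen.refl, hdy⟩
    have hτS : ∀ j ≤ l, τ j ∉ S := by
      intro j hj hjS
      rcases Nat.eq_zero_or_pos j with rfl | hj0
      · exact hSX _ hjS hx
      · exact hτD j hj0 hj ⟨hSX _ hjS, y, hy, hjS.2⟩
    -- Without an element of `Z` in `S`, the walk x ↔ d → ⋯ → y would be open, contrary to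
    -- `not_conn`.
    obtain ⟨z, hzS, hz⟩ : ∃ z ∈ S, z ∈ varNodes Vm Z := by
      by_contra! hno
      have hSC : ∀ i ∈ S, i ∉ C := by
        rintro i hi (hz | hr)
        · exact hno i hi hz
        · exact hSR i hi hr
      have r0 : Reach (G.toADMG.removeCausal A B) G.toADMG C B 0 false y := Reach.start hy
      obtain ⟨w, r1⟩ := r0.up (removeCausal_between hSC hdA hdy)
      have r2 := r1.step (k := EdgeKind.bidir) (n' := x) (G.bi_symm _ _ hxd)
        (by rw [Bool.false_and]; exact jopen_false.2 (hSC d hdS))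
      exact hconn ⟨x, _, _, _, _, Reach.start hx, r2,
        by rw [Bool.false_and]; exact jopen_false.2 (hAC x hx)⟩
    have hxd' : x ≠ d := fun he => hdA (he ▸ hx)
    refine h.not_trail hXY hXZ (τ := τ) (S := S) (T := {d, x}) (q := none) hinj hdir hx hτY hτR
      hτS ?_ ?_ ?_ (Or.inl ⟨Or.inr rfl, rfl⟩) hSX hSR ⟨hdy, Relation.ReflTransGen.refl⟩ hy hzS hz
    · rintro i (rfl | rfl)
      · exact Or.inr hdS
      · exact Or.inl rfl
    · rintro i (rfl | rfl) j (rfl | rfl) hij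
      · exact absurd rfl hij
      · exact G.bi_symm _ _ hxd
      · exact hxd
      · exact absurd rfl hij
    · intro i hi hiT
      obtain ⟨j, hj, hji⟩ := between_exists_parent hi fun he => hiT (Or.inl he)
      exact ⟨j, hj, hji.1⟩
  · set S := H.between d y ∪ H.between t p with hS
    have hSX : ∀ i ∈ S, i ∉ A := by
      rintro i (hi | hi)
      · exact Desc.notMem_of_removeIn hi.1 hdA
      · exact Desc.notMem_of_removeIn hi.1 htA
    have hSR : ∀ i ∈ S, i ∉ R := by
      rintro i (hi | hi)
      · exact hvar (Or.inr hy) (Desc.of_removeIn hi.2)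
      · exact hvar (Or.inl hx) ((Desc.of_removeIn hi.2).tail hpx)
    have hdS : d ∈ S := Or.inl ⟨Relation.ReflTransGen.refl, hdy⟩
    have htS : t ∈ S := Or.inr ⟨Relation.ReflTransGen.refl, htp⟩
    have hpS : p ∈ S := Or.inr ⟨htp, Relation.ReflTransGen.refl⟩
    have hτS : ∀ j ≤ l, τ j ∉ S := by
      intro j hj hjS
      rcases Nat.eq_zero_or_pos j with rfl | hj0
      · exact hSX _ hjS hx
      · rcases hjS with hjS | hjS
        · exact hτD j hj0 hj ⟨hSX _ (Or.inl hjS), y, hy, hjS.2⟩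
        · exact G.acyclic x ((hstrict j hj0 hj).trans
            (Relation.TransGen.tail' (Desc.of_removeIn hjS.2) hpx))
    -- Without an element of `Z` in `S`, the walk from `x` up through `p` to `t`, over to `d` and
    -- down to `y` would be open.
    obtain ⟨z, hzS, hz⟩ : ∃ z ∈ S, z ∈ varNodes Vm Z := by
      by_contra! hno
      have hSC : ∀ i ∈ S, i ∉ C := by
        rintro i hi (hz | hr)
        · exact hno i hi hz
        · exact hSR i hi hr
      have r0 : Reach (G.toADMG.removeCausal A B) G.toADMG C B 0 false y := Reach.start hy
      obtain ⟨w, r1⟩ := r0.up (removeCausal_between (fun i hi => hSC i (Or.inl hi)) hdA hdy)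
      have s0 : Reach (G.toADMG.removeCausal A B) G.toADMG C A 0 false x := Reach.start hx
      have s1 := s0.step (k := EdgeKind.bwd) (n' := p) (removeCausal_dir hpx (hSX p hpS))
        (by rw [Bool.false_and]; exact jopen_false.2 (hAC x hx))
      obtain ⟨w', s2⟩ := s1.up (removeCausal_between (fun i hi => hSC i (Or.inr hi)) htA htp)
      rcases htd with rfl | htd
      · exact hconn (s2.conn r1 (hSC _ hdS))
      · have s3 := s2.step (k := EdgeKind.bidir) (n' := d) htd
          (by rw [Bool.false_and]; exact jopen_false.2 (hSC t htS))
        exact hconn (s3.conn r1 (hSC _ hdS))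
    have hxS : x ∉ S := fun hS => hSX x hS hx
    have hTS : ({d, t} : Set (MNode Vm)) ⊆ S := by
      rintro i (rfl | rfl)
      · exact hdS
      · exact htS
    refine h.not_trail hXY hXZ (τ := τ) (S := S) (T := {d, t}) (q := some p) hinj hdir hx hτY
      hτR hτS (fun i hi => Or.inr (hTS hi)) ?_ ?_
      (Or.inr ⟨fun hxT => hxS (hTS hxT), p, hpS, rfl, hpx⟩) hSX hSR
      (Or.inl ⟨hdy, Relation.ReflTransGen.refl⟩) hy hzS hz
    · rintro i (rfl | rfl) j (rfl | rfl) hij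
      · exact absurd rfl hij
      · exact G.bi_symm _ _ (htd.resolve_left fun he => hij he.symm)
      · exact htd.resolve_left hij
      · exact absurd rfl hij
    · rintro i (hi | hi) hiT
      · obtain ⟨j, hj, hji⟩ := between_exists_parent hi fun he => hiT (Or.inl he)
        exact ⟨j, Or.inl hj, hji.1⟩
      · obtain ⟨j, hj, hji⟩ := between_exists_parent hi fun he => hiT (Or.inr he)
        exact ⟨j, Or.inr hj, hji.1⟩

/-- Completeness of the walk form of the criterion. -/
theorem walkCriterion (hXY : Disjoint X Y) (hXZ : Disjoint X Z) (hYZ : Disjoint Y Z)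
    (h : G.IsMAdjustmentSet X Y Z) : G.WalkCriterion X Y Z where
  no_forbidden := h.no_forbidden hXY hXZ
  not_conn := h.not_conn hXY hXZ hYZ
  not_shared := h.not_sharedSource
  not_back := h.not_backSource hXY hXZ hYZ

end MGraph.IsMAdjustmentSet

theorem theorem1 {V : Type*} [Fintype V] [DecidableEq V] {Vm : Finset V}
    (G : MGraph V Vm) (X Y Z : Finset V)
    (hXY : Disjoint X Y) (hXZ : Disjoint X Z) (hYZ : Disjoint Y Z) :
    G.IsMAdjustmentSet X Y Z ↔ G.MAdjustmentCriterion X Y Z := by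
  rw [G.mAdjustmentCriterion_iff hXY hXZ hYZ]
  exact ⟨fun h => h.walkCriterion hXY hXZ hYZ, fun h => h.isMAdjustmentSet hXY hXZ hYZ⟩
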